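/- **Integrability of the Cartan–Dirac structure.** Let $G$ be a (real, finite-dimensional) Lie group with Lie algebra $\mathfrak g$, and let $B$ be a non-degenerate symmetric bilinear form on $\mathfrak g$ that is invariant under the adjoint action, $B(\mathrm{Ad}_g\xi,\mathrm{Ad}_g\zeta)=B(\xi,\zeta)$. Let $\theta^L,\theta^R\in\Omega^1(G)\otimes\mathfrak g$ be the Maurer–Cartan forms, $\xi^L,\xi^R$ the left- and right-invariant vector fields defined by $\xi\in\mathfrak g$, and let $$\eta=\tfrac1{12}B(\theta^L,[\theta^L,\theta^L])\in\Omega^3(G)$$ be the Cartan 3-form. On $\mathbb TG=TG\oplus T^*G$ consider the pairing $\langle v_1\oplus\alpha_1,v_2\oplus\alpha_2\rangle=\alpha_1(v_2)+\alpha_2(v_1)$ and the Clifford action $\rho(v\oplus\alpha)\gamma=\iota_v\gamma+\alpha\wedge\gamma$ on differential forms. Let $E\subset\mathbb TG$ be the Cartan–Dirac sub-bundle, spanned by the sections $$e(\xi)=(\xi^L-\xi^R)\oplus B\big(\tfrac{\theta^L+\theta^R}{2},\xi\big),\qquad \xi\in\mathfrak g.$$ Suppose that $G$ admits a bi-invariant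 volume form $\mu\ne0$ (equivalently, a bi-invariant orientation), and that $\mathrm{Ad}\colon G\to \mathrm O(\mathfrak g)$ lifts to a homomorphism of Lie groups $\widetilde{\mathrm{Ad}}\colon G\to\mathrm{Pin}(\mathfrak g)$. Here $\mathrm{Cl}(\mathfrak g)$ is the Clifford algebra with relations $\xi\zeta+\zeta\xi=B(\xi,\zeta)$, with parity automorphism $\Pi$ and canonical anti-automorphism $\top$; $\mathrm{Pin}(\mathfrak g)$ is the group of invertible $x\in\mathrm{Cl}(\mathfrak g)$ such that $y\mapsto\Pi(x)yx^{-1}$ preserves $\mathfrak g$ and $x^\top x=\pm1$; and the lifting condition is $\Pi(\widetilde{\mathrm{Ad}}_g)\,\xi\,\widetilde{\mathrm{Ad}}{}_g^{-1}=\mathrm{Ad}_g\xi$ for $\xi\in\mathfrak g$. Let $\varrho$ be the algebra homomorphism $\mathrm{Cl}(\mathfrak g)\to\mathrm{End}(\wedge\mathfrak g^*)$ extending $\xi\mapsto\iota_\xi+\tfrac12B(\xi,\cdot)\wedge$, and let $\phi\in\Omega(G)$ be the differential form given in the left trivialization $\theta^L_g\colon T_gG\cong\mathfrak g$ by $\phi_g=\varrho(\widetilde{\mathrm{Ad}}_g)\mu$.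 Then $\phi$ is a smooth differential form, invariant under conjugation; at every point it is a pure spinor with null space $\{w\in\mathbb T_gG\mid\rho(w)\phi_g=0\}=E_g$; and $$(d+\eta)\phi=0.$$ Hence $E$ is a Dirac structure twisted by $\eta$: the form $\eta$ is smooth and closed, $E$ is a smooth sub-bundle of $\mathbb TG$ with $E=E^\perp$, and $E$ is Courant integrable relative to $\eta$, that is, for every smooth form $\phi'$ on an open set $U\subset G$ that is at each point of $U$ a pure spinor with null space $E$, one has $$\rho(w_0)\rho(w_1)\rho(w_2)\,(d+\eta)\phi'=0\quad\text{at every } x\in U,\text{ for all } w_0,w_1,w_2\in E_x .$$ -/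

import Mathlib

open scoped Manifold ContDiff

noncomputable section

namespace CartanDirac

/-! ### Linear Dirac geometry and spinors -/

section Linear

variable (V : Type*) [AddCommGroup V] [Module ℝ V]

/-- The space `𝕍 = V ⊕ V*`. -/
abbrev Double : Type _ := V × Module.Dual ℝ V

/-- The contravariant spinor module: inhomogeneous alternating forms `(φ₀, φ₁, φ₂, …)` on `V`.
For finite-dimensional `V` the components of degree `> dim V` vanish, and this is `⋀ V*`. -/
abbrev Spinor : Type _ := ∀ k : ℕ, V [⋀^Fin k]→ₗ[ℝ] ℝ

variable {V}

/-- The symmetric pairing `⟨v₁ ⊕ α₁, v₂ ⊕ α₂⟩ = α₁(v₂) + α₂(v₁)` on `V ⊕ V*`. -/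
def pairing (w₁ w₂ : Double V) : ℝ := w₁.2 w₂.1 + w₂.2 w₁.1

/-- A subspace `L` of `V ⊕ V*` is Lagrangian if it equals its own orthogonal. -/
def IsLagrangian (L : Submodule ℝ (Double V)) : Prop :=
  ∀ w : Double V, w ∈ L ↔ ∀ w' ∈ L, pairing w w' = 0

variable (V) in
/-- The quadratic form `v ⊕ α ↦ α(v) = ½ ⟨v ⊕ α, v ⊕ α⟩`. Its Clifford algebra in Mathlib's
convention (`w * w = Q w`) has the relations `w₁ w₂ + w₂ w₁ = ⟨w₁, w₂⟩`. -/
def doubleForm : QuadraticForm ℝ (Double V) :=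
  (QuadraticForm.dualProd ℝ V).comp
    (LinearMap.prod (LinearMap.snd ℝ V (Module.Dual ℝ V)) (LinearMap.fst ℝ V (Module.Dual ℝ V)))

theorem doubleForm_apply (w : Double V) : doubleForm V w = w.2 w.1 := rfl

/-- Contraction `ι(v)` on inhomogeneous forms: `(ι(v)φ)(v₁, …) = φ(v, v₁, …)`. -/
def contraction : V →ₗ[ℝ] Module.End ℝ (Spinor V) where
  toFun v :=
    { toFun := fun φ k => (φ (k + 1)).curryLeft v
      map_add' := fun _ _ => rfl
      map_smul' := fun _ _ => rfl }
  map_add' v v' := LinearMap.ext fun φ => funext fun k => map_add ((φ (k + 1)).curryLeft) v v'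
  map_smul' c v := LinearMap.ext fun φ => funext fun k => map_smul ((φ (k + 1)).curryLeft) c v

/-- The wedge product `α ∧ β` of a 1-form with a `k`-form:
`(α ∧ β)(v₀, …, vₖ) = ∑ᵢ (-1)ⁱ α(vᵢ) β(v₀, …, v̂ᵢ, …, vₖ)`. -/
def covectorWedge {k : ℕ} (α : Module.Dual ℝ V) (β : V [⋀^Fin k]→ₗ[ℝ] ℝ) :
    V [⋀^Fin (k + 1)]→ₗ[ℝ] ℝ :=
  AlternatingMap.alternatizeUncurryFin (α.smulRight β)

/-- Exterior multiplication `φ ↦ α ∧ φ` by a 1-form on inhomogeneous forms, degree by degree. -/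
def extMulComponent (α : Module.Dual ℝ V) (φ : Spinor V) : Spinor V
  | 0 => 0
  | k + 1 => covectorWedge α (φ k)

/-- Exterior multiplication by 1-forms on inhomogeneous forms. -/
def extMul : Module.Dual ℝ V →ₗ[ℝ] Module.End ℝ (Spinor V) where
  toFun α :=
    { toFun := extMulComponent α
      map_add' := fun φ ψ => by
        funext k
        cases k with
        | zero => simp [extMulComponent]
        | succ k =>
          ext v
          simp [extMulComponent, covectorWedge, AlternatingMap.alternatizeUncurryFin_apply,
            Finset.sum_add_distrib]
      map_smul' := fun c φ => by
        funext k
        cases k with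
        | zero => simp [extMulComponent]
        | succ k =>
          ext v
          simp [extMulComponent, covectorWedge, AlternatingMap.alternatizeUncurryFin_apply,
            Finset.mul_sum, mul_left_comm] }
  map_add' α β := by
    refine LinearMap.ext fun φ => funext fun k => ?_
    cases k with
    | zero => simp [extMulComponent]
    | succ k =>
      ext v
      simp [extMulComponent, covectorWedge, AlternatingMap.alternatizeUncurryFin_apply,
        add_mul, Finset.sum_add_distrib]
  map_smul' c α := by
    refine LinearMap.ext fun φ => funext fun k => ?_
    cases k with
    | zero => simp [extMulComponent]
    | succ k =>
      ext v
      simp [extMulComponent, covectorWedge, AlternatingMap.alternatizeUncurryFin_apply,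
        Finset.mul_sum, mul_assoc, mul_left_comm]

/-- The spinor action `ρ(v ⊕ α) = ι(v) + α ∧ ·` of `V ⊕ V*` on inhomogeneous forms. -/
def rho : Double V →ₗ[ℝ] Module.End ℝ (Spinor V) := contraction.coprod extMul

theorem rho_apply (w : Double V) (φ : Spinor V) :
    rho w φ = contraction w.1 φ + extMul w.2 φ := rfl

theorem contraction_contraction (v : V) (φ : Spinor V) :
    contraction v (contraction v φ) = 0 := by
  funext k
  exact AlternatingMap.curryLeft_same _ _

theorem extMul_extMul (α : Module.Dual ℝ V) (φ : Spinor V) :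
    extMul α (extMul α φ) = 0 := by
  funext k
  match k with
  | 0 => rfl
  | 1 =>
    ext v
    simp [extMul, extMulComponent, covectorWedge, AlternatingMap.alternatizeUncurryFin_apply]
  | k + 2 =>
    have h := AlternatingMap.alternatizeUncurryFin_alternatizeUncurryFinLM_comp_of_symmetric
      (f := α.smulRight (α.smulRight (φ k)))
      (fun x y => by ext v; simp [mul_left_comm])
    have h' : (AlternatingMap.alternatizeUncurryFinLM ∘ₗ α.smulRight (α.smulRight (φ k)))
        = α.smulRight (covectorWedge α (φ k)) := by
      ext x v
      simp [covectorWedge]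
    rw [h'] at h
    exact h

theorem curryLeft_covectorWedge {k : ℕ} (v : V) (α : Module.Dual ℝ V)
    (β : V [⋀^Fin (k + 1)]→ₗ[ℝ] ℝ) :
    (covectorWedge α β).curryLeft v = α v • β - covectorWedge α (β.curryLeft v) := by
  ext u
  simp only [covectorWedge, AlternatingMap.curryLeft_apply_apply,
    AlternatingMap.alternatizeUncurryFin_apply, AlternatingMap.sub_apply,
    AlternatingMap.smul_apply, LinearMap.smulRight_apply]
  rw [Fin.sum_univ_succ, sub_eq_add_neg, ← Finset.sum_neg_distrib]
  congr 1
  · simp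
  · refine Finset.sum_congr rfl fun i _ => ?_
    have : i.succ.removeNth (Matrix.vecCons v u) = Matrix.vecCons v (i.removeNth u) := by
      funext j
      cases j using Fin.cases with
      | zero => simp [Fin.removeNth_apply]
      | succ j => simp [Fin.removeNth_apply]
    rw [this]
    simp [pow_succ]

theorem contraction_extMul (v : V) (α : Module.Dual ℝ V) (φ : Spinor V) :
    contraction v (extMul α φ) + extMul α (contraction v φ) = α v • φ := by
  funext k
  cases k with
  | zero =>
    ext u
    change covectorWedge α (φ 0) (Matrix.vecCons v u) + 0 = α v * φ 0 u
    simp [covectorWedge, AlternatingMap.alternatizeUncurryFin_apply]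
  | succ k =>
    change (covectorWedge α (φ (k + 1))).curryLeft v + covectorWedge α ((φ (k + 1)).curryLeft v)
      = α v • φ (k + 1)
    rw [curryLeft_covectorWedge, sub_add_cancel]

/-- The Clifford relation `ρ(w)² = ½⟨w, w⟩`. -/
theorem rho_mul_self (w : Double V) :
    rho w * rho w = algebraMap ℝ (Module.End ℝ (Spinor V)) (doubleForm V w) := by
  refine LinearMap.ext fun φ => ?_
  have h := contraction_extMul w.1 w.2 φ
  have h1 := contraction_contraction w.1 φ
  have h2 := extMul_extMul w.2 φ
  simp only [Module.End.mul_apply, rho_apply, map_add, h1, h2, Module.algebraMap_end_apply,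
    doubleForm_apply, zero_add, add_zero]
  rw [← h, add_comm]

variable (V) in
/-- The spinor representation `ϱ : Cl(V ⊕ V*) → End(⋀ V*)`. -/
def spinorRep : CliffordAlgebra (doubleForm V) →ₐ[ℝ] Module.End ℝ (Spinor V) :=
  CliffordAlgebra.lift (doubleForm V) ⟨rho, rho_mul_self⟩

theorem spinorRep_ι (w : Double V) :
    spinorRep V (CliffordAlgebra.ι (doubleForm V) w) = rho w :=
  CliffordAlgebra.lift_ι_apply _ _ _

/-- The null space `N_φ = {w ∈ V ⊕ V* | ρ(w)φ = 0}` of a spinor. -/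
def nullSpace (φ : Spinor V) : Submodule ℝ (Double V) := LinearMap.ker (rho.flip φ)

/-- A pure spinor is a non-zero spinor whose null space is Lagrangian. -/
def IsPureSpinor (φ : Spinor V) : Prop := φ ≠ 0 ∧ IsLagrangian (nullSpace φ)

/-- The filtration defined by `L ⊆ V ⊕ V*`: `InFiltration L k γ` says that
`ρ(w₀) ⋯ ρ(wₖ) γ = 0` for all `w₀, …, wₖ ∈ L`. -/
def InFiltration (L : Submodule ℝ (Double V)) : ℕ → Spinor V → Prop
  | 0, γ => ∀ w ∈ L, rho w γ = 0
  | k + 1, γ => ∀ w ∈ L, InFiltration L k (rho w γ)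

/-- The wedge product of a `p`-form with a `q`-form,
`(α ∧ β)(v₁, …, v_{p+q}) =
  1/(p! q!) ∑_σ sgn(σ) α(v_{σ 1}, …, v_{σ p}) β(v_{σ(p+1)}, …, v_{σ(p+q)})`. -/
def wedge {p q : ℕ} (α : V [⋀^Fin p]→ₗ[ℝ] ℝ) (β : V [⋀^Fin q]→ₗ[ℝ] ℝ) :
    V [⋀^Fin (p + q)]→ₗ[ℝ] ℝ :=
  ((p.factorial : ℝ) * (q.factorial : ℝ))⁻¹ •
    MultilinearMap.alternatization
      ((((LinearMap.mul' ℝ ℝ).compMultilinearMap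
        (MultilinearMap.domCoprod α.toMultilinearMap β.toMultilinearMap))).domDomCongr
          finSumFinEquiv)

/-- Exterior multiplication `φ ↦ η ∧ φ` by a 3-form on inhomogeneous forms. -/
def threeFormMul (η : V [⋀^Fin 3]→ₗ[ℝ] ℝ) (φ : Spinor V) : Spinor V
  | 0 => 0
  | 1 => 0
  | 2 => 0
  | k + 3 => (wedge η (φ k)).domDomCongr (finCongr (Nat.add_comm 3 k))

/-- Pull-back of inhomogeneous forms under a linear map. -/
def pullback {V' : Type*} [AddCommGroup V'] [Module ℝ V'] (A : V →ₗ[ℝ] V') (φ : Spinor V') :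
    Spinor V :=
  fun k => (φ k).compLinearMap A

/-- A form of degree `n`, viewed as an inhomogeneous form. -/
def homogeneous {n : ℕ} (μ : V [⋀^Fin n]→ₗ[ℝ] ℝ) : Spinor V := Pi.single n μ

/-! ### The Clifford algebra of `(V, B)` and its Pin group -/

/-- The quadratic form `v ↦ ½ B(v, v)`; its Clifford algebra `Cl(V)` has the relations
`v₁ v₂ + v₂ v₁ = B(v₁, v₂)` when `B` is symmetric. -/
def halfForm (B : LinearMap.BilinForm ℝ V) : QuadraticForm ℝ V :=
  ((1 / 2 : ℝ) • B).toQuadraticMap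

/-- The Clifford algebra `Cl(V)` of `(V, B)`. -/
abbrev Cl (B : LinearMap.BilinForm ℝ V) : Type _ := CliffordAlgebra (halfForm B)

/-- The map `κ : V ⊕ V̄ → V ⊕ V*`, `κ(v ⊕ w) = (v - w) ⊕ ½ B(v + w, ·)`. -/
def kappa (B : LinearMap.BilinForm ℝ V) : V × V →ₗ[ℝ] Double V :=
  LinearMap.prod (LinearMap.fst ℝ V V - LinearMap.snd ℝ V V)
    ((1 / 2 : ℝ) • LinearMap.comp B (LinearMap.fst ℝ V V + LinearMap.snd ℝ V V))

/-- The isometric inclusion `V → V ⊕ V*`, `v ↦ κ(v ⊕ 0)`. -/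
def kappaInl (B : LinearMap.BilinForm ℝ V) : halfForm B →qᵢ doubleForm V where
  toLinearMap := (kappa B).comp (LinearMap.inl ℝ V V)
  map_app' v := by simp [kappa, halfForm, doubleForm_apply]

/-- The algebra homomorphism `x ↦ x^κ`, `Cl(V) → Cl(V ⊕ V*)`, induced by `κ`. -/
def cliffordKappa (B : LinearMap.BilinForm ℝ V) : Cl B →ₐ[ℝ] CliffordAlgebra (doubleForm V) :=
  CliffordAlgebra.map (kappaInl B)

theorem spinorRep_cliffordKappa_ι (B : LinearMap.BilinForm ℝ V) (v : V) :
    spinorRep V (cliffordKappa B (CliffordAlgebra.ι (halfForm B) v)) =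
      rho (v, (1 / 2 : ℝ) • B v) := by
  rw [cliffordKappa, CliffordAlgebra.map_apply_ι, spinorRep_ι]
  congr 1
  change kappa B (v, 0) = _
  simp [kappa]

/-- The Clifford group `Γ(V)`: the invertible `x ∈ Cl(V)` such that `y ↦ Π(x) y x⁻¹` preserves
the subspace `V ⊆ Cl(V)`, where `Π` is the parity automorphism. -/
def cliffordGroup (B : LinearMap.BilinForm ℝ V) : Subgroup (Cl B)ˣ where
  carrier := {x | ∀ y : Cl B, y ∈ LinearMap.range (CliffordAlgebra.ι (halfForm B)) ↔
    CliffordAlgebra.involute (x : Cl B) * y * (↑x⁻¹ : Cl B) ∈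
      LinearMap.range (CliffordAlgebra.ι (halfForm B))}
  one_mem' y := by simp
  mul_mem' {a b} ha hb y := by
    rw [hb y, ha]
    simp [mul_assoc]
  inv_mem' {a} ha y := by
    have h1 : CliffordAlgebra.involute (a : Cl B) * CliffordAlgebra.involute (↑a⁻¹ : Cl B) = 1 := by
      rw [← map_mul]; simp
    rw [ha (CliffordAlgebra.involute (↑a⁻¹ : Cl B) * y * (↑a⁻¹⁻¹ : Cl B))]
    rw [show CliffordAlgebra.involute (a : Cl B) *
        (CliffordAlgebra.involute (↑a⁻¹ : Cl B) * y * (↑a⁻¹⁻¹ : Cl B)) * (↑a⁻¹ : Cl B)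
        = (CliffordAlgebra.involute (a : Cl B) * CliffordAlgebra.involute (↑a⁻¹ : Cl B)) * y *
          ((↑a⁻¹⁻¹ : Cl B) * (↑a⁻¹ : Cl B)) by simp only [mul_assoc], h1]
    simp

/-- The Pin group `Pin(V) = {x ∈ Γ(V) | xᵀ x = ±1}`, with `xᵀ` the canonical anti-automorphism
`(v₁ ⋯ vₖ)ᵀ = vₖ ⋯ v₁`. -/
def pinGroup (B : LinearMap.BilinForm ℝ V) : Subgroup (Cl B)ˣ where
  carrier := {x | x ∈ cliffordGroup B ∧
    (CliffordAlgebra.reverse (x : Cl B) * (x : Cl B) = 1 ∨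
      CliffordAlgebra.reverse (x : Cl B) * (x : Cl B) = -1)}
  one_mem' := ⟨one_mem _, Or.inl (by simp)⟩
  mul_mem' {a b} ha hb := by
    refine ⟨mul_mem ha.1 hb.1, ?_⟩
    have h : CliffordAlgebra.reverse ((a * b : (Cl B)ˣ) : Cl B) * ((a * b : (Cl B)ˣ) : Cl B)
        = CliffordAlgebra.reverse (b : Cl B) *
          (CliffordAlgebra.reverse (a : Cl B) * (a : Cl B)) * (b : Cl B) := by
      simp [CliffordAlgebra.reverse.map_mul, mul_assoc]
    rw [h]
    rcases ha.2 with h1 | h1 <;> rcases hb.2 with h2 | h2 <;> rw [h1] <;> simp [h2]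
  inv_mem' {a} ha := by
    refine ⟨inv_mem ha.1, ?_⟩
    have key : ∀ c : Cl B, c * c = 1 → (∀ z, c * z = z * c) →
        CliffordAlgebra.reverse (a : Cl B) * (a : Cl B) = c →
        CliffordAlgebra.reverse (↑a⁻¹ : Cl B) * (↑a⁻¹ : Cl B) = c := by
      intro c hc hcomm h
      have h1 : CliffordAlgebra.reverse (a : Cl B) = c * (↑a⁻¹ : Cl B) := by
        rw [← h, mul_assoc, Units.mul_inv, mul_one]
      have h2 : CliffordAlgebra.reverse (↑a⁻¹ : Cl B) * CliffordAlgebra.reverse (a : Cl B) = 1 := by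
        rw [← CliffordAlgebra.reverse.map_mul, Units.mul_inv, CliffordAlgebra.reverse.map_one]
      rw [h1, ← mul_assoc, ← hcomm, mul_assoc] at h2
      calc CliffordAlgebra.reverse (↑a⁻¹ : Cl B) * (↑a⁻¹ : Cl B)
          = c * c * (CliffordAlgebra.reverse (↑a⁻¹ : Cl B) * (↑a⁻¹ : Cl B)) := by rw [hc, one_mul]
        _ = c := by rw [mul_assoc, h2, mul_one]
    rcases ha.2 with h | h
    · exact Or.inl (key 1 (by simp) (by simp) h)
    · exact Or.inr (key (-1) (by simp) (by simp) h)

/-- `x` is a lift of `A ∈ GL(V)`: the transformation `y ↦ Π(x) y x⁻¹` restricts to `A` on `V`. -/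
def IsLiftOf (B : LinearMap.BilinForm ℝ V) (x : (Cl B)ˣ) (A : V →ₗ[ℝ] V) : Prop :=
  ∀ v : V, CliffordAlgebra.involute (x : Cl B) * CliffordAlgebra.ι (halfForm B) v * (↑x⁻¹ : Cl B)
    = CliffordAlgebra.ι (halfForm B) (A v)

/-- Alternating maps on a finite-dimensional normed space are continuous. -/
theorem continuous_alternatingMap {E : Type*} [NormedAddCommGroup E] [NormedSpace ℝ E]
    [FiniteDimensional ℝ E] {k : ℕ} (β : E [⋀^Fin k]→ₗ[ℝ] ℝ) : Continuous fun v => β v := by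
  let b := Module.finBasis ℝ E
  have h : ∀ v : Fin k → E, β v = ∑ r : Fin k → Fin (Module.finrank ℝ E),
      (∏ i, b.repr (v i) (r i)) * β (fun i => b (r i)) := by
    intro v
    have hv : v = fun i => ∑ j, b.repr (v i) j • b j :=
      funext fun i => (b.sum_repr (v i)).symm
    have h1 := β.toMultilinearMap.map_sum (fun i j => b.repr (v i) j • b j)
    rw [← hv] at h1
    refine h1.trans (Finset.sum_congr rfl fun r _ => ?_)
    exact β.toMultilinearMap.map_smul_univ _ _
  rw [show (fun v => β v) = _ from funext h]
  refine continuous_finsetSum _ fun r _ => Continuous.mul ?_ continuous_const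
  refine continuous_finsetProd _ fun i _ => ?_
  exact ((b.coord (r i)).continuous_of_finiteDimensional).comp (continuous_apply i)

/-- An alternating map on a finite-dimensional normed space as a continuous alternating map. -/
def toContinuousAlternating {E : Type*} [NormedAddCommGroup E] [NormedSpace ℝ E]
    [FiniteDimensional ℝ E] {k : ℕ} (β : E [⋀^Fin k]→ₗ[ℝ] ℝ) : E [⋀^Fin k]→L[ℝ] ℝ :=
  { β with cont := continuous_alternatingMap β }

end Linear

/-! ### Differential forms and Dirac structures on manifolds -/

section Manifold

variable {E : Type*} [NormedAddCommGroup E] [NormedSpace ℝ E] [FiniteDimensional ℝ E]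
  {M : Type*} [TopologicalSpace M] [ChartedSpace E M]

variable (E M) in
/-- (Not necessarily smooth) `k`-forms on `M`. -/
abbrev FormField (k : ℕ) : Type _ := ∀ x : M, TangentSpace 𝓘(ℝ, E) x [⋀^Fin k]→ₗ[ℝ] ℝ

variable (E M) in
/-- (Not necessarily smooth) inhomogeneous differential forms on `M`. -/
abbrev SpinorField : Type _ := ∀ x : M, Spinor (TangentSpace 𝓘(ℝ, E) x)

/-- The expression of a `k`-form in the preferred chart at `x₀`, i.e. its pull-back under the
inverse of the chart. (Only its values on the target of the chart are meaningful.) -/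
def formInChart {k : ℕ} (x₀ : M) (β : FormField E M k) (y : E) : E [⋀^Fin k]→L[ℝ] ℝ :=
  toContinuousAlternating
    ((β ((extChartAt 𝓘(ℝ, E) x₀).symm y)).compLinearMap
      (mfderiv 𝓘(ℝ, E) 𝓘(ℝ, E) (extChartAt 𝓘(ℝ, E) x₀).symm y).toLinearMap)

/-- Smoothness of a `k`-form on an open subset `U` of `M`. -/
def IsSmoothFormOn {k : ℕ} (β : FormField E M k) (U : Set M) : Prop :=
  ∀ x₀ : M, ContDiffOn ℝ ∞ (formInChart x₀ β)
    ((extChartAt 𝓘(ℝ, E) x₀).target ∩ (extChartAt 𝓘(ℝ, E) x₀).symm ⁻¹' U)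

/-- Smoothness of an inhomogeneous form on an open subset `U` of `M`. -/
def IsSmoothSpinorOn (φ : SpinorField E M) (U : Set M) : Prop :=
  ∀ k : ℕ, IsSmoothFormOn (fun x => φ x k) U

/-- The exterior derivative of a `k`-form on `M`, computed at each point in the preferred chart
at this point. -/
def extD {k : ℕ} (β : FormField E M k) : FormField E M (k + 1) := fun x =>
  (extDeriv (formInChart x β) (extChartAt 𝓘(ℝ, E) x x)).toAlternatingMap.compLinearMap
    (mfderiv 𝓘(ℝ, E) 𝓘(ℝ, E) (extChartAt 𝓘(ℝ, E) x) x).toLinearMap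

/-- The exterior derivative of an inhomogeneous form. -/
def extDSpinor (φ : SpinorField E M) : SpinorField E M := fun x k =>
  match k with
  | 0 => 0
  | k + 1 => extD (fun x => φ x k) x

/-- `(d + η)φ = dφ + η ∧ φ`. -/
def twistedD (η : FormField E M 3) (φ : SpinorField E M) : SpinorField E M := fun x =>
  extDSpinor φ x + threeFormMul (η x) (φ x)

variable (E M) in
/-- A family of subspaces of the fibres of `𝕋M = TM ⊕ T*M`. -/
abbrev SubspaceField : Type _ := ∀ x : M, Submodule ℝ (Double (TangentSpace 𝓘(ℝ, E) x))

variable [IsManifold 𝓘(ℝ, E) ∞ M]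

/-- Smoothness on an open set `U` of a section of `𝕋M = TM ⊕ T*M`: its vector field part and its
1-form part are smooth. -/
def IsSmoothSectionOn (w : ∀ x : M, Double (TangentSpace 𝓘(ℝ, E) x)) (U : Set M) : Prop :=
  ContMDiffOn 𝓘(ℝ, E) 𝓘(ℝ, E).tangent ∞
      (fun x => (⟨x, (w x).1⟩ : TangentBundle 𝓘(ℝ, E) M)) U ∧
    IsSmoothFormOn
      (fun x => AlternatingMap.ofSubsingleton ℝ (TangentSpace 𝓘(ℝ, E) x) ℝ (0 : Fin 1) (w x).2) U

/-- `L` is a smooth sub-bundle of `𝕋M`: it has smooth frames near every point. -/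
def IsSmoothSubbundle (L : SubspaceField E M) : Prop :=
  ∀ x₀ : M, ∃ U : Set M, IsOpen U ∧ x₀ ∈ U ∧
    ∃ (r : ℕ) (w : Fin r → ∀ x : M, Double (TangentSpace 𝓘(ℝ, E) x)),
      (∀ i, IsSmoothSectionOn (w i) U) ∧
        ∀ x ∈ U, LinearIndependent ℝ (fun i => w i x) ∧
          Submodule.span ℝ (Set.range fun i => w i x) = L x

/-- An almost Dirac structure: a Lagrangian sub-bundle of `𝕋M`. -/
def IsAlmostDirac (L : SubspaceField E M) : Prop :=
  IsSmoothSubbundle L ∧ ∀ x, IsLagrangian (L x)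

/-- Courant integrability of `L` relative to `η`: for every pure spinor `φ`, defined over an open
set `U`, with `N_φ = L`, the class of `(d + η)φ` in `gr³ = Ω⁽³⁾/Ω⁽²⁾` vanishes, that is,
`(d + η)φ ∈ Ω⁽²⁾`. -/
def IsIntegrable (L : SubspaceField E M) (η : FormField E M 3) : Prop :=
  ∀ (U : Set M) (φ : SpinorField E M), IsOpen U → IsSmoothSpinorOn φ U →
    (∀ x ∈ U, IsPureSpinor (φ x) ∧ nullSpace (φ x) = L x) →
      ∀ x ∈ U, InFiltration (L x) 2 (twistedD η φ x)

/-- `L` is a Dirac structure on `M` twisted by the closed 3-form `η`. -/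
def IsDirac (L : SubspaceField E M) (η : FormField E M 3) : Prop :=
  IsSmoothFormOn η Set.univ ∧ (∀ x, extD η x = 0) ∧ IsAlmostDirac L ∧ IsIntegrable L η

end Manifold

/-! ### The Cartan-Dirac structure on a Lie group -/

section LieGroup

variable {E : Type*} [NormedAddCommGroup E] [NormedSpace ℝ E]
  {G : Type*} [TopologicalSpace G] [ChartedSpace E G] [Group G]

variable (E) in
/-- The left-invariant Maurer-Cartan form `θᴸ_g : T_gG → 𝔤`. -/
def thetaL (g : G) : TangentSpace 𝓘(ℝ, E) g →ₗ[ℝ] GroupLieAlgebra 𝓘(ℝ, E) G :=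
  (mfderiv 𝓘(ℝ, E) 𝓘(ℝ, E) (fun h : G => g⁻¹ * h) g).toLinearMap

variable (E) in
/-- The right-invariant Maurer-Cartan form `θᴿ_g : T_gG → 𝔤`. -/
def thetaR (g : G) : TangentSpace 𝓘(ℝ, E) g →ₗ[ℝ] GroupLieAlgebra 𝓘(ℝ, E) G :=
  (mfderiv 𝓘(ℝ, E) 𝓘(ℝ, E) (fun h : G => h * g⁻¹) g).toLinearMap

/-- The value at `g` of the left-invariant vector field `ξᴸ`, linearly in `ξ`. -/
def leftField (g : G) : GroupLieAlgebra 𝓘(ℝ, E) G →ₗ[ℝ] TangentSpace 𝓘(ℝ, E) g :=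
  (mfderiv 𝓘(ℝ, E) 𝓘(ℝ, E) (fun h : G => g * h) 1).toLinearMap

/-- The value at `g` of the right-invariant vector field `ξᴿ`, linearly in `ξ`. -/
def rightField (g : G) : GroupLieAlgebra 𝓘(ℝ, E) G →ₗ[ℝ] TangentSpace 𝓘(ℝ, E) g :=
  (mfderiv 𝓘(ℝ, E) 𝓘(ℝ, E) (fun h : G => h * g) 1).toLinearMap

variable (E) in
/-- The adjoint action `Ad_g : 𝔤 → 𝔤`. -/
def Ad (g : G) : GroupLieAlgebra 𝓘(ℝ, E) G →ₗ[ℝ] GroupLieAlgebra 𝓘(ℝ, E) G :=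
  (mfderiv 𝓘(ℝ, E) 𝓘(ℝ, E) (fun h : G => g * h * g⁻¹) 1).toLinearMap

/-- The map `e(ξ) = (ξᴸ - ξᴿ) ⊕ B((θᴸ + θᴿ)/2, ξ)` at the point `g`. -/
def cartanMap (B : LinearMap.BilinForm ℝ (GroupLieAlgebra 𝓘(ℝ, E) G)) (g : G) :
    GroupLieAlgebra 𝓘(ℝ, E) G →ₗ[ℝ] Double (TangentSpace 𝓘(ℝ, E) g) :=
  LinearMap.prod (leftField g - rightField g)
    (B.compl₁₂ ((1 / 2 : ℝ) • (thetaL E g + thetaR E g)) LinearMap.id).flip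

/-- The Cartan-Dirac sub-bundle `E ⊆ 𝕋G`, spanned by the sections `e(ξ)`, `ξ ∈ 𝔤`. -/
def cartanDirac (B : LinearMap.BilinForm ℝ (GroupLieAlgebra 𝓘(ℝ, E) G)) : SubspaceField E G :=
  fun g => LinearMap.range (cartanMap B g)

/-- `Ãd : G → Pin(𝔤)` is a lift of the adjoint action to a homomorphism of Lie groups: it is a
group homomorphism, it is smooth as a map into the finite-dimensional vector space `Cl(𝔤)`, and
`Ãd_g` acts on `𝔤` as `Ad_g`. -/
structure IsPinLift (B : LinearMap.BilinForm ℝ (GroupLieAlgebra 𝓘(ℝ, E) G))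
    (Adt : G →* pinGroup B) : Prop where
  smooth : ∀ ℓ : Module.Dual ℝ (Cl B),
    ContMDiff 𝓘(ℝ, E) 𝓘(ℝ, ℝ) ∞ (fun g => ℓ ((Adt g : (Cl B)ˣ) : Cl B))
  lifts : ∀ g, IsLiftOf B (Adt g : (Cl B)ˣ) (Ad E g)

/-- The form `φ = ϱ(Ã^κ) μ` on `G`. In the left trivialization `θᴸ_g : T_gG ≅ 𝔤` the section `Ã`
is `g ↦ Ãd_g`, and `μ` is the left-invariant volume form with the given value at the identity. -/
def cartanSpinor (B : LinearMap.BilinForm ℝ (GroupLieAlgebra 𝓘(ℝ, E) G)) (Adt : G →* pinGroup B)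
    {n : ℕ} (μ : GroupLieAlgebra 𝓘(ℝ, E) G [⋀^Fin n]→ₗ[ℝ] ℝ) : SpinorField E G :=
  fun g => pullback (thetaL E g)
    (spinorRep _ (cliffordKappa B ((Adt g : (Cl B)ˣ) : Cl B)) (homogeneous μ))

/-- Invariance of an inhomogeneous form on `G` under the conjugation action of `G`. -/
def IsAdInvariant (φ : SpinorField E G) : Prop :=
  ∀ h g : G, pullback
    (mfderiv 𝓘(ℝ, E) 𝓘(ℝ, E) (fun a : G => h * a * h⁻¹) g).toLinearMap (φ (h * g * h⁻¹)) = φ g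

variable [FiniteDimensional ℝ E] [LieGroup 𝓘(ℝ, E) ∞ G]

/-- The trilinear map `(ξ₀, ξ₁, ξ₂) ↦ B(ξ₀, [ξ₁, ξ₂])` on `𝔤`. -/
def bracketTrilinear (B : LinearMap.BilinForm ℝ (GroupLieAlgebra 𝓘(ℝ, E) G)) :
    MultilinearMap ℝ (fun _ : Fin 3 => GroupLieAlgebra 𝓘(ℝ, E) G) ℝ :=
  haveI : LieGroup 𝓘(ℝ, E) (minSmoothness ℝ 3) G := LieGroup.of_le (n := ∞) (by
    rw [minSmoothness_of_isRCLikeNormedField]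
    exact ENat.LEInfty.out)
  { toFun := fun v => B (v 0) ⁅v 1, v 2⁆
    map_update_add' := by
      intro inst v i x y
      obtain rfl : inst = instDecidableEqFin 3 := Subsingleton.elim _ _
      fin_cases i <;> simp
    map_update_smul' := by
      intro inst v i c x
      obtain rfl : inst = instDecidableEqFin 3 := Subsingleton.elim _ _
      fin_cases i <;> simp }

/-- The Cartan 3-form `η = (1/12) B(θᴸ, [θᴸ, θᴸ])`. In terms of a basis `eᵢ` of `𝔤`, the form
`B(θᴸ, [θᴸ, θᴸ])` is `∑ B(eᵢ, [eⱼ, eₖ]) θⁱ ∧ θʲ ∧ θᵏ`: the sum of `sgn(σ) B(θᴸ, [θᴸ, θᴸ])`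
over all permutations `σ` of the three arguments. -/
def cartanThreeForm (B : LinearMap.BilinForm ℝ (GroupLieAlgebra 𝓘(ℝ, E) G)) : FormField E G 3 :=
  fun g => ((1 / 12 : ℝ) • MultilinearMap.alternatization (bracketTrilinear B)).compLinearMap
    (thetaL E g)

end LieGroup

end CartanDirac

end

/-!
# Integrability of the Cartan-Dirac structure

Everything is computed in the left trivialization `θᴸ_g : T_gG ≅ 𝔤`, in which the fibre of the
Cartan-Dirac sub-bundle at `g` is `{κ(Ad_g v ⊕ v) | v ∈ 𝔤}` (`mem_cartanDirac_iff`) and the form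
`φ` is the function `g ↦ ϱ(Ãd_g)μ` with values in `⋀ 𝔤*` (`spinorCoeff`).

*Linear algebra.* Under `κ`, the diagonal of `V ⊕ V̄` corresponds to `V* ⊆ V ⊕ V*`, which
annihilates exactly the multiples of the volume form `μ`. A lift `x` of an isometry `A` carries
this over to the subspace `{κ(Av ⊕ v)}`, which is Lagrangian (`isLagrangian_range_kappa`): the
spinors annihilated by it form the line through `ϱ(x)μ` (`exists_eq_smul_of_rho_kappa`). So `φ`
is a pure spinor with null space `E`. Since `Ad_g` preserves the volume form, its lift is even
(`IsLiftOf.involute_eq`). This gives the invariance of `φ` under conjugation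
(`pullback_cliffordRep_conj`), and shows that `φ` has only components whose degree has the parity
of `dim G`.

*The equation `(d + η)φ = 0`.* In left trivialization the exterior derivative is the sum of the
derivatives of the coefficients and the Chevalley-Eilenberg differential
(`extDSpinor_leftTrivialized`), by the Maurer-Cartan equation. Three properties of `φ` are used:
`ρ(e)φ = 0` for sections `e` of `E`, the derivative of this equation along left-invariant fields
(`rho_kappa_spinorDeriv`), and the infinitesimal invariance of `φ` under conjugation
(`spinorDeriv_sub_of_invariant`). Together they imply `ρ(e)(d + η)φ = 0`
(`rho_twistedDifferential_eq_zero`), a computation in which the terms with the 2-forms `B(v, [·,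
·])` cancel against those from `η`. Hence `(d + η)φ` is at each point a multiple of `φ`. As `d +
η` changes the parity of the degree, this multiple is zero (`twistedD_cartanSpinor`).

*Integrability.* Another pure spinor `φ'` defining `E` over an open set is a function times `φ`;
the function is differentiable, as a quotient of components, so that `(d + η)φ' = α ∧ φ` at each
point for a covector `α` (`exists_extDSpinor_eq`). Two elements of `E` already annihilate such a
form.

The form `η` is closed since it is left-invariant and its value at the identity is
`ad`-invariant. The derivative of the adjoint action, needed for the invariance under the
bracket, is identified with the bracket in `fderiv_AdCLM_one`, through the second derivatives of
the product in a chart.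
-/

noncomputable section

namespace CartanDirac

/-! ### The three-form multiplication as a Clifford operator -/

section Operators

variable {V : Type*} [AddCommGroup V] [Module ℝ V]

theorem contraction_apply (v : V) (φ : Spinor V) (k : ℕ) :
    contraction v φ k = (φ (k + 1)).curryLeft v := rfl

theorem extMul_apply_zero (α : Module.Dual ℝ V) (φ : Spinor V) : extMul α φ 0 = 0 := rfl

theorem extMul_apply_succ (α : Module.Dual ℝ V) (φ : Spinor V) (k : ℕ) :
    extMul α φ (k + 1) = covectorWedge α (φ k) := rfl

theorem alternatingMap_sum_apply {W ι κ : Type*} [AddCommGroup W] [Module ℝ W]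
    (s : Finset ι) (f : ι → V [⋀^κ]→ₗ[ℝ] W) (v : κ → V) :
    (∑ i ∈ s, f i) v = ∑ i ∈ s, f i v :=
  map_sum (⟨⟨fun g : V [⋀^κ]→ₗ[ℝ] W => g v, rfl⟩, fun _ _ => rfl⟩ :
    (V [⋀^κ]→ₗ[ℝ] W) →+ W) f s

theorem covectorWedge_apply {k : ℕ} (α : Module.Dual ℝ V) (β : V [⋀^Fin k]→ₗ[ℝ] ℝ)
    (w : Fin (k + 1) → V) :
    covectorWedge α β w =
      ∑ i : Fin (k + 1), (-1 : ℝ) ^ (i : ℕ) * (α (w i) * β (i.removeNth w)) := by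
  simp only [covectorWedge, AlternatingMap.alternatizeUncurryFin_apply]
  refine Finset.sum_congr rfl fun i _ => ?_
  rcases Nat.even_or_odd (i : ℕ) with h | h <;> simp [h.neg_one_pow]

theorem contraction_anticomm (v w : V) (φ : Spinor V) :
    contraction v (contraction w φ) = -contraction w (contraction v φ) := by
  have h2 := contraction_contraction (v + w) φ
  simp only [map_add, LinearMap.add_apply, contraction_contraction, zero_add, add_zero] at h2
  exact eq_neg_of_add_eq_zero_right h2

theorem extMul_anticomm (α β : Module.Dual ℝ V) (φ : Spinor V) :
    extMul α (extMul β φ) = -extMul β (extMul α φ) := by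
  have h2 := extMul_extMul (α + β) φ
  simp only [map_add, LinearMap.add_apply, extMul_extMul, zero_add, add_zero] at h2
  exact eq_neg_of_add_eq_zero_right h2

theorem contraction_extMul_eq_sub (v : V) (α : Module.Dual ℝ V) (φ : Spinor V) :
    contraction v (extMul α φ) = α v • φ - extMul α (contraction v φ) :=
  eq_sub_of_add_eq (contraction_extMul v α φ)

/-- The Clifford relation `ρ(w₁)ρ(w₂) + ρ(w₂)ρ(w₁) = ⟨w₁, w₂⟩`. -/
theorem rho_rho (w₁ w₂ : Double V) (φ : Spinor V) :
    rho w₁ (rho w₂ φ) = pairing w₁ w₂ • φ - rho w₂ (rho w₁ φ) := by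
  simp only [rho_apply, map_add, pairing]
  rw [contraction_anticomm w₁.1, extMul_anticomm w₁.2, contraction_extMul_eq_sub w₁.1,
    contraction_extMul_eq_sub w₂.1, add_smul]
  abel

/-- The multilinear map `α ⊗ c`. -/
def covectorTensor {n : ℕ} (α : Module.Dual ℝ V) (c : MultilinearMap ℝ (fun _ : Fin n => V) ℝ) :
    MultilinearMap ℝ (fun _ : Fin (n + 1) => V) ℝ :=
  LinearMap.uncurryLeft (α.smulRight c)

theorem covectorTensor_apply {n : ℕ} (α : Module.Dual ℝ V)
    (c : MultilinearMap ℝ (fun _ : Fin n => V) ℝ) (v : Fin (n + 1) → V) :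
    covectorTensor α c v = α (v 0) * c (Fin.tail v) := rfl

/-- Every permutation of `{0, …, n}` is determined by the image of `0` and a permutation of the
other elements. The factor of the image `p` is chosen such that its sign is `(-1)ᵖ`. -/
theorem bijective_cycleRange_mul (n : ℕ) :
    Function.Bijective (fun x : Fin (n + 1) × Equiv.Perm (Fin n) =>
      (x.1.cycleRange.symm * Equiv.Perm.decomposeFin.symm (0, x.2) :
        Equiv.Perm (Fin (n + 1)))) := by
  rw [Fintype.bijective_iff_injective_and_card]
  constructor
  · rintro ⟨p, e⟩ ⟨p', e'⟩ h
    have h0 : p = p' := by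
      have := Equiv.congr_fun h 0
      simpa [Fin.cycleRange_symm_zero] using this
    subst h0
    have := Equiv.Perm.decomposeFin.symm.injective (mul_left_cancel h)
    simpa using this
  · simp [Fintype.card_perm, Nat.factorial_succ]

/-- The wedge product with a 1-form of the alternatization of `c` is the alternatization of
`α ⊗ c`, so that iterated wedge products become a single sum over permutations. -/
theorem covectorWedge_alternatization {n : ℕ} (α : Module.Dual ℝ V)
    (c : MultilinearMap ℝ (fun _ : Fin n => V) ℝ) :
    covectorWedge α (MultilinearMap.alternatization c) =
      MultilinearMap.alternatization (covectorTensor α c) := by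
  ext v
  rw [covectorWedge_apply, MultilinearMap.alternatization_apply,
    ← (bijective_cycleRange_mul n).sum_comp, Fintype.sum_prod_type]
  refine Finset.sum_congr rfl fun p _ => ?_
  rw [MultilinearMap.alternatization_apply, Finset.mul_sum, Finset.mul_sum]
  refine Finset.sum_congr rfl fun e _ => ?_
  have h1 : (fun i => v ((p.cycleRange.symm * Equiv.Perm.decomposeFin.symm (0, e) :
      Equiv.Perm (Fin (n + 1))) i)) 0 = v p := by simp
  have h2 : Fin.tail (fun i => v ((p.cycleRange.symm * Equiv.Perm.decomposeFin.symm (0, e) :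
      Equiv.Perm (Fin (n + 1))) i)) = fun i => p.removeNth v (e i) := by
    funext i
    simp [Fin.tail, Fin.removeNth]
  dsimp only at h1 ⊢
  rw [MultilinearMap.domDomCongr_apply, MultilinearMap.domDomCongr_apply, covectorTensor_apply,
    h1, h2]
  simp only [Equiv.Perm.sign_mul, Equiv.Perm.sign_symm, Fin.sign_cycleRange,
    Equiv.Perm.decomposeFin.symm_sign, if_true, one_mul, Units.smul_def, zsmul_eq_mul]
  push_cast
  ring

theorem threeForm_apply_eq_sum {ι : Type*} [Fintype ι] (b : Module.Basis ι ℝ V)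
    (η : V [⋀^Fin 3]→ₗ[ℝ] ℝ) (v : Fin 3 → V) :
    η v = ∑ i, ∑ j, ∑ k, η ![b i, b j, b k] *
      (b.coord i (v 0) * (b.coord j (v 1) * b.coord k (v 2))) := by
  classical
  have h : ∀ w : Fin 3 → V, (∑ i, ∑ j, ∑ k, η ![b i, b j, b k] • covectorTensor (b.coord i)
      (covectorTensor (b.coord j) (covectorTensor (b.coord k)
        (MultilinearMap.constOfIsEmpty ℝ (fun _ : Fin 0 => V) (1 : ℝ))))) w =
      ∑ i, ∑ j, ∑ k, η ![b i, b j, b k] *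
        (b.coord i (w 0) * (b.coord j (w 1) * b.coord k (w 2))) := by
    intro w
    simp [covectorTensor_apply, Fin.tail]
  rw [← h]
  refine congrArg (fun m : MultilinearMap ℝ (fun _ : Fin 3 => V) ℝ => m v)
    (Module.Basis.ext_multilinear (fun _ => b) (f := η.toMultilinearMap) fun r => ?_)
  rw [h]
  simp [Finsupp.single_apply]
  congr 1
  funext i
  fin_cases i <;> rfl

/-- Wedge product with a 3-form, through iterated wedge products with 1-forms. The factor `1/6`
occurs since the sum is over all triples of basis elements. -/
theorem threeFormMul_eq_sum {ι : Type*} [Fintype ι] (b : Module.Basis ι ℝ V)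
    (η : V [⋀^Fin 3]→ₗ[ℝ] ℝ) (φ : Spinor V) :
    threeFormMul η φ = (1 / 6 : ℝ) • ∑ i, ∑ j, ∑ k, η ![b i, b j, b k] •
      extMul (b.coord i) (extMul (b.coord j) (extMul (b.coord k) φ)) := by
  funext k
  simp only [Pi.smul_apply, Finset.sum_apply]
  have hz : ∀ {k : ℕ} (α : Module.Dual ℝ V), covectorWedge α (0 : V [⋀^Fin k]→ₗ[ℝ] ℝ) = 0 := by
    intro k α; ext; simp [covectorWedge_apply]
  match k with
  | 0 => simp [threeFormMul, extMul_apply_zero]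
  | 1 => simp [threeFormMul, extMul_apply_zero, extMul_apply_succ, hz]
  | 2 => simp [threeFormMul, extMul_apply_zero, extMul_apply_succ, hz]
  | q + 3 =>
    -- Both sides are sums over the permutations of the `q + 3` arguments.
    have key : ∀ α : Module.Dual ℝ V, ∀ β : Module.Dual ℝ V, ∀ γ : Module.Dual ℝ V,
        extMul α (extMul β (extMul γ φ)) (q + 3) =
          (q.factorial : ℝ)⁻¹ • MultilinearMap.alternatization
            (covectorTensor α (covectorTensor β (covectorTensor γ (φ q).toMultilinearMap))) := by
      intro α β γ
      rw [extMul_apply_succ, extMul_apply_succ, extMul_apply_succ,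
        ← covectorWedge_alternatization, ← covectorWedge_alternatization,
        ← covectorWedge_alternatization]
      have h := AlternatingMap.coe_alternatization (φ q)
      rw [Fintype.card_fin] at h
      have h' : MultilinearMap.alternatization (φ q).toMultilinearMap
          = (q.factorial : ℝ) • φ q := by
        rw [Nat.cast_smul_eq_nsmul]; exact h
      rw [h']
      ext v
      simp only [covectorWedge_apply, AlternatingMap.smul_apply, smul_eq_mul, Finset.mul_sum]
      refine Finset.sum_congr rfl fun _ _ => Finset.sum_congr rfl fun _ _ =>
        Finset.sum_congr rfl fun _ _ => ?_
      have hfac : (q.factorial : ℝ) ≠ 0 := by positivity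
      field_simp
    ext v
    have hR : (∑ i, ∑ j, ∑ k, η ![b i, b j, b k] •
        extMul (b.coord i) (extMul (b.coord j) (extMul (b.coord k) φ)) (q + 3)) v
        = (q.factorial : ℝ)⁻¹ * ∑ σ : Equiv.Perm (Fin (q + 3)), (Equiv.Perm.sign σ : ℤ) •
          (η ![v (σ 0), v (σ 1), v (σ 2)] * φ q (fun i => v (σ i.succ.succ.succ))) := by
      simp only [key]
      have h3 : ∀ σ : Equiv.Perm (Fin (q + 3)), η ![v (σ 0), v (σ 1), v (σ 2)] =
          ∑ i, ∑ j, ∑ k, η ![b i, b j, b k] * (b.coord i (v (σ 0)) * (b.coord j (v (σ 1)) *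
            b.coord k (v (σ 2)))) := fun σ => threeForm_apply_eq_sum b η _
      simp only [alternatingMap_sum_apply, AlternatingMap.smul_apply,
        MultilinearMap.alternatization_apply, smul_eq_mul, MultilinearMap.domDomCongr_apply,
        covectorTensor_apply, h3, Finset.sum_mul, Finset.smul_sum, Finset.mul_sum]
      rw [Finset.sum_comm (s := (Finset.univ : Finset (Equiv.Perm (Fin (q + 3)))))]
      refine Finset.sum_congr rfl fun i _ => ?_
      rw [Finset.sum_comm (s := (Finset.univ : Finset (Equiv.Perm (Fin (q + 3)))))]
      refine Finset.sum_congr rfl fun j _ => ?_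
      rw [Finset.sum_comm (s := (Finset.univ : Finset (Equiv.Perm (Fin (q + 3)))))]
      refine Finset.sum_congr rfl fun k _ => Finset.sum_congr rfl fun σ _ => ?_
      have h4 : (φ q).toMultilinearMap (Fin.tail (Fin.tail (Fin.tail fun i => v (σ i)))) =
        φ q (fun i => v (σ i.succ.succ.succ)) := rfl
      have h5 : Fin.tail (fun i => v (σ i)) 0 = v (σ 1) := rfl
      have h6 : Fin.tail (Fin.tail (fun i => v (σ i))) 0 = v (σ 2) := rfl
      rw [h4, h5, h6]
      simp only [Units.smul_def, zsmul_eq_mul]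
      ring
    rw [AlternatingMap.smul_apply, hR]
    simp only [threeFormMul, wedge, AlternatingMap.domDomCongr_apply, AlternatingMap.smul_apply,
      MultilinearMap.alternatization_apply, MultilinearMap.domDomCongr_apply]
    simp only [smul_eq_mul]
    rw [← mul_assoc, mul_inv]
    congr 1
    · norm_num [Nat.factorial]
    · refine Fintype.sum_equiv (Equiv.permCongr (finCongr (Nat.add_comm 3 q))) _ _ fun σ => ?_
      rw [Equiv.Perm.sign_permCongr, Units.smul_def]
      congr 1
      change η (fun i => _) * φ q (fun i => _) = _
      congr 2
      · funext i
        fin_cases i <;> rfl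
      · funext i
        refine congrArg (fun j => v (finCongr (Nat.add_comm 3 q) (σ j))) (Fin.ext ?_)
        simp
        omega

end Operators

/-! ### Elements of the Clifford group over transformations of determinant one -/

section Even

/-- An element commuting with the factors of a product up to scalars commutes with the product up
to the product of these scalars. -/
theorem mul_prod_ofFn_of_commute {R : Type*} [Ring R] [Algebra ℝ R] (a : R) {n : ℕ}
    (x : Fin n → R) (s : Fin n → ℝ) (h : ∀ i, a * x i = s i • (x i * a)) :
    a * (List.ofFn x).prod = (∏ i, s i) • ((List.ofFn x).prod * a) := by
  induction n with
  | zero => simp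
  | succ n ih =>
    rw [List.ofFn_succ, List.prod_cons, Fin.prod_univ_succ, ← mul_assoc, h, smul_mul_assoc,
      mul_assoc, ih (fun i => x i.succ) (fun i => s i.succ) (fun i => h i.succ), mul_smul_comm,
      smul_smul, mul_assoc]

/-- The product of an anticommuting family changes by the sign under a permutation. -/
theorem prod_ofFn_perm_of_anticommute {R : Type*} [Ring R] {n : ℕ} (σ : Equiv.Perm (Fin n)) :
    ∀ x : Fin n → R, (∀ i j, i ≠ j → x i * x j = -(x j * x i)) →
      (List.ofFn fun i => x (σ i)).prod = (Equiv.Perm.sign σ : ℤ) • (List.ofFn x).prod := by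
  -- The adjacent transpositions generate the symmetric group.
  have hswap : ∀ (m : ℕ) (i : Fin m) (x : Fin (m + 1) → R),
      (∀ i j, i ≠ j → x i * x j = -(x j * x i)) →
      (List.ofFn fun j => x (Equiv.swap i.castSucc i.succ j)).prod = -(List.ofFn x).prod := by
    intro m
    induction m with
    | zero => exact fun i => i.elim0
    | succ m ih =>
      intro i x hx
      cases i using Fin.cases with
      | zero =>
        have h0 : ∀ j : Fin m, Equiv.swap (0 : Fin (m + 2)) 1 j.succ.succ = j.succ.succ :=
          fun j => Equiv.swap_apply_of_ne_of_ne (Fin.succ_ne_zero _)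
            (fun h => Fin.succ_ne_zero j (Fin.succ_injective _ h))
        have h1 : x 1 * x 0 = -(x 0 * x 1) := hx 1 0 (by simp)
        simp only [List.ofFn_succ, List.prod_cons, Fin.castSucc_zero, Fin.succ_zero_eq_one,
          Equiv.swap_apply_left, Equiv.swap_apply_right, h0]
        rw [← mul_assoc, h1, neg_mul, mul_assoc]
      | succ i =>
        have h0 : Equiv.swap i.succ.castSucc i.succ.succ 0 = 0 :=
          Equiv.swap_apply_of_ne_of_ne (by simp [Fin.ext_iff]) (by simp [Fin.ext_iff])
        have h1 : ∀ j : Fin (m + 1), Equiv.swap i.succ.castSucc i.succ.succ j.succ =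
            (Equiv.swap i.castSucc i.succ j).succ := fun j => by
          rw [← Fin.succ_castSucc]
          exact ((Fin.succ_injective _).swap_apply _ _ _)
        have h2 := ih i (fun j => x j.succ) (fun a b hab =>
          hx _ _ (fun h => hab (Fin.succ_injective _ h)))
        have h3 : ∀ y : Fin (m + 2) → R,
            (List.ofFn y).prod = y 0 * (List.ofFn fun j => y j.succ).prod := fun y => by
          rw [List.ofFn_succ, List.prod_cons]
        rw [h3, h3 x, h0]
        simp only [h1]
        rw [h2, mul_neg]
  cases n with
  | zero => intro x _; simp [Subsingleton.elim σ 1]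
  | succ m =>
    have hσ : σ ∈ Submonoid.closure
        (Set.range fun i : Fin m => Equiv.swap i.castSucc i.succ) := by
      rw [Equiv.Perm.mclosure_swap_castSucc_succ]; trivial
    induction hσ using Submonoid.closure_induction with
    | mem σ h =>
      obtain ⟨i, rfl⟩ := h
      intro x hx
      have hne : i.castSucc ≠ i.succ := (Fin.castSucc_lt_succ).ne
      simp only
      rw [hswap m i x hx, Equiv.Perm.sign_swap hne]
      simp
    | one => intro x _; simp
    | mul σ τ _ _ h1 h2 =>
      intro x hx
      have h3 := h2 (fun i => x (σ i)) (fun i j hij => hx _ _ (fun h => hij (σ.injective h)))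
      simp only [Equiv.Perm.mul_apply]
      rw [h3, h1 x hx, smul_smul, Equiv.Perm.sign_mul, mul_comm]
      simp

variable {V : Type*} [AddCommGroup V] [Module ℝ V]

/-- Moving `z` through a product, when it intertwines the factors up to the parity automorphism. -/
theorem prod_ofFn_mul_involute {B : LinearMap.BilinForm ℝ V} {n : ℕ} (x y : Fin n → Cl B) :
    ∀ z : Cl B, (∀ i, y i * CliffordAlgebra.involute z = z * x i) →
      (∀ i, y i * z = CliffordAlgebra.involute z * x i) →
      (List.ofFn y).prod * (CliffordAlgebra.involute)^[n] z = z * (List.ofFn x).prod := by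
  induction n with
  | zero => intro z _ _; simp
  | succ n ih =>
    intro z h1 h2
    rw [List.ofFn_succ, List.ofFn_succ, List.prod_cons, List.prod_cons, Function.iterate_succ_apply,
      mul_assoc, ih (fun i => x i.succ) (fun i => y i.succ) (CliffordAlgebra.involute z)
        (fun i => by rw [CliffordAlgebra.involute_involute]; exact h2 i.succ)
        (fun i => by rw [CliffordAlgebra.involute_involute]; exact h1 i.succ),
      ← mul_assoc, h1, mul_assoc]

theorem ι_mul_ι_anticomm_of_isOrtho {B : LinearMap.BilinForm ℝ V} (hB : B.IsSymm) {v w : V}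
    (h : B v w = 0) :
    CliffordAlgebra.ι (halfForm B) v * CliffordAlgebra.ι (halfForm B) w =
      -(CliffordAlgebra.ι (halfForm B) w * CliffordAlgebra.ι (halfForm B) v) := by
  apply CliffordAlgebra.ι_mul_ι_comm_of_isOrtho
  have h' : B w v = 0 := by rw [← h]; exact hB.eq w v
  rw [QuadraticMap.isOrtho_def]
  simp [halfForm, h, h', mul_add]

/-- Alternating maps of top degree are determined by their value on a basis. -/
theorem alternatingMap_ext_basis {W : Type*} [AddCommGroup W] [Module ℝ W] {n : ℕ}
    (e : Module.Basis (Fin n) ℝ V) {N₁ N₂ : V [⋀^Fin n]→ₗ[ℝ] W} (h : N₁ e = N₂ e) : N₁ = N₂ :=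
  Module.Basis.ext_alternating e fun v hv => by
    let σ : Equiv.Perm (Fin n) := Equiv.ofBijective v (Finite.injective_iff_bijective.1 hv)
    have h1 : ∀ N : V [⋀^Fin n]→ₗ[ℝ] W, (N fun i => e (v i)) = Equiv.Perm.sign σ • N e :=
      fun N => N.map_perm e σ
    rw [h1, h1, h]

/-- A transformation preserving a volume form fixes the values of alternating maps of top
degree. -/
theorem alternatingMap_apply_of_preserves_volume {W : Type*} [AddCommGroup W] [Module ℝ W]
    {n : ℕ} (e : Module.Basis (Fin n) ℝ V) (μ : V [⋀^Fin n]→ₗ[ℝ] ℝ) (hμ : μ ≠ 0)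
    (A : V →ₗ[ℝ] V) (hA : μ.compLinearMap A = μ) (N : V [⋀^Fin n]→ₗ[ℝ] W) :
    N (fun i => A (e i)) = N e := by
  have hμe : μ e ≠ 0 := fun h => hμ (alternatingMap_ext_basis e (by simpa using h))
  have hN : N = ((μ e)⁻¹ • LinearMap.toSpanSingleton ℝ W (N e)).compAlternatingMap μ :=
    alternatingMap_ext_basis e (by simp [smul_smul, hμe])
  have h2 : μ (fun i => A (e i)) = μ e := congrArg (fun m => m e) hA
  rw [hN]
  simp [h2]

variable [FiniteDimensional ℝ V] {B : LinearMap.BilinForm ℝ V}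

/-- A lift of a volume-preserving transformation to the Clifford group is even. The product
`Γ = e₁ ⋯ eₙ` over an orthogonal basis satisfies `z Γ = Γ Πⁿ⁺¹(z)` for all `z`, and
`(A e₁) ⋯ (A eₙ) Πⁿ(x) = x Γ` for a lift `x` of `A`; here `(A e₁) ⋯ (A eₙ) = Γ` since `A` preserves
the volume, and `Γ` is invertible. -/
theorem IsLiftOf.involute_eq (hBs : B.IsSymm) (hBn : B.Nondegenerate)
    {n : ℕ} (hn : Module.finrank ℝ V = n) (μ : V [⋀^Fin n]→ₗ[ℝ] ℝ) (hμ : μ ≠ 0) {A : V →ₗ[ℝ] V}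
    (hA : μ.compLinearMap A = μ) (hAB : ∀ v w, B (A v) (A w) = B v w) {x : (Cl B)ˣ}
    (hx : IsLiftOf B x A) : CliffordAlgebra.involute (x : Cl B) = x := by
  classical
  obtain ⟨e, he⟩ : ∃ e : Module.Basis (Fin n) ℝ V, LinearMap.IsOrthoᵢ B e := by
    subst hn
    exact LinearMap.BilinForm.exists_orthogonal_basis (K := ℝ) (B := B) ⟨hBs.eq⟩
  let Q := halfForm B
  have heo : ∀ i j, i ≠ j → B (e i) (e j) = 0 := fun i j hij => he hij
  have hanti : ∀ i j, i ≠ j → CliffordAlgebra.ι Q (e i) * CliffordAlgebra.ι Q (e j) =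
      -(CliffordAlgebra.ι Q (e j) * CliffordAlgebra.ι Q (e i)) :=
    fun i j hij => ι_mul_ι_anticomm_of_isOrtho hBs (heo i j hij)
  set Γ : Cl B := (List.ofFn fun i => CliffordAlgebra.ι Q (e i)).prod with hΓ
  have hΓu : IsUnit Γ := by
    refine List.prod_isUnit fun m hm => ?_
    obtain ⟨i, rfl⟩ := (List.mem_ofFn' _ _).1 hm
    refine CliffordAlgebra.isUnit_ι_of_isUnit _ (isUnit_iff_ne_zero.2 ?_)
    have := he.not_isOrtho_basis_self_of_separatingLeft hBn.1 i
    simpa [Q, halfForm] using this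
  -- The products over `e` and `A e` agree, as values of an alternating map of top degree.
  have hAΓ : (List.ofFn fun i => CliffordAlgebra.ι Q (A (e i))).prod = Γ := by
    let M : MultilinearMap ℝ (fun _ : Fin n => V) (Cl B) :=
      (MultilinearMap.mkPiAlgebraFin ℝ n (Cl B)).compLinearMap fun _ => CliffordAlgebra.ι Q
    have hM : ∀ v : Fin n → V, M v = (List.ofFn fun i => CliffordAlgebra.ι Q (v i)).prod :=
      fun v => by simp [M]
    have hN : ∀ v : Fin n → V, (∀ i j, i ≠ j → B (v i) (v j) = 0) →
        MultilinearMap.alternatization M v = (n.factorial : ℝ) • M v := by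
      intro v hv
      rw [MultilinearMap.alternatization_apply]
      have : ∀ σ : Equiv.Perm (Fin n), Equiv.Perm.sign σ • M.domDomCongr σ v = M v := by
        intro σ
        rw [MultilinearMap.domDomCongr_apply, hM, hM, prod_ofFn_perm_of_anticommute σ
          (fun i => CliffordAlgebra.ι Q (v i))
          fun i j hij => ι_mul_ι_anticomm_of_isOrtho hBs (hv i j hij), Units.smul_def, smul_smul]
        rw [← Units.val_mul, Int.units_mul_self, Units.val_one, one_smul]
      simp only [this, Finset.sum_const, Finset.card_univ, Fintype.card_perm, Fintype.card_fin]
      rw [Nat.cast_smul_eq_nsmul]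
    have h1 := alternatingMap_apply_of_preserves_volume e μ hμ A hA
      (MultilinearMap.alternatization M)
    rw [hN _ (fun i j hij => by rw [hAB, heo i j hij]), hN _ heo, hM, hM] at h1
    exact smul_right_injective _ (by positivity : (n.factorial : ℝ) ≠ 0) h1
  have hinv : ∀ v : V, ∀ k : ℕ, (CliffordAlgebra.involute (Q := Q))^[k] (CliffordAlgebra.ι Q v) =
      (-1 : ℝ) ^ k • CliffordAlgebra.ι Q v := by
    intro v k
    induction k with
    | zero => simp
    | succ k ih => rw [Function.iterate_succ_apply', ih]; simp [pow_succ]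
  have hzΓ : ∀ z : Cl B, z * Γ = Γ * (CliffordAlgebra.involute (Q := Q))^[n + 1] z := by
    intro z
    induction z using CliffordAlgebra.induction with
    | algebraMap r =>
      have : (CliffordAlgebra.involute (Q := Q))^[n + 1] (algebraMap ℝ _ r) = algebraMap ℝ _ r :=
        Function.iterate_fixed (AlgHom.commutes _ r) _
      rw [this, Algebra.commutes]
    | ι v =>
      rw [hinv]
      have : (LinearMap.mulRight ℝ Γ).comp (CliffordAlgebra.ι Q) =
          (-1 : ℝ) ^ (n + 1) • (LinearMap.mulLeft ℝ Γ).comp (CliffordAlgebra.ι Q) := by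
        refine e.ext fun j => ?_
        have h1 := mul_prod_ofFn_of_commute (CliffordAlgebra.ι Q (e j))
          (fun i => CliffordAlgebra.ι Q (e i)) (fun i => (-1) * if i = j then -1 else 1)
          (fun i => by
            by_cases h : i = j
            · subst h; simp
            · simp [h, hanti j i (Ne.symm h)])
        rw [Finset.prod_mul_distrib, Finset.prod_ite_eq'] at h1
        simpa [pow_succ] using h1
      simpa using LinearMap.congr_fun this v
    | mul a b ha hb => 
      rw [mul_assoc, hb, ← mul_assoc, ha, mul_assoc, iterate_map_mul]
    | add a b ha hb => rw [add_mul, ha, hb, ← mul_add, iterate_map_add]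
  have hxA : ∀ v, CliffordAlgebra.ι Q (A v) * (x : Cl B) =
      CliffordAlgebra.involute (x : Cl B) * CliffordAlgebra.ι Q v := by
    intro v
    rw [← hx v, mul_assoc, Units.inv_mul, mul_one]
  have h1 := prod_ofFn_mul_involute (fun i => CliffordAlgebra.ι Q (e i))
    (fun i => CliffordAlgebra.ι Q (A (e i))) (x : Cl B)
    (fun i => by
      have := congrArg CliffordAlgebra.involute (hxA (e i))
      simpa using this)
    (fun i => hxA (e i))
  rw [hAΓ, ← hΓ, hzΓ] at h1
  have h2 := hΓu.mul_left_cancel h1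
  rw [Function.iterate_succ_apply] at h2
  exact ((CliffordAlgebra.involute_involutive (Q := Q)).injective.iterate n h2).symm

end Even

/-! ### Pure spinors attached to elements of the Clifford group -/

section Spinors

variable {V : Type*} [AddCommGroup V] [Module ℝ V]

theorem covectorWedge_smul {k : ℕ} (α : Module.Dual ℝ V) (c : ℝ) (β : V [⋀^Fin k]→ₗ[ℝ] ℝ) :
    covectorWedge α (c • β) = c • covectorWedge α β := by
  ext v
  simp [covectorWedge_apply, Finset.mul_sum, mul_left_comm]

theorem sum_covectorWedge {ι : Type*} [Fintype ι] (b : Module.Basis ι ℝ V) {k : ℕ}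
    (f : V →ₗ[ℝ] V [⋀^Fin k]→ₗ[ℝ] ℝ) :
    ∑ i, covectorWedge (b.coord i) (f (b i)) = AlternatingMap.alternatizeUncurryFin f := by
  have h : f = ∑ i, (b.coord i).smulRight (f (b i)) := by
    classical
    refine b.ext fun j => ?_
    simp [Finsupp.single_apply]
  conv_rhs => rw [h]
  exact (map_sum (AlternatingMap.alternatizeUncurryFinLM (R := ℝ) (M := V) (N := ℝ) (n := k))
    _ _).symm

/-- The Euler operator `∑ eⁱ ∧ ι(eᵢ)` is multiplication by the degree. -/
theorem sum_extMul_contraction {ι : Type*} [Fintype ι] (b : Module.Basis ι ℝ V) (ψ : Spinor V)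
    (k : ℕ) : (∑ i, extMul (b.coord i) (contraction (b i) ψ)) k = (k : ℝ) • ψ k := by
  rw [Finset.sum_apply]
  cases k with
  | zero => simp [extMul_apply_zero]
  | succ k =>
    simp only [extMul_apply_succ, contraction_apply]
    rw [sum_covectorWedge b, AlternatingMap.alternatizeUncurryFin_curryLeft,
      ← Nat.cast_smul_eq_nsmul ℝ, Nat.cast_add, Nat.cast_one]

theorem sum_contraction_extMul {ι : Type*} [Fintype ι] (b : Module.Basis ι ℝ V) (ψ : Spinor V)
    (k : ℕ) : (∑ i, contraction (b i) (extMul (b.coord i) ψ)) k =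
      ((Fintype.card ι : ℝ) - k) • ψ k := by
  simp only [contraction_extMul_eq_sub, Module.Basis.coord_apply, Module.Basis.repr_self,
    Finsupp.single_eq_same, one_smul, Finset.sum_sub_distrib]
  have h : (∑ _i : ι, ψ) k = (Fintype.card ι : ℝ) • ψ k := by
    simp [Finset.sum_const, ← Nat.cast_smul_eq_nsmul ℝ]
  rw [Pi.sub_apply, sum_extMul_contraction, h]
  exact (sub_smul _ _ _).symm

theorem homogeneous_self {n : ℕ} (μ : V [⋀^Fin n]→ₗ[ℝ] ℝ) : homogeneous μ n = μ :=
  Pi.single_eq_same _ _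

theorem homogeneous_of_ne {n k : ℕ} (μ : V [⋀^Fin n]→ₗ[ℝ] ℝ) (h : k ≠ n) :
    homogeneous μ k = 0 :=
  Pi.single_eq_of_ne h _

section TopDegree

variable [FiniteDimensional ℝ V] {n : ℕ}

theorem alternatingMap_eq_zero_of_finrank_lt {k : ℕ} (h : Module.finrank ℝ V < k)
    (β : V [⋀^Fin k]→ₗ[ℝ] ℝ) : β = 0 := by
  ext v
  refine β.map_linearDependent v fun hv => ?_
  have := hv.fintype_card_le_finrank
  rw [Fintype.card_fin] at this
  omega

theorem extMul_homogeneous (hn : Module.finrank ℝ V = n) (μ : V [⋀^Fin n]→ₗ[ℝ] ℝ)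
    (α : Module.Dual ℝ V) : extMul α (homogeneous μ) = 0 := by
  funext k
  cases k with
  | zero => rfl
  | succ k =>
    rcases eq_or_ne k n with rfl | h
    · exact alternatingMap_eq_zero_of_finrank_lt (by omega) _
    · rw [extMul_apply_succ, homogeneous_of_ne μ h]
      ext
      simp [covectorWedge_apply]

/-- The spinors annihilated by `V*` are the forms of top degree. -/
theorem exists_eq_smul_homogeneous (hn : Module.finrank ℝ V = n) (μ : V [⋀^Fin n]→ₗ[ℝ] ℝ)
    (hμ : μ ≠ 0) (ψ : Spinor V) (hψ : ∀ α, extMul α ψ = 0) :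
    ∃ c : ℝ, ψ = c • homogeneous μ := by
  obtain ⟨e⟩ : Nonempty (Module.Basis (Fin n) ℝ V) :=
    ⟨(Module.finBasis ℝ V).reindex (finCongr hn)⟩
  have hμe : μ e ≠ 0 := fun h => hμ (alternatingMap_ext_basis e (by simpa using h))
  refine ⟨ψ n e / μ e, funext fun k => ?_⟩
  rcases lt_trichotomy k n with h | rfl | h
  -- Below the top degree, `∑ ι(eᵢ) (eⁱ ∧ ψ)` is a non-zero multiple of `ψ`.
  · have h1 := sum_contraction_extMul e ψ k
    simp only [hψ, map_zero, Finset.sum_const_zero, Fintype.card_fin] at h1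
    have h2 : ((n : ℝ) - k) ≠ 0 := by
      rw [sub_ne_zero]; exact_mod_cast h.ne'
    rw [Pi.smul_apply, homogeneous_of_ne μ h.ne, smul_zero]
    exact (smul_eq_zero.1 h1.symm).resolve_left h2
  · refine alternatingMap_ext_basis e ?_
    rw [Pi.smul_apply, homogeneous_self]
    simp [hμe]
  · rw [alternatingMap_eq_zero_of_finrank_lt (by omega) (ψ k),
      alternatingMap_eq_zero_of_finrank_lt (by omega) ((_ • homogeneous μ : Spinor V) k)]

end TopDegree

variable (B : LinearMap.BilinForm ℝ V)

/-- The representation `ϱ : Cl(V) → End(⋀ V*)` extending `v ↦ ι(v) + ½ B(v, ·) ∧`. -/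
def cliffordRep : Cl B →ₐ[ℝ] Module.End ℝ (Spinor V) := (spinorRep V).comp (cliffordKappa B)

variable {B}

theorem cliffordRep_ι (v : V) (ψ : Spinor V) :
    cliffordRep B (CliffordAlgebra.ι (halfForm B) v) ψ = rho (kappa B (v, 0)) ψ := by
  have h : kappa B (v, 0) = (v, (1 / 2 : ℝ) • B v) := by simp [kappa]
  rw [h, ← spinorRep_cliffordKappa_ι]
  rfl

theorem cliffordRep_mul (x y : Cl B) (ψ : Spinor V) :
    cliffordRep B (x * y) ψ = cliffordRep B x (cliffordRep B y ψ) := by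
  rw [map_mul]; rfl

theorem cliffordRep_one (ψ : Spinor V) : cliffordRep B 1 ψ = ψ := by
  rw [map_one]; rfl

theorem kappa_apply (v w : V) :
    kappa B (v, w) = (v - w, (1 / 2 : ℝ) • B (v + w)) := rfl

theorem kappa_add_right (v w : V) : kappa B (v, w) = kappa B (v, 0) + kappa B (0, w) := by
  rw [← map_add]; simp

/-- `κ` takes the form `B ⊕ (-B)` on `V ⊕ V̄` to the pairing on `V ⊕ V*`. -/
theorem pairing_kappa (hB : B.IsSymm) (v w v' w' : V) :
    pairing (kappa B (v, w)) (kappa B (v', w')) = B v v' - B w w' := by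
  have h1 : B v' v = B v v' := hB.eq v' v
  have h2 : B w' w = B w w' := hB.eq w' w
  have h3 : B v' w = B w v' := hB.eq v' w
  have h4 : B w' v = B v w' := hB.eq w' v
  simp only [pairing, kappa_apply, LinearMap.smul_apply, map_add, map_sub, LinearMap.add_apply,
    smul_eq_mul, h1, h2, h3, h4]
  ring

/-- The actions of the two summands of `V ⊕ V̄` commute in the graded sense. -/
theorem rho_kappa_inr_cliffordRep (hB : B.IsSymm) (v : V) (x : Cl B) :
    ∀ ψ : Spinor V, rho (kappa B (0, v)) (cliffordRep B x ψ) =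
      cliffordRep B (CliffordAlgebra.involute x) (rho (kappa B (0, v)) ψ) := by
  induction x using CliffordAlgebra.induction with
  | algebraMap r => intro ψ; simp
  | ι w =>
    intro ψ
    rw [CliffordAlgebra.involute_ι, map_neg, LinearMap.neg_apply, cliffordRep_ι, cliffordRep_ι,
      rho_rho, pairing_kappa hB]
    simp
  | mul x y hx hy =>
    intro ψ
    rw [cliffordRep_mul, hx, hy, map_mul, cliffordRep_mul]
  | add x y hx hy =>
    intro ψ
    simp only [map_add, LinearMap.add_apply, hx, hy]

theorem IsLiftOf.ι_mul {x : (Cl B)ˣ} {A : V →ₗ[ℝ] V} (hx : IsLiftOf B x A) (v : V) :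
    CliffordAlgebra.ι (halfForm B) (A v) * (x : Cl B) =
      CliffordAlgebra.involute (x : Cl B) * CliffordAlgebra.ι (halfForm B) v := by
  rw [← hx v, mul_assoc, Units.inv_mul, mul_one]

/-- A lift `x` of `A` maps spinors annihilated by `κ(v ⊕ w)` to spinors annihilated by
`κ(Av ⊕ w)`. -/
theorem rho_kappa_cliffordRep (hB : B.IsSymm) {x : (Cl B)ˣ} {A : V →ₗ[ℝ] V}
    (hx : IsLiftOf B x A) (v w : V) (ψ : Spinor V) :
    rho (kappa B (A v, w)) (cliffordRep B x ψ) =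
      cliffordRep B (CliffordAlgebra.involute (x : Cl B)) (rho (kappa B (v, w)) ψ) := by
  rw [kappa_add_right, map_add, LinearMap.add_apply, rho_kappa_inr_cliffordRep hB,
    ← cliffordRep_ι, ← cliffordRep_mul, hx.ι_mul, cliffordRep_mul, cliffordRep_ι, ← map_add,
    ← LinearMap.add_apply, ← map_add, ← kappa_add_right]

theorem involute_mul_involute_inv (x : (Cl B)ˣ) :
    CliffordAlgebra.involute (x : Cl B) * CliffordAlgebra.involute (↑x⁻¹ : Cl B) = 1 := by
  rw [← map_mul]; simp

/-- The diagonal of `V ⊕ V̄` corresponds to `V* ⊆ V ⊕ V*` under `κ`. -/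
theorem rho_kappa_self (v : V) (ψ : Spinor V) : rho (kappa B (v, v)) ψ = extMul (B v) ψ := by
  rw [rho_apply, kappa_apply, ← two_smul ℝ v, map_smul, smul_smul]
  simp

theorem cliffordRep_unit_ne_zero (x : (Cl B)ˣ) {ψ : Spinor V} (hψ : ψ ≠ 0) :
    cliffordRep B x ψ ≠ 0 := fun h => hψ <| by
  rw [← cliffordRep_one (B := B) ψ, ← Units.inv_mul x, cliffordRep_mul, h, map_zero]

theorem homogeneous_ne_zero {n : ℕ} {μ : V [⋀^Fin n]→ₗ[ℝ] ℝ} (hμ : μ ≠ 0) :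
    homogeneous μ ≠ 0 := fun h => hμ <| by
  rw [← homogeneous_self μ, h]; rfl

/-- Null spaces are isotropic, so that a null space cannot exceed a Lagrangian subspace. -/
theorem nullSpace_eq_of_isLagrangian {L : Submodule ℝ (Double V)} (hL : IsLagrangian L)
    {ψ : Spinor V} (hψ : ψ ≠ 0) (h : ∀ w ∈ L, rho w ψ = 0) : nullSpace ψ = L := by
  refine le_antisymm (fun w hw => (hL w).2 fun w' hw' => ?_) h
  have hw0 : rho w ψ = 0 := hw
  have h1 := rho_rho w w' ψ
  rw [h w' hw', hw0, map_zero, map_zero, sub_zero] at h1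
  exact (smul_eq_zero.1 h1.symm).resolve_right hψ

/-- The parity operator on forms implements the parity automorphism `Π` of the Clifford algebra. -/
theorem cliffordRep_apply_neg_one_pow {x : Cl B} :
    ∀ ψ : Spinor V, cliffordRep B (CliffordAlgebra.involute x) (fun k => (-1 : ℝ) ^ k • ψ k) =
      fun k => (-1 : ℝ) ^ k • cliffordRep B x ψ k := by
  induction x using CliffordAlgebra.induction with
  | algebraMap r =>
    intro ψ
    funext k
    rw [AlgHom.commutes, AlgHom.commutes, Module.algebraMap_end_apply, Module.algebraMap_end_apply]
    exact smul_comm r ((-1 : ℝ) ^ k) (ψ k)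
  | ι w =>
    intro ψ
    rw [CliffordAlgebra.involute_ι, map_neg, LinearMap.neg_apply, cliffordRep_ι, cliffordRep_ι]
    funext k
    rw [Pi.neg_apply, rho_apply, rho_apply, Pi.add_apply, Pi.add_apply,
      contraction_apply, contraction_apply, AlternatingMap.curryLeft_smul, LinearMap.smul_apply,
      pow_succ, mul_neg_one, neg_smul, smul_add, neg_add, neg_neg]
    congr 1
    cases k with
    | zero => simp [extMul_apply_zero]
    | succ k =>
      rw [extMul_apply_succ, extMul_apply_succ, covectorWedge_smul, pow_succ, mul_neg_one,
        neg_smul]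
  | mul x y hx hy =>
    intro ψ
    rw [map_mul, cliffordRep_mul, hy, hx, cliffordRep_mul]
  | add x y hx hy =>
    intro ψ
    simp only [map_add, LinearMap.add_apply, hx, hy, Pi.add_apply, smul_add]
    rfl

/-- The parity of the form `ϱ(x)μ` for even `x`. -/
theorem cliffordRep_even_homogeneous {n : ℕ} {x : Cl B} (hx : CliffordAlgebra.involute x = x)
    (μ : V [⋀^Fin n]→ₗ[ℝ] ℝ) (k : ℕ) :
    (-1 : ℝ) ^ k • cliffordRep B x (homogeneous μ) k =
      (-1 : ℝ) ^ n • cliffordRep B x (homogeneous μ) k := by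
  have h := cliffordRep_apply_neg_one_pow (x := x) (homogeneous μ)
  have h2 : (fun k => (-1 : ℝ) ^ k • homogeneous μ k) = (-1 : ℝ) ^ n • homogeneous μ := by
    funext k
    rcases eq_or_ne k n with rfl | hk
    · rfl
    · simp [homogeneous_of_ne μ hk]
  rw [hx, h2, map_smul] at h
  exact (congrFun h k).symm

section Lift

variable [FiniteDimensional ℝ V] {n : ℕ}

theorem exists_bilin_eq (hBn : B.Nondegenerate) (α : Module.Dual ℝ V) : ∃ v, B v = α := by
  have h1 : Function.Injective B := by
    rw [← LinearMap.ker_eq_bot, LinearMap.ker_eq_bot']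
    exact fun m hm => hBn.1 m fun y => by rw [hm]; rfl
  exact (LinearMap.injective_iff_surjective_of_finrank_eq_finrank
    (Subspace.dual_finrank_eq (K := ℝ) (V := V)).symm).1 h1 α

theorem rho_kappa_lift_homogeneous (hB : B.IsSymm) (hn : Module.finrank ℝ V = n)
    (μ : V [⋀^Fin n]→ₗ[ℝ] ℝ) {x : (Cl B)ˣ} {A : V →ₗ[ℝ] V} (hx : IsLiftOf B x A) (v : V) :
    rho (kappa B (A v, v)) (cliffordRep B x (homogeneous μ)) = 0 := by
  rw [rho_kappa_cliffordRep hB hx, rho_kappa_self, extMul_homogeneous hn, map_zero]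

/-- The spinors annihilated by `{κ(Av ⊕ v)}` form a line: the inverse of the lift maps them to
spinors annihilated by `V*`, which are forms of top degree. -/
theorem exists_eq_smul_of_rho_kappa (hB : B.IsSymm) (hBn : B.Nondegenerate)
    (hn : Module.finrank ℝ V = n) (μ : V [⋀^Fin n]→ₗ[ℝ] ℝ) (hμ : μ ≠ 0) {x : (Cl B)ˣ}
    {A : V →ₗ[ℝ] V} (hx : IsLiftOf B x A) (ψ : Spinor V)
    (hψ : ∀ v, rho (kappa B (A v, v)) ψ = 0) :
    ∃ c : ℝ, ψ = c • cliffordRep B x (homogeneous μ) := by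
  have h1 : cliffordRep B x (cliffordRep B (↑x⁻¹ : Cl B) ψ) = ψ := by
    rw [← cliffordRep_mul, Units.mul_inv, cliffordRep_one]
  have h2 : ∀ α, extMul α (cliffordRep B (↑x⁻¹ : Cl B) ψ) = 0 := by
    intro α
    obtain ⟨v, rfl⟩ := exists_bilin_eq hBn α
    have h3 := hψ v
    rw [← h1, rho_kappa_cliffordRep hB hx, rho_kappa_self] at h3
    have h4 := congrArg (cliffordRep B (CliffordAlgebra.involute (↑x⁻¹ : Cl B))) h3
    have h5 := involute_mul_involute_inv x⁻¹
    rw [inv_inv] at h5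
    rwa [← cliffordRep_mul, h5, cliffordRep_one, map_zero] at h4
  obtain ⟨c, hc⟩ := exists_eq_smul_homogeneous hn μ hμ _ h2
  exact ⟨c, by rw [← h1, hc, map_smul]⟩

/-- The graph-type subspace `{κ(Av ⊕ v)}` of an isometry is Lagrangian. -/
theorem isLagrangian_range_kappa (hB : B.IsSymm) (hBn : B.Nondegenerate) {A : V →ₗ[ℝ] V}
    (hAs : Function.Surjective A) (hAB : ∀ v w, B (A v) (A w) = B v w) :
    IsLagrangian (LinearMap.range ((kappa B).comp (A.prod LinearMap.id))) := by
  intro w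
  constructor
  · rintro ⟨v, rfl⟩ _ ⟨v', rfl⟩
    change pairing (kappa B (A v, v)) (kappa B (A v', v')) = 0
    rw [pairing_kappa hB, hAB, sub_self]
  · intro h
    obtain ⟨a, ha⟩ := exists_bilin_eq hBn w.2
    -- `κ` is onto, so that `w = κ(u ⊕ u')`.
    obtain ⟨u, hu⟩ : ∃ u, u = a + (1 / 2 : ℝ) • w.1 := ⟨_, rfl⟩
    obtain ⟨u', hu'⟩ : ∃ u', u' = a - (1 / 2 : ℝ) • w.1 := ⟨_, rfl⟩
    have hw : w = kappa B (u, u') := by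
      rw [kappa_apply, hu, hu']
      refine Prod.ext ?_ ?_
      · simp only; module
      · rw [← ha, ← map_smul]
        congr 1
        module
    obtain ⟨y, hy⟩ := hAs u
    have h1 : ∀ v, B (y - u') v = 0 := by
      intro v
      have h2 := h (kappa B (A v, v)) ⟨v, rfl⟩
      rw [hw, pairing_kappa hB, ← hy, hAB] at h2
      rw [map_sub, LinearMap.sub_apply, h2]
    have h3 : y = u' := sub_eq_zero.1 (hBn.1 _ h1)
    exact ⟨u', by rw [hw, ← hy, h3]; rfl⟩

end Lift

end Spinors

/-! ### Pull-backs of spinors -/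

section Pullback

variable {V V' : Type*} [AddCommGroup V] [Module ℝ V] [AddCommGroup V'] [Module ℝ V']

theorem pullback_add (A : V →ₗ[ℝ] V') (φ ψ : Spinor V') :
    pullback A (φ + ψ) = pullback A φ + pullback A ψ := rfl

theorem pullback_smul (A : V →ₗ[ℝ] V') (c : ℝ) (φ : Spinor V') :
    pullback A (c • φ) = c • pullback A φ := rfl

theorem pullback_zero (A : V →ₗ[ℝ] V') : pullback A (0 : Spinor V') = 0 := rfl

theorem pullback_contraction (A : V →ₗ[ℝ] V') (v : V) (φ : Spinor V') :
    pullback A (contraction (A v) φ) = contraction v (pullback A φ) := by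
  funext k
  exact (AlternatingMap.curryLeft_compLinearMap A (φ (k + 1)) v).symm

theorem pullback_extMul (A : V →ₗ[ℝ] V') (α : Module.Dual ℝ V') (φ : Spinor V') :
    pullback A (extMul α φ) = extMul (α.comp A) (pullback A φ) := by
  funext k
  cases k with
  | zero => rfl
  | succ k =>
    ext w
    change covectorWedge α (φ k) (A ∘ w) = covectorWedge (α.comp A) ((φ k).compLinearMap A) w
    rw [covectorWedge_apply, covectorWedge_apply]
    rfl

theorem pullback_rho (A : V →ₗ[ℝ] V') (v : V) (α : Module.Dual ℝ V') (φ : Spinor V') :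
    pullback A (rho (A v, α) φ) = rho (v, α.comp A) (pullback A φ) := by
  rw [rho_apply, rho_apply, pullback_add, pullback_contraction, pullback_extMul]

theorem pullback_homogeneous (A : V →ₗ[ℝ] V') {n : ℕ} (μ : V' [⋀^Fin n]→ₗ[ℝ] ℝ) :
    pullback A (homogeneous μ) = homogeneous (μ.compLinearMap A) := by
  funext k
  rcases eq_or_ne k n with rfl | h
  · rw [homogeneous_self, pullback, homogeneous_self]
  · rw [homogeneous_of_ne _ h, pullback, homogeneous_of_ne _ h]
    rfl

/-- Pull-back under an isometry intertwines `ϱ` with conjugation by an even lift. -/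
theorem pullback_cliffordRep_conj {B : LinearMap.BilinForm ℝ V} {x : (Cl B)ˣ} {A : V →ₗ[ℝ] V}
    (hx : IsLiftOf B x A) (hxe : CliffordAlgebra.involute (x : Cl B) = x)
    (hAB : ∀ v w, B (A v) (A w) = B v w) (y : Cl B) :
    ∀ ψ : Spinor V, pullback A (cliffordRep B (x * y * (↑x⁻¹ : Cl B)) ψ) =
      cliffordRep B y (pullback A ψ) := by
  induction y using CliffordAlgebra.induction with
  | algebraMap r =>
    intro ψ
    rw [← Algebra.commutes, mul_assoc, Units.mul_inv, mul_one, AlgHom.commutes]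
    rfl
  | ι v =>
    intro ψ
    have h := hx v
    rw [hxe] at h
    rw [h, cliffordRep_ι, cliffordRep_ι, kappa_apply, kappa_apply, sub_zero, add_zero, sub_zero,
      add_zero, pullback_rho]
    congr 2
    refine Prod.ext rfl (LinearMap.ext fun w => ?_)
    simp [hAB]
  | mul y z hy hz =>
    intro ψ
    have h : (x : Cl B) * (y * z) * (↑x⁻¹ : Cl B) =
        (x * y * (↑x⁻¹ : Cl B)) * (x * z * (↑x⁻¹ : Cl B)) := by
      simp only [mul_assoc, Units.inv_mul_cancel_left]
    rw [h, cliffordRep_mul, hy, hz, cliffordRep_mul]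
  | add y z hy hz =>
    intro ψ
    simp only [mul_add, add_mul, map_add, LinearMap.add_apply, pullback_add, hy, hz]

/-- The map `v ⊕ α ↦ θ(v) ⊕ α ∘ θ⁻¹`. -/
def doubleMap (θ : V ≃ₗ[ℝ] V') : Double V ≃ₗ[ℝ] Double V' := θ.prodCongr θ.symm.dualMap

theorem doubleMap_apply (θ : V ≃ₗ[ℝ] V') (w : Double V) :
    doubleMap θ w = (θ w.1, w.2.comp θ.symm.toLinearMap) := rfl

theorem pairing_doubleMap (θ : V ≃ₗ[ℝ] V') (w w' : Double V) :
    pairing (doubleMap θ w) (doubleMap θ w') = pairing w w' := by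
  simp [pairing, doubleMap_apply]

theorem rho_pullback (θ : V ≃ₗ[ℝ] V') (w : Double V) (ψ : Spinor V') :
    rho w (pullback θ.toLinearMap ψ) = pullback θ.toLinearMap (rho (doubleMap θ w) ψ) := by
  have h := pullback_rho θ.toLinearMap w.1 (w.2.comp θ.symm.toLinearMap) ψ
  refine Eq.trans ?_ h.symm
  congr 2
  refine Prod.ext rfl (LinearMap.ext fun u => ?_)
  simp

theorem pullback_eq_zero_iff (θ : V ≃ₗ[ℝ] V') (ψ : Spinor V') :
    pullback θ.toLinearMap ψ = 0 ↔ ψ = 0 := by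
  refine ⟨fun h => funext fun k => AlternatingMap.ext fun w => ?_, fun h => by rw [h]; rfl⟩
  have h1 := congrArg (fun m => m (θ.symm ∘ w)) (congrFun h k)
  simpa [pullback, Function.comp_def] using h1

theorem mem_nullSpace {ψ : Spinor V} {w : Double V} : w ∈ nullSpace ψ ↔ rho w ψ = 0 := Iff.rfl

theorem mem_nullSpace_pullback (θ : V ≃ₗ[ℝ] V') (ψ : Spinor V') (w : Double V) :
    w ∈ nullSpace (pullback θ.toLinearMap ψ) ↔ doubleMap θ w ∈ nullSpace ψ := by
  rw [mem_nullSpace, mem_nullSpace, rho_pullback, pullback_eq_zero_iff]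

theorem IsPureSpinor.pullback (θ : V ≃ₗ[ℝ] V') {ψ : Spinor V'} (hψ : IsPureSpinor ψ) :
    IsPureSpinor (pullback θ.toLinearMap ψ) := by
  refine ⟨fun h => hψ.1 ((pullback_eq_zero_iff θ ψ).1 h), fun w => ?_⟩
  rw [mem_nullSpace_pullback, hψ.2]
  constructor
  · intro h w' hw'
    rw [← pairing_doubleMap θ]
    exact h _ ((mem_nullSpace_pullback θ ψ w').1 hw')
  · intro h w' hw'
    obtain ⟨u, rfl⟩ := (doubleMap θ).surjective w'
    rw [pairing_doubleMap]
    exact h u ((mem_nullSpace_pullback θ ψ u).2 hw')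

end Pullback

/-! ### Derivations of the exterior algebra -/

section Derivation

variable {V : Type*} [AddCommGroup V] [Module ℝ V]

/-- The derivation of `⋀ V*` extending the transpose of `T`:
`(D_T β)(w₁, …, wₖ) = ∑ⱼ β(w₁, …, T wⱼ, …, wₖ)`. -/
def formDerivation (T : V →ₗ[ℝ] V) (ψ : Spinor V) : Spinor V
  | 0 => 0
  | k + 1 => AlternatingMap.alternatizeUncurryFin ((ψ (k + 1)).curryLeft ∘ₗ T)

theorem formDerivation_apply (T : V →ₗ[ℝ] V) (ψ : Spinor V) (k : ℕ) (w : Fin k → V) :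
    formDerivation T ψ k w = ∑ j, ψ k (Function.update w j (T (w j))) := by
  cases k with
  | zero => simp [formDerivation]
  | succ k =>
    rw [formDerivation, AlternatingMap.alternatizeUncurryFin_apply]
    refine Finset.sum_congr rfl fun j _ => ?_
    rw [LinearMap.comp_apply, AlternatingMap.curryLeft_apply_apply,
      ← AlternatingMap.neg_one_pow_smul_map_insertNth, smul_smul, ← pow_add,
      Even.neg_one_pow ⟨_, rfl⟩, one_smul, Fin.insertNth_removeNth]

variable {ι : Type*} [Fintype ι] (b : Module.Basis ι ℝ V)

theorem formDerivation_eq_sum (T : V →ₗ[ℝ] V) (ψ : Spinor V) :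
    formDerivation T ψ = ∑ i, extMul (b.coord i) (contraction (T (b i)) ψ) := by
  funext k
  rw [Finset.sum_apply]
  cases k with
  | zero => simp [formDerivation, extMul_apply_zero]
  | succ k =>
    rw [formDerivation, ← sum_covectorWedge b]
    rfl

theorem formDerivation_add (T S : V →ₗ[ℝ] V) (ψ : Spinor V) :
    formDerivation (T + S) ψ = formDerivation T ψ + formDerivation S ψ := by
  funext k
  ext w
  rw [Pi.add_apply, AlternatingMap.add_apply]
  simp only [formDerivation_apply, LinearMap.add_apply, AlternatingMap.map_update_add,
    Finset.sum_add_distrib]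

theorem rho_extMul (w : Double V) (α : Module.Dual ℝ V) (ψ : Spinor V) :
    rho w (extMul α ψ) = α w.1 • ψ - extMul α (rho w ψ) := by
  have h := rho_rho w (0, α) ψ
  simpa [rho_apply (0, α), pairing] using h

theorem rho_contraction (w : Double V) (v : V) (ψ : Spinor V) :
    rho w (contraction v ψ) = w.2 v • ψ - contraction v (rho w ψ) := by
  have h := rho_rho w (v, 0) ψ
  simpa [rho_apply (v, 0), pairing] using h

theorem sum_coord_smul {W : Type*} [AddCommGroup W] [Module ℝ W] (F : V →ₗ[ℝ] W) (u : V) :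
    ∑ i, b.coord i u • F (b i) = F u := by
  have h := congrArg F (b.sum_repr u)
  rw [map_sum] at h
  rw [← h]
  exact Finset.sum_congr rfl fun i _ => (map_smul F _ _).symm

theorem sum_apply_smul_extMul (α : Module.Dual ℝ V) (ψ : Spinor V) :
    ∑ j, α (b j) • extMul (b.coord j) ψ = extMul α ψ := by
  have h : ∑ j, α (b j) • b.coord j = α := by
    classical
    refine b.ext fun j => ?_
    simp
  conv_rhs => rw [← h, map_sum, LinearMap.sum_apply]
  exact Finset.sum_congr rfl fun j _ => by rw [map_smul, LinearMap.smul_apply]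

end Derivation

/-! ### The twisted differential in a left trivialization -/

section TwistedDifferential

variable {V : Type*} [LieRing V] [LieAlgebra ℝ V] {ι : Type*} [Fintype ι]
  (b : Module.Basis ι ℝ V)

/-- The Chevalley-Eilenberg differential `-½ ∑ eⁱ ∧ eʲ ∧ ι([eᵢ, eⱼ])`. -/
def chevalleyEilenberg (ψ : Spinor V) : Spinor V :=
  -(1 / 2 : ℝ) • ∑ i, ∑ j, extMul (b.coord i) (extMul (b.coord j) (contraction ⁅b i, b j⁆ ψ))

/-- The 2-form `∑ α([eᵢ, eⱼ]) eⁱ ∧ eʲ` acting by multiplication. -/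
def bracketMul (α : Module.Dual ℝ V) (ψ : Spinor V) : Spinor V :=
  ∑ i, ∑ j, α ⁅b i, b j⁆ • extMul (b.coord i) (extMul (b.coord j) ψ)

theorem bracketMul_linear (α β : Module.Dual ℝ V) (s t : ℝ) (ψ : Spinor V) :
    bracketMul b (s • α + t • β) ψ = s • bracketMul b α ψ + t • bracketMul b β ψ := by
  simp only [bracketMul, Finset.smul_sum, ← Finset.sum_add_distrib, LinearMap.add_apply,
    LinearMap.smul_apply, add_smul, smul_smul, smul_eq_mul]

/-- The graded commutator of the Chevalley-Eilenberg differential with `ρ(v ⊕ α)` consists of the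
Lie derivative `-ad_v` and the exterior differential of `α`. -/
theorem rho_chevalleyEilenberg (w : Double V) (ψ : Spinor V) (hw : rho w ψ = 0) :
    rho w (chevalleyEilenberg b ψ) =
      -formDerivation (LieAlgebra.ad ℝ V w.1) ψ - (1 / 2 : ℝ) • bracketMul b w.2 ψ := by
  have h1 : ∑ i, ∑ j, b.coord i w.1 • extMul (b.coord j) (contraction ⁅b i, b j⁆ ψ) =
      formDerivation (LieAlgebra.ad ℝ V w.1) ψ := by
    rw [formDerivation_eq_sum b, Finset.sum_comm]
    refine Finset.sum_congr rfl fun j _ => ?_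
    have := sum_coord_smul b ((extMul (b.coord j)) ∘ₗ (contraction (V := V)).flip ψ ∘ₗ
      (LieAlgebra.ad ℝ V : V →ₗ[ℝ] Module.End ℝ V).flip (b j)) w.1
    simpa using this
  have h2 : ∑ i, ∑ j, b.coord j w.1 • extMul (b.coord i) (contraction ⁅b i, b j⁆ ψ) =
      -formDerivation (LieAlgebra.ad ℝ V w.1) ψ := by
    rw [← h1, Finset.sum_comm, ← Finset.sum_neg_distrib]
    refine Finset.sum_congr rfl fun i _ => ?_
    rw [← Finset.sum_neg_distrib]
    refine Finset.sum_congr rfl fun j _ => ?_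
    rw [← lie_skew, map_neg, LinearMap.neg_apply, map_neg, smul_neg]
  have h3 : rho w (∑ i, ∑ j, extMul (b.coord i) (extMul (b.coord j)
      (contraction ⁅b i, b j⁆ ψ))) = (∑ i, ∑ j, b.coord i w.1 • extMul (b.coord j)
      (contraction ⁅b i, b j⁆ ψ)) - (∑ i, ∑ j, b.coord j w.1 • extMul (b.coord i)
      (contraction ⁅b i, b j⁆ ψ)) + bracketMul b w.2 ψ := by
    simp only [bracketMul, map_sum, ← Finset.sum_sub_distrib, ← Finset.sum_add_distrib]
    refine Finset.sum_congr rfl fun i _ => Finset.sum_congr rfl fun j _ => ?_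
    rw [rho_extMul, rho_extMul, rho_contraction, hw, map_zero, sub_zero]
    simp only [map_sub, map_smul]
    abel
  rw [chevalleyEilenberg, map_smul, h3, h1, h2]
  module

/-- The graded commutator of `η ∧ ·` with `ρ(v ⊕ α)` is the product with the 2-form `ι(v)η`. -/
theorem rho_threeFormMul (B : LinearMap.BilinForm ℝ V) (hB : B.IsSymm)
    (hBad : ∀ u v w : V, B ⁅u, v⁆ w = -B v ⁅u, w⁆) (η : V [⋀^Fin 3]→ₗ[ℝ] ℝ)
    (hη : ∀ x y z, η ![x, y, z] = (1 / 2 : ℝ) * B x ⁅y, z⁆) (w : Double V) (ψ : Spinor V)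
    (hw : rho w ψ = 0) :
    rho w (threeFormMul η ψ) = (1 / 4 : ℝ) • bracketMul b (B w.1) ψ := by
  have hsym : ∀ x y, B x y = B y x := fun x y => hB.eq x y
  have h1 : ∑ i, ∑ j, ∑ k, (η ![b i, b j, b k] * b.coord i w.1) •
      extMul (b.coord j) (extMul (b.coord k) ψ) = (1 / 2 : ℝ) • bracketMul b (B w.1) ψ := by
    rw [bracketMul, Finset.sum_comm, Finset.smul_sum]
    refine Finset.sum_congr rfl fun j _ => ?_
    rw [Finset.sum_comm, Finset.smul_sum]
    refine Finset.sum_congr rfl fun k _ => ?_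
    rw [← Finset.sum_smul, smul_smul]
    congr 1
    have h2 : ∑ i, b.coord i w.1 * B (b i) ⁅b j, b k⁆ = B w.1 ⁅b j, b k⁆ :=
      sum_coord_smul b (LinearMap.flip (B : V →ₗ[ℝ] V →ₗ[ℝ] ℝ) ⁅b j, b k⁆) w.1
    rw [← h2, Finset.mul_sum]
    refine Finset.sum_congr rfl fun i _ => ?_
    rw [hη]
    ring
  have hinv : ∀ x y z, B x ⁅y, z⁆ = B ⁅x, y⁆ z := fun x y z => by
    rw [← lie_skew y, ← lie_skew x, map_neg, map_neg, LinearMap.neg_apply, hBad, neg_neg,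
      ← lie_skew z, map_neg, neg_neg]
  have hcyc : ∀ x y z, η ![x, y, z] = η ![z, x, y] := fun x y z => by
    rw [hη, hη, hinv, hsym]
  have hsk : ∀ x y z, η ![x, y, z] = -η ![y, x, z] := fun x y z => by
    rw [hη, hη, hinv, hBad, mul_neg]
  have h3 : rho w (threeFormMul η ψ) = (1 / 6 : ℝ) • (
      (∑ i, ∑ j, ∑ k, (η ![b i, b j, b k] * b.coord i w.1) •
        extMul (b.coord j) (extMul (b.coord k) ψ)) -
      (∑ i, ∑ j, ∑ k, (η ![b i, b j, b k] * b.coord j w.1) •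
        extMul (b.coord i) (extMul (b.coord k) ψ)) +
      ∑ i, ∑ j, ∑ k, (η ![b i, b j, b k] * b.coord k w.1) •
        extMul (b.coord i) (extMul (b.coord j) ψ)) := by
    rw [threeFormMul_eq_sum b]
    simp only [map_smul, map_sum, ← Finset.sum_sub_distrib, ← Finset.sum_add_distrib]
    congr 1
    refine Finset.sum_congr rfl fun i _ => Finset.sum_congr rfl fun j _ =>
      Finset.sum_congr rfl fun k _ => ?_
    rw [rho_extMul, rho_extMul, rho_extMul, hw, map_zero, sub_zero]
    simp only [map_sub, map_smul]
    module
  have h4 : ∑ i, ∑ j, ∑ k, (η ![b i, b j, b k] * b.coord j w.1) •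
        extMul (b.coord i) (extMul (b.coord k) ψ) = -((1 / 2 : ℝ) • bracketMul b (B w.1) ψ) := by
    rw [← h1, Finset.sum_comm]
    simp only [← Finset.sum_neg_distrib]
    refine Finset.sum_congr rfl fun i _ => Finset.sum_congr rfl fun j _ =>
      Finset.sum_congr rfl fun k _ => ?_
    rw [hsk]
    module
  have h5 : ∑ i, ∑ j, ∑ k, (η ![b i, b j, b k] * b.coord k w.1) •
        extMul (b.coord i) (extMul (b.coord j) ψ) = (1 / 2 : ℝ) • bracketMul b (B w.1) ψ := by
    rw [← h1]
    have : ∀ f : ι → ι → ι → Spinor V, ∑ i, ∑ j, ∑ k, f i j k = ∑ k, ∑ i, ∑ j, f i j k :=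
      fun f => (Finset.sum_congr rfl fun i _ => Finset.sum_comm).trans Finset.sum_comm
    rw [this]
    refine Finset.sum_congr rfl fun i _ => Finset.sum_congr rfl fun j _ =>
      Finset.sum_congr rfl fun k _ => ?_
    rw [hcyc]
  rw [h3, h1, h4, h5]
  module

/-- The algebraic form of the identity `ρ(e)(d + η)φ = 0` for sections `e` of `E`. Here `f` and `F`
are the value and the derivative at a point of a form in left trivialization, and `A = Ad_g`:
the three hypotheses say that `e` annihilates the form at the point, that it does so near the
point, and that the form is invariant under conjugation. -/
theorem rho_twistedDifferential_eq_zero (B : LinearMap.BilinForm ℝ V) (hB : B.IsSymm)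
    (hBad : ∀ u v w : V, B ⁅u, v⁆ w = -B v ⁅u, w⁆) (η : V [⋀^Fin 3]→ₗ[ℝ] ℝ)
    (hη : ∀ x y z, η ![x, y, z] = (1 / 2 : ℝ) * B x ⁅y, z⁆) (A : V →ₗ[ℝ] V) (f : Spinor V)
    (F : V →ₗ[ℝ] Spinor V) (h1 : ∀ v, rho (kappa B (A v, v)) f = 0)
    (h2 : ∀ ξ v, rho (kappa B (A v, v)) (F ξ) + rho (kappa B (A ⁅ξ, v⁆, 0)) f = 0)
    (h3 : ∀ v, F (A v - v) = formDerivation (LieAlgebra.ad ℝ V (A v)) f) (v : V) :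
    rho (kappa B (A v, v)) ((∑ i, extMul (b.coord i) (F (b i))) + chevalleyEilenberg b f +
      threeFormMul η f) = 0 := by
  have hT1 : rho (kappa B (A v, v)) (∑ i, extMul (b.coord i) (F (b i))) = F (A v - v) -
      formDerivation (LieAlgebra.ad ℝ V v) f + (1 / 2 : ℝ) • bracketMul b (B v) f := by
    have h4 : ∀ i, rho (kappa B (A v, v)) (extMul (b.coord i) (F (b i))) =
        b.coord i (A v - v) • F (b i) - extMul (b.coord i) (contraction ⁅v, b i⁆ f) +
          (1 / 2 : ℝ) • ∑ j, B v ⁅b i, b j⁆ • extMul (b.coord i) (extMul (b.coord j) f) := by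
      intro i
      have h5 := h2 (b i) v
      have h6 := h1 ⁅b i, v⁆
      rw [kappa_add_right, map_add, LinearMap.add_apply] at h6
      -- `κ(A[eᵢ, v] ⊕ [eᵢ, v])` annihilates `f`, which trades the first summand for the second.
      have h7 : rho (kappa B (A v, v)) (F (b i)) = rho (kappa B (0, ⁅b i, v⁆)) f := by
        rw [eq_neg_of_add_eq_zero_left h5, eq_neg_of_add_eq_zero_left h6, neg_neg]
      have h8 : kappa B (0, ⁅b i, v⁆) = (⁅v, b i⁆, (1 / 2 : ℝ) • B ⁅b i, v⁆) := by
        rw [kappa_apply, zero_sub, lie_skew, zero_add]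
      have h9 : rho (kappa B (0, ⁅b i, v⁆)) f = contraction ⁅v, b i⁆ f -
          (1 / 2 : ℝ) • ∑ j, B v ⁅b i, b j⁆ • extMul (b.coord j) f := by
        have h10 : ∀ j, B ⁅b i, v⁆ (b j) = (-1) * B v ⁅b i, b j⁆ := fun j => by
          rw [hBad, neg_one_mul]
        rw [h8, rho_apply, map_smul, LinearMap.smul_apply, ← sum_apply_smul_extMul b]
        simp only [h10, mul_smul, ← Finset.smul_sum]
        module
      rw [rho_extMul, h7, h9, map_sub, map_smul, map_sum, kappa_apply]
      simp only [map_smul]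
      exact sub_sub_eq_add_sub _ _ _ |>.trans (by abel)
    rw [map_sum, Finset.sum_congr rfl fun i _ => h4 i, Finset.sum_add_distrib,
      Finset.sum_sub_distrib, sum_coord_smul b F, ← Finset.smul_sum, formDerivation_eq_sum b]
    rfl
  rw [map_add, map_add, hT1, rho_chevalleyEilenberg b _ _ (h1 v),
    rho_threeFormMul b B hB hBad η hη _ _ (h1 v), h3]
  have h10 : formDerivation (LieAlgebra.ad ℝ V (A v)) f =
      formDerivation (LieAlgebra.ad ℝ V (kappa B (A v, v)).1) f +
        formDerivation (LieAlgebra.ad ℝ V v) f := by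
    rw [← formDerivation_add, kappa_apply, map_sub, sub_add_cancel]
  have h11 := bracketMul_linear b (B (A v)) (B v) (1 / 2) (1 / 2) f
  have h12 := bracketMul_linear b (B (A v)) (B v) 1 (-1) f
  have h13 : (kappa B (A v, v)).2 = (1 / 2 : ℝ) • B (A v) + (1 / 2 : ℝ) • B v := by
    rw [kappa_apply, map_add, smul_add]
  have h14 : B (kappa B (A v, v)).1 = (1 : ℝ) • B (A v) + (-1 : ℝ) • B v := by
    rw [kappa_apply, map_sub]
    module
  rw [h10, h13, h14, h11, h12]
  module

end TwistedDifferential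

/-! ### Translations and the adjoint action -/

section Translations

variable {E : Type*} [NormedAddCommGroup E] [NormedSpace ℝ E]
  {G : Type*} [TopologicalSpace G] [ChartedSpace E G]

/-- Chain rule for self-maps of `G`, with the base points of the derivatives given up to
equality. -/
theorem mfderiv_comp_apply_of_eq {p q r : G → G} {x y : G} (hp : MDifferentiable 𝓘(ℝ, E) 𝓘(ℝ, E) p)
    (hq : MDifferentiable 𝓘(ℝ, E) 𝓘(ℝ, E) q) (hy : q x = y) (hr : ∀ h, p (q h) = r h) (v : E) :
    (mfderiv 𝓘(ℝ, E) 𝓘(ℝ, E) p y : E →L[ℝ] E) ((mfderiv 𝓘(ℝ, E) 𝓘(ℝ, E) q x : E →L[ℝ] E) v) =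
      (mfderiv 𝓘(ℝ, E) 𝓘(ℝ, E) r x : E →L[ℝ] E) v := by
  subst hy
  have h : r = p ∘ q := funext fun h => (hr h).symm
  rw [h, mfderiv_comp x (hp _) (hq _)]
  rfl

theorem mfderiv_id_apply_of_eq {r : G → G} (x : G) (hr : ∀ h, r h = h) (v : E) :
    (mfderiv 𝓘(ℝ, E) 𝓘(ℝ, E) r x : E →L[ℝ] E) v = v := by
  have h : r = id := funext hr
  rw [h, mfderiv_id]
  rfl

variable [Group G]

theorem Ad_one (ξ : GroupLieAlgebra 𝓘(ℝ, E) G) : Ad E (1 : G) ξ = ξ :=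
  mfderiv_id_apply_of_eq (E := E) 1 (fun h => by simp) ξ

variable [LieGroup 𝓘(ℝ, E) ∞ G]

theorem mdifferentiable_mul_left (a : G) :
    MDifferentiable 𝓘(ℝ, E) 𝓘(ℝ, E) (fun h : G => a * h) :=
  (contMDiff_mul_left (n := ∞)).mdifferentiable (by simp)

theorem mdifferentiable_mul_right (a : G) :
    MDifferentiable 𝓘(ℝ, E) 𝓘(ℝ, E) (fun h : G => h * a) :=
  (contMDiff_mul_right (n := ∞)).mdifferentiable (by simp)

theorem mdifferentiable_conj (a : G) :
    MDifferentiable 𝓘(ℝ, E) 𝓘(ℝ, E) (fun h : G => a * h * a⁻¹) :=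
  (mdifferentiable_mul_right a⁻¹).comp (mdifferentiable_mul_left a)

theorem thetaL_leftField (g : G) (ξ : GroupLieAlgebra 𝓘(ℝ, E) G) :
    thetaL E g (leftField g ξ) = ξ :=
  (mfderiv_comp_apply_of_eq (E := E) (r := fun h => h) (mdifferentiable_mul_left g⁻¹)
    (mdifferentiable_mul_left g) (mul_one g) (fun h => by simp) ξ).trans
    (mfderiv_id_apply_of_eq (E := E) 1 (fun _ => rfl) ξ)

theorem leftField_thetaL (g : G) (v : TangentSpace 𝓘(ℝ, E) g) :
    leftField g (thetaL E g v) = v :=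
  (mfderiv_comp_apply_of_eq (E := E) (r := fun h => h) (mdifferentiable_mul_left g)
    (mdifferentiable_mul_left g⁻¹) (inv_mul_cancel g) (fun h => by simp) v).trans
    (mfderiv_id_apply_of_eq (E := E) g (fun _ => rfl) v)

theorem thetaR_leftField (g : G) (ξ : GroupLieAlgebra 𝓘(ℝ, E) G) :
    thetaR E g (leftField g ξ) = Ad E g ξ :=
  mfderiv_comp_apply_of_eq (E := E) (mdifferentiable_mul_right g⁻¹)
    (mdifferentiable_mul_left g) (mul_one g) (fun _ => rfl) ξ

theorem rightField_Ad (g : G) (ξ : GroupLieAlgebra 𝓘(ℝ, E) G) :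
    rightField g (Ad E g ξ) = leftField g ξ :=
  mfderiv_comp_apply_of_eq (E := E) (mdifferentiable_mul_right g) (mdifferentiable_conj g)
    (by simp) (fun h => by simp) ξ

theorem Ad_mul (g h : G) (ξ : GroupLieAlgebra 𝓘(ℝ, E) G) :
    Ad E (g * h) ξ = Ad E g (Ad E h ξ) :=
  (mfderiv_comp_apply_of_eq (E := E) (r := fun k => g * h * k * (g * h)⁻¹)
    (mdifferentiable_conj g) (mdifferentiable_conj h) (by simp) (fun k => by simp [mul_assoc]) ξ).symm

theorem Ad_Ad_inv (g : G) (ξ : GroupLieAlgebra 𝓘(ℝ, E) G) : Ad E g (Ad E g⁻¹ ξ) = ξ := by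
  rw [← Ad_mul, mul_inv_cancel, Ad_one]

theorem thetaR_eq (g : G) (v : TangentSpace 𝓘(ℝ, E) g) : thetaR E g v = Ad E g (thetaL E g v) := by
  rw [← thetaR_leftField, leftField_thetaL]

/-- The left trivialization `θᴸ_g : T_gG ≅ 𝔤`. -/
def thetaEquiv (g : G) : TangentSpace 𝓘(ℝ, E) g ≃ₗ[ℝ] GroupLieAlgebra 𝓘(ℝ, E) G :=
  LinearEquiv.ofLinearMap (thetaL E g) (leftField g) (LinearMap.ext (thetaL_leftField g))
    (LinearMap.ext (leftField_thetaL g))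

/-- In left trivialization, the conjugation by `h` has the derivative `Ad_h`. -/
theorem thetaL_conj (h g : G) (v : TangentSpace 𝓘(ℝ, E) g) :
    thetaL E (h * g * h⁻¹)
      ((mfderiv 𝓘(ℝ, E) 𝓘(ℝ, E) (fun a : G => h * a * h⁻¹) g).toLinearMap v) =
      Ad E h (thetaL E g v) :=
  (mfderiv_comp_apply_of_eq (E := E) (r := fun a => h * (g⁻¹ * a) * h⁻¹)
      (mdifferentiable_mul_left (h * g * h⁻¹)⁻¹) (mdifferentiable_conj h)
      rfl (fun a => by simp [mul_assoc]) v).trans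
    (mfderiv_comp_apply_of_eq (E := E) (mdifferentiable_conj h) (mdifferentiable_mul_left g⁻¹)
      (inv_mul_cancel g) (fun a => rfl) v).symm

/-- In left trivialization, the section `e(ξ)` with `ξ = Ad_g v` takes the value `κ(Ad_g v ⊕ v)`. -/
theorem doubleMap_cartanMap {B : LinearMap.BilinForm ℝ (GroupLieAlgebra 𝓘(ℝ, E) G)}
    (hB : B.IsSymm) (hBinv : ∀ (g : G) (ξ ζ : GroupLieAlgebra 𝓘(ℝ, E) G),
      B (Ad E g ξ) (Ad E g ζ) = B ξ ζ) (g : G) (v : GroupLieAlgebra 𝓘(ℝ, E) G) :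
    doubleMap (thetaEquiv g) (cartanMap B g (Ad E g v)) = kappa B (Ad E g v, v) := by
  rw [doubleMap_apply, kappa_apply]
  refine Prod.ext ?_ (LinearMap.ext fun w => ?_)
  · change thetaL E g (leftField g (Ad E g v) - rightField g (Ad E g v)) = _
    rw [rightField_Ad, ← map_sub, thetaL_leftField]
  · change B ((1 / 2 : ℝ) • (thetaL E g (leftField g w) + thetaR E g (leftField g w))) (Ad E g v) =
      (1 / 2 : ℝ) * B (Ad E g v + v) w
    rw [thetaL_leftField, thetaR_leftField, map_smul, LinearMap.smul_apply, map_add, map_add,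
      LinearMap.add_apply, LinearMap.add_apply, hBinv, smul_eq_mul, hB.eq w, hB.eq w]

theorem mem_cartanDirac_iff {B : LinearMap.BilinForm ℝ (GroupLieAlgebra 𝓘(ℝ, E) G)}
    (hB : B.IsSymm) (hBinv : ∀ (g : G) (ξ ζ : GroupLieAlgebra 𝓘(ℝ, E) G),
      B (Ad E g ξ) (Ad E g ζ) = B ξ ζ) (g : G) (w : Double (TangentSpace 𝓘(ℝ, E) g)) :
    w ∈ cartanDirac B g ↔ doubleMap (thetaEquiv g) w ∈
      LinearMap.range ((kappa B).comp ((Ad E g).prod LinearMap.id)) := by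
  constructor
  · rintro ⟨ξ, rfl⟩
    refine ⟨Ad E g⁻¹ ξ, ?_⟩
    have h := doubleMap_cartanMap hB hBinv g (Ad E g⁻¹ ξ)
    rw [Ad_Ad_inv] at h
    rw [h]
    change kappa B (Ad E g (Ad E g⁻¹ ξ), Ad E g⁻¹ ξ) = _
    rw [Ad_Ad_inv]
  · rintro ⟨v, hv⟩
    refine ⟨Ad E g v, (doubleMap (thetaEquiv g)).injective ?_⟩
    rw [doubleMap_cartanMap hB hBinv, ← hv]
    rfl

end Translations

/-! ### Charts and the smoothness of invariant vector fields -/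

section Charts

open Bundle Set

variable {E : Type*} [NormedAddCommGroup E] [NormedSpace ℝ E]
  {M : Type*} [TopologicalSpace M] [ChartedSpace E M]

/-- The derivative at `x` of the preferred chart at `x₀`. -/
def chartDeriv (x₀ x : M) : E →L[ℝ] E := mfderiv 𝓘(ℝ, E) 𝓘(ℝ, E) (extChartAt 𝓘(ℝ, E) x₀) x

/-- The derivative at `y` of the inverse of the preferred chart at `x₀`. -/
def chartSymmDeriv (x₀ : M) (y : E) : E →L[ℝ] E :=
  mfderiv 𝓘(ℝ, E) 𝓘(ℝ, E) (extChartAt 𝓘(ℝ, E) x₀).symm y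

variable [IsManifold 𝓘(ℝ, E) ∞ M]

theorem chartDeriv_chartSymmDeriv {x₀ : M} {y : E} (hy : y ∈ (extChartAt 𝓘(ℝ, E) x₀).target)
    (v : E) : chartDeriv x₀ ((extChartAt 𝓘(ℝ, E) x₀).symm y) (chartSymmDeriv x₀ y v) = v := by
  have h := mfderiv_extChartAt_comp_mfderivWithin_extChartAt_symm (I := 𝓘(ℝ, E)) hy
  rw [ModelWithCorners.range_eq_univ, mfderivWithin_univ] at h
  exact DFunLike.congr_fun h v

theorem chartSymmDeriv_chartDeriv {x₀ : M} {y : E} (hy : y ∈ (extChartAt 𝓘(ℝ, E) x₀).target)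
    (v : E) : chartSymmDeriv x₀ y (chartDeriv x₀ ((extChartAt 𝓘(ℝ, E) x₀).symm y) v) = v := by
  have h := mfderivWithin_extChartAt_symm_comp_mfderiv_extChartAt (I := 𝓘(ℝ, E)) hy
  rw [ModelWithCorners.range_eq_univ, mfderivWithin_univ] at h
  exact DFunLike.congr_fun h v

theorem chartDeriv_self (x : M) : chartDeriv x x = ContinuousLinearMap.id ℝ E :=
  mfderiv_extChartAt_self

theorem chartSymmDeriv_self (x : M) :
    chartSymmDeriv x (extChartAt 𝓘(ℝ, E) x x) = ContinuousLinearMap.id ℝ E := by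
  have h := mfderivWithin_range_extChartAt_symm (I := 𝓘(ℝ, E)) (x := x)
  rwa [ModelWithCorners.range_eq_univ, mfderivWithin_univ] at h

/-- A smooth vector field along `p` is smooth in the preferred chart at `x₀`. -/
theorem contMDiffOn_chartDeriv {N : Type*} [TopologicalSpace N] [ChartedSpace E N]
    {p : N → M} {X : ∀ x, TangentSpace 𝓘(ℝ, E) (p x)}
    {U : Set N} (hX : ContMDiffOn 𝓘(ℝ, E) 𝓘(ℝ, E).tangent ∞
      (fun x => (⟨p x, X x⟩ : TangentBundle 𝓘(ℝ, E) M)) U) (x₀ : M) :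
    ContMDiffOn 𝓘(ℝ, E) 𝓘(ℝ, E) ∞ (fun x => chartDeriv x₀ (p x) (X x))
      (U ∩ p ⁻¹' (chartAt E x₀).source) := by
  have h := ((trivializationAt E (TangentSpace 𝓘(ℝ, E)) x₀).contMDiffOn_iff
    (IB := 𝓘(ℝ, E)) (fun x hx => ?_)).1 (hX.mono
      (inter_subset_left (t := p ⁻¹' (chartAt E x₀).source)))
  · refine h.2.congr fun x hx => ?_
    rw [chartDeriv, ← TangentBundle.continuousLinearMapAt_trivializationAt hx.2]
    exact ((trivializationAt E (TangentSpace 𝓘(ℝ, E)) x₀).continuousLinearMapAt_apply_of_mem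
      (R := ℝ)
      (b := p x) hx.2 (X x))
  · exact (trivializationAt E (TangentSpace 𝓘(ℝ, E)) x₀).mem_source.2 hx.2

theorem contDiffOn_chartDeriv {X : ∀ x : M, TangentSpace 𝓘(ℝ, E) x}
    {U : Set M} (hX : ContMDiffOn 𝓘(ℝ, E) 𝓘(ℝ, E).tangent ∞
      (fun x => (⟨x, X x⟩ : TangentBundle 𝓘(ℝ, E) M)) U) (x₀ : M) :
    ContDiffOn ℝ ∞ (fun y => chartDeriv x₀ ((extChartAt 𝓘(ℝ, E) x₀).symm y)
      (X ((extChartAt 𝓘(ℝ, E) x₀).symm y)))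
      ((extChartAt 𝓘(ℝ, E) x₀).target ∩ (extChartAt 𝓘(ℝ, E) x₀).symm ⁻¹' U) := by
  rw [← contMDiffOn_iff_contDiffOn]
  refine (contMDiffOn_chartDeriv hX x₀).comp
    ((contMDiffOn_extChartAt_symm x₀).mono inter_subset_left) fun y hy => ⟨hy.2, ?_⟩
  have := (extChartAt 𝓘(ℝ, E) x₀).map_target hy.1
  rwa [extChartAt_source] at this

/-- The derivative of `P(x, ·)` at `a` depends smoothly on `x`. -/
theorem contMDiff_mfderiv_snd {P : M × M → M}
    (hP : ContMDiff (𝓘(ℝ, E).prod 𝓘(ℝ, E)) 𝓘(ℝ, E) ∞ P) (a : M) (v : TangentSpace 𝓘(ℝ, E) a) :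
    ContMDiff 𝓘(ℝ, E) 𝓘(ℝ, E).tangent ∞ (fun x => (⟨P (x, a),
      mfderiv 𝓘(ℝ, E) 𝓘(ℝ, E) (fun y => P (x, y)) a v⟩ : TangentBundle 𝓘(ℝ, E) M)) := by
  -- The derivative of `P` on the tangent vector `(0, v)` at `(x, a)`.
  let fg : M → TangentBundle 𝓘(ℝ, E) M := fun g ↦ TotalSpace.mk' E g 0
  have sfg : CMDiff ∞ fg := contMDiff_zeroSection _ _
  let fv : M → TangentBundle 𝓘(ℝ, E) M := fun _ ↦ TotalSpace.mk' E a v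
  have sfv : CMDiff ∞ fv := contMDiff_const
  have S₁ : CMDiff ∞ (fun g => (fg g, fv g)) := sfg.prodMk sfv
  have S₂ : CMDiff ∞ (equivTangentBundleProd 𝓘(ℝ, E) M 𝓘(ℝ, E) M).symm :=
    contMDiff_equivTangentBundleProd_symm
  have S₃ : CMDiff ∞ (tangentMap (𝓘(ℝ, E).prod 𝓘(ℝ, E)) 𝓘(ℝ, E) P) :=
    ContMDiff.contMDiff_tangentMap hP (m := ∞) (by simp)
  convert! (S₃.comp S₂).comp S₁ with g
  let w : TangentSpace (𝓘(ℝ, E).prod 𝓘(ℝ, E)) (g, a) := ((0 : E), (id v : E))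
  have h := mfderiv_prod_eq_add_apply (hP.mdifferentiableAt (x := (g, a)) (by simp)) (v := w)
  refine Eq.trans ?_ h.symm
  have h0 := map_zero (mfderiv 𝓘(ℝ, E) 𝓘(ℝ, E) (fun z => P (z, a)) g : E →L[ℝ] E)
  exact (zero_add _).symm.trans (congrArg₂ (fun a b : E => a + b) h0.symm rfl)

end Charts

section InvariantFields

open Set

variable {E : Type*} [NormedAddCommGroup E] [NormedSpace ℝ E]
  {G : Type*} [TopologicalSpace G] [ChartedSpace E G] [Group G] [LieGroup 𝓘(ℝ, E) ∞ G]

/-- `Ad_g` as an endomorphism of the model space, with which `𝔤` and all tangent spaces are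
identified by definition. In this form it has a derivative with respect to `g`. -/
def AdCLM (g : G) : E →L[ℝ] E := mfderiv 𝓘(ℝ, E) 𝓘(ℝ, E) (fun h : G => g * h * g⁻¹) 1

/-- `ξ ↦ ξᴸ_g` as an endomorphism of the model space. -/
def leftCLM (g : G) : E →L[ℝ] E := mfderiv 𝓘(ℝ, E) 𝓘(ℝ, E) (fun h : G => g * h) 1

/-- `ξ ↦ ξᴿ_g` as an endomorphism of the model space. -/
def rightCLM (g : G) : E →L[ℝ] E := mfderiv 𝓘(ℝ, E) 𝓘(ℝ, E) (fun h : G => h * g) 1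

/-- `θᴸ_g` as an endomorphism of the model space. -/
def thetaCLM (g : G) : E →L[ℝ] E := mfderiv 𝓘(ℝ, E) 𝓘(ℝ, E) (fun h : G => g⁻¹ * h) g

theorem thetaCLM_leftCLM (g : G) (ξ : E) : thetaCLM g (leftCLM g ξ) = ξ := thetaL_leftField g ξ

theorem leftCLM_thetaCLM (g : G) (v : E) : leftCLM g (thetaCLM g v) = v := leftField_thetaL g v

theorem rightCLM_AdCLM (g : G) (ξ : E) : rightCLM g (AdCLM g ξ) = leftCLM g ξ := rightField_Ad g ξ

theorem contMDiff_leftField (ξ : GroupLieAlgebra 𝓘(ℝ, E) G) :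
    ContMDiff 𝓘(ℝ, E) 𝓘(ℝ, E).tangent ∞
      (fun g : G => (⟨g, leftField g ξ⟩ : TangentBundle 𝓘(ℝ, E) G)) := by
  convert! contMDiff_mfderiv_snd (contMDiff_mul 𝓘(ℝ, E) ∞) (1 : G) ξ using 3 with g
  exact (mul_one g).symm

theorem contMDiff_rightField (ξ : GroupLieAlgebra 𝓘(ℝ, E) G) :
    ContMDiff 𝓘(ℝ, E) 𝓘(ℝ, E).tangent ∞
      (fun g : G => (⟨g, rightField g ξ⟩ : TangentBundle 𝓘(ℝ, E) G)) := by
  convert! contMDiff_mfderiv_snd (P := fun p : G × G => p.2 * p.1)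
    (contMDiff_snd.mul contMDiff_fst) (1 : G) ξ using 3 with g
  exact (one_mul g).symm

theorem contMDiff_AdCLM (ξ : E) : ContMDiff 𝓘(ℝ, E) 𝓘(ℝ, E) ∞ (fun g : G => AdCLM g ξ) := by
  have hP : ContMDiff (𝓘(ℝ, E).prod 𝓘(ℝ, E)) 𝓘(ℝ, E) ∞ (fun p : G × G => p.1 * p.2 * p.1⁻¹) :=
    (contMDiff_fst.mul contMDiff_snd).mul contMDiff_fst.inv
  have h := contMDiffOn_chartDeriv (contMDiff_mfderiv_snd hP (1 : G) ξ).contMDiffOn (U := univ) 1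
  have h1 : ∀ g : G, g * 1 * g⁻¹ = 1 := fun g => by simp
  rw [← contMDiffOn_univ]
  refine (h.mono fun g _ => ⟨mem_univ g, ?_⟩).congr fun g _ => ?_
  · change g * 1 * g⁻¹ ∈ (chartAt E (1 : G)).source
    rw [h1]
    exact mem_chart_source E 1
  · have h2 : chartDeriv (E := E) (1 : G) (g * 1 * g⁻¹) = ContinuousLinearMap.id ℝ E := by
      rw [h1, chartDeriv_self]
    exact (DFunLike.congr_fun h2 _).symm

/-- The left-invariant vector fields in the preferred chart at `x₀`. -/
def chartLeft (x₀ : G) (y : E) : E →L[ℝ] E :=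
  (chartDeriv x₀ ((extChartAt 𝓘(ℝ, E) x₀).symm y)).comp
    (leftCLM ((extChartAt 𝓘(ℝ, E) x₀).symm y))

/-- The left-invariant Maurer-Cartan form in the preferred chart at `x₀`. -/
def chartTheta (x₀ : G) (y : E) : E →L[ℝ] E :=
  (thetaCLM ((extChartAt 𝓘(ℝ, E) x₀).symm y)).comp (chartSymmDeriv x₀ y)

theorem chartTheta_chartLeft {x₀ : G} {y : E} (hy : y ∈ (extChartAt 𝓘(ℝ, E) x₀).target) (ξ : E) :
    chartTheta x₀ y (chartLeft x₀ y ξ) = ξ := by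
  rw [chartTheta, chartLeft, ContinuousLinearMap.comp_apply, ContinuousLinearMap.comp_apply,
    chartSymmDeriv_chartDeriv hy, thetaCLM_leftCLM]

theorem chartLeft_chartTheta {x₀ : G} {y : E} (hy : y ∈ (extChartAt 𝓘(ℝ, E) x₀).target) (v : E) :
    chartLeft x₀ y (chartTheta x₀ y v) = v := by
  rw [chartTheta, chartLeft, ContinuousLinearMap.comp_apply, ContinuousLinearMap.comp_apply,
    leftCLM_thetaCLM, chartDeriv_chartSymmDeriv hy]

theorem chartLeft_self (x₀ : G) (ξ : E) :
    chartLeft x₀ (extChartAt 𝓘(ℝ, E) x₀ x₀) ξ = leftCLM x₀ ξ := by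
  rw [chartLeft, extChartAt_to_inv, chartDeriv_self]
  rfl

theorem chartTheta_self (x₀ : G) (v : E) :
    chartTheta x₀ (extChartAt 𝓘(ℝ, E) x₀ x₀) v = thetaCLM x₀ v := by
  rw [chartTheta, extChartAt_to_inv, chartSymmDeriv_self]
  rfl

variable [FiniteDimensional ℝ E]

theorem contDiffOn_chartLeft (x₀ : G) :
    ContDiffOn ℝ ∞ (chartLeft (E := E) x₀) (extChartAt 𝓘(ℝ, E) x₀).target := by
  rw [contDiffOn_clm_apply]
  intro ξ
  have h := contDiffOn_chartDeriv (contMDiff_leftField (E := E) (G := G) ξ).contMDiffOn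
    (U := univ) x₀
  exact h.mono fun y hy => ⟨hy, mem_univ _⟩

/-- The Maurer-Cartan form is smooth, as the inverse of the frame of left-invariant fields. -/
theorem contDiffOn_chartTheta (x₀ : G) :
    ContDiffOn ℝ ∞ (chartTheta (E := E) x₀) (extChartAt 𝓘(ℝ, E) x₀).target := by
  have h : ∀ y ∈ (extChartAt 𝓘(ℝ, E) x₀).target,
      chartTheta (E := E) x₀ y = (chartLeft x₀ y).inverse := fun y hy =>
    (ContinuousLinearMap.inverse_eq (f := chartLeft x₀ y) (g := chartTheta x₀ y)
      (ContinuousLinearMap.ext fun v => chartLeft_chartTheta hy v)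
      (ContinuousLinearMap.ext fun v => chartTheta_chartLeft hy v)).symm
  intro y hy
  refine ContDiffWithinAt.congr ?_ h (h y hy)
  let e : E ≃L[ℝ] E := ContinuousLinearEquiv.equivOfInverse (chartLeft x₀ y) (chartTheta x₀ y)
    (chartTheta_chartLeft hy) (chartLeft_chartTheta hy)
  have he : (e : E →L[ℝ] E) = chartLeft x₀ y := rfl
  exact ContDiffAt.comp_contDiffWithinAt y (he ▸ contDiffAt_map_inverse e)
    (contDiffOn_chartLeft x₀ y hy)

end InvariantFields

/-! ### The Maurer-Cartan equation -/

section MaurerCartan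

open Set VectorField Filter
open scoped Topology

variable {E : Type*} [NormedAddCommGroup E] [NormedSpace ℝ E] [FiniteDimensional ℝ E]
  {G : Type*} [TopologicalSpace G] [ChartedSpace E G] [Group G] [LieGroup 𝓘(ℝ, E) ∞ G]

/-- A smooth Lie group is a Lie group of the regularity at which its Lie algebra is defined. -/
instance lieGroup_minSmoothness : LieGroup 𝓘(ℝ, E) (minSmoothness ℝ 3) G :=
  LieGroup.of_le (n := ∞) (by
    rw [minSmoothness_of_isRCLikeNormedField]
    exact ENat.LEInfty.out)

instance finiteDimensional_groupLieAlgebra : FiniteDimensional ℝ (GroupLieAlgebra 𝓘(ℝ, E) G) :=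
  inferInstanceAs (FiniteDimensional ℝ E)

variable (G) in
/-- The Lie bracket of `𝔤`, on the model space with which `𝔤` is identified. -/
def modelBracket (ξ ζ : E) : E :=
  Bracket.bracket (L := GroupLieAlgebra 𝓘(ℝ, E) G) (M := GroupLieAlgebra 𝓘(ℝ, E) G) ξ ζ

theorem differentiableAt_chartLeft (x₀ : G) :
    DifferentiableAt ℝ (chartLeft (E := E) x₀) (extChartAt 𝓘(ℝ, E) x₀ x₀) :=
  ((contDiffOn_chartLeft x₀).contDiffAt (extChartAt_target_mem_nhds x₀)).differentiableAt
    (by simp)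

theorem differentiableAt_chartTheta (x₀ : G) :
    DifferentiableAt ℝ (chartTheta (E := E) x₀) (extChartAt 𝓘(ℝ, E) x₀ x₀) :=
  ((contDiffOn_chartTheta x₀).contDiffAt (extChartAt_target_mem_nhds x₀)).differentiableAt
    (by simp)

/-- The Lie bracket of `𝔤` is the bracket of left-invariant vector fields, which is computed in the
preferred chart at `x₀`. -/
theorem leftCLM_modelBracket (x₀ : G) (ξ ζ : E) :
    leftCLM x₀ (modelBracket G ξ ζ) =
      fderiv ℝ (chartLeft x₀) (extChartAt 𝓘(ℝ, E) x₀ x₀) (leftCLM x₀ ξ) ζ -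
      fderiv ℝ (chartLeft x₀) (extChartAt 𝓘(ℝ, E) x₀ x₀) (leftCLM x₀ ζ) ξ := by
  obtain ⟨V, hV⟩ : ∃ V : E → E → E, V = fun ξ => mpullbackWithin 𝓘(ℝ, E) 𝓘(ℝ, E)
    (extChartAt 𝓘(ℝ, E) x₀).symm (mulInvariantVectorField (G := G) (I := 𝓘(ℝ, E)) ξ)
    (range 𝓘(ℝ, E)) := ⟨_, rfl⟩
  have h1 : leftCLM x₀ (modelBracket G ξ ζ) = (chartDeriv x₀ x₀).inverse
      (lieBracketWithin ℝ (V ξ) (V ζ) ((extChartAt 𝓘(ℝ, E) x₀).symm ⁻¹' univ ∩ range 𝓘(ℝ, E))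
        (extChartAt 𝓘(ℝ, E) x₀ x₀)) := by
    subst hV
    exact congrFun (mulInvariantVector_mlieBracket (I := 𝓘(ℝ, E)) (G := G) ξ ζ) x₀
  have h2 : ∀ ξ : E, V ξ =ᶠ[𝓝 (extChartAt 𝓘(ℝ, E) x₀ x₀)] fun y => chartLeft x₀ y ξ := by
    intro ξ
    filter_upwards [extChartAt_target_mem_nhds (I := 𝓘(ℝ, E)) x₀] with y hy
    have h3 : (chartSymmDeriv x₀ y).inverse = chartDeriv x₀ ((extChartAt 𝓘(ℝ, E) x₀).symm y) :=
      ContinuousLinearMap.inverse_eq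
        (ContinuousLinearMap.ext fun v => chartSymmDeriv_chartDeriv hy v)
        (ContinuousLinearMap.ext fun v => chartDeriv_chartSymmDeriv hy v)
    rw [hV, ModelWithCorners.range_eq_univ]
    beta_reduce
    rw [mpullbackWithin_apply, mfderivWithin_univ]
    exact DFunLike.congr_fun h3 _
  have h4 : ∀ ξ : E, HasFDerivAt (fun y => chartLeft x₀ y ξ)
      ((fderiv ℝ (chartLeft (E := E) x₀) (extChartAt 𝓘(ℝ, E) x₀ x₀)).flip ξ)
        (extChartAt 𝓘(ℝ, E) x₀ x₀) := fun ξ => by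
    have := (differentiableAt_chartLeft (E := E) x₀).hasFDerivAt.clm_apply
      (hasFDerivAt_const ξ (extChartAt 𝓘(ℝ, E) x₀ x₀))
    refine this.congr_fderiv ?_
    ext v
    simp
  rw [h1, preimage_univ, univ_inter, ModelWithCorners.range_eq_univ, lieBracketWithin_univ,
    (h2 ξ).lieBracket_vectorField_eq (h2 ζ), lieBracket_eq, chartDeriv_self,
    ContinuousLinearMap.inverse_id, ContinuousLinearMap.id_apply]
  beta_reduce
  rw [(h4 _).fderiv, (h4 _).fderiv, chartLeft_self, chartLeft_self]
  rfl

/-- The Maurer-Cartan equation `dθ(u, v) = -[θ(u), θ(v)]`, in the preferred chart at `x₀`. -/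
theorem fderiv_chartTheta_sub (x₀ : G) (u v : E) :
    fderiv ℝ (chartTheta (E := E) x₀) (extChartAt 𝓘(ℝ, E) x₀ x₀) u v -
      fderiv ℝ (chartTheta (E := E) x₀) (extChartAt 𝓘(ℝ, E) x₀ x₀) v u =
    -modelBracket G (thetaCLM x₀ u) (thetaCLM x₀ v) := by
  set y₀ := extChartAt 𝓘(ℝ, E) x₀ x₀
  have h1 : ∀ w ξ : E, fderiv ℝ (chartTheta (E := E) x₀) y₀ w (leftCLM x₀ ξ) =
      - thetaCLM x₀ (fderiv ℝ (chartLeft (E := E) x₀) y₀ w ξ) := by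
    intro w ξ
    have h2 : (fun y => (chartTheta (E := E) x₀ y) (chartLeft x₀ y ξ)) =ᶠ[𝓝 y₀] fun _ => ξ := by
      filter_upwards [extChartAt_target_mem_nhds (I := 𝓘(ℝ, E)) x₀] with y hy
      exact chartTheta_chartLeft hy ξ
    have h3 := ((differentiableAt_chartTheta (E := E) x₀).hasFDerivAt.clm_apply
      ((differentiableAt_chartLeft (E := E) x₀).hasFDerivAt.clm_apply
        (hasFDerivAt_const ξ y₀))).unique ((hasFDerivAt_const ξ y₀).congr_of_eventuallyEq h2)
    have h4 := DFunLike.congr_fun h3 w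
    simp only [add_apply, ContinuousLinearMap.comp_apply,
      ContinuousLinearMap.flip_apply, zero_apply, map_zero, zero_add] at h4
    rw [chartTheta_self, chartLeft_self] at h4
    exact (eq_neg_of_add_eq_zero_right h4)
  obtain ⟨ξ, rfl⟩ : ∃ ξ, leftCLM x₀ ξ = u := ⟨_, leftCLM_thetaCLM x₀ u⟩
  obtain ⟨ζ, rfl⟩ : ∃ ξ, leftCLM x₀ ξ = v := ⟨_, leftCLM_thetaCLM x₀ v⟩
  rw [h1, h1, thetaCLM_leftCLM, thetaCLM_leftCLM, ← thetaCLM_leftCLM x₀ (modelBracket G ξ ζ),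
    leftCLM_modelBracket, map_sub]
  abel

end MaurerCartan

/-! ### The derivative of the adjoint action -/

section DerivAd

open Set Filter
open scoped Topology

variable {E : Type*} [NormedAddCommGroup E] [NormedSpace ℝ E]

theorem contDiffOn_comp_extChartAt_symm {M : Type*} [TopologicalSpace M] [ChartedSpace E M]
    [IsManifold 𝓘(ℝ, E) ∞ M] {F : Type*} [NormedAddCommGroup F] [NormedSpace ℝ F] {f : M → F}
    (hf : ContMDiff 𝓘(ℝ, E) 𝓘(ℝ, F) ∞ f) (x₀ : M) :
    ContDiffOn ℝ ∞ (fun y => f ((extChartAt 𝓘(ℝ, E) x₀).symm y)) (extChartAt 𝓘(ℝ, E) x₀).target :=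
  contMDiffOn_iff_contDiffOn.1 (hf.comp_contMDiffOn (contMDiffOn_extChartAt_symm x₀))

theorem hasMFDerivAt_of_hasFDerivAt_comp_symm {M : Type*} [TopologicalSpace M] [ChartedSpace E M]
    {F : Type*} [NormedAddCommGroup F] [NormedSpace ℝ F] {f : M → F} {x : M} {L : E →L[ℝ] F}
    (hf : ContinuousAt f x)
    (h : HasFDerivAt (fun y => f ((extChartAt 𝓘(ℝ, E) x).symm y)) L (extChartAt 𝓘(ℝ, E) x x)) :
    HasMFDerivAt 𝓘(ℝ, E) 𝓘(ℝ, F) f x L :=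
  ⟨hf, h.hasFDerivWithinAt⟩

theorem mfderiv_eq_fderiv_comp_symm {M : Type*} [TopologicalSpace M] [ChartedSpace E M]
    [IsManifold 𝓘(ℝ, E) ∞ M] {F : Type*} [NormedAddCommGroup F] [NormedSpace ℝ F] {f : M → F}
    (hf : ContMDiff 𝓘(ℝ, E) 𝓘(ℝ, F) ∞ f) (x : M) :
    mfderiv 𝓘(ℝ, E) 𝓘(ℝ, F) f x =
      fderiv ℝ (fun y => f ((extChartAt 𝓘(ℝ, E) x).symm y)) (extChartAt 𝓘(ℝ, E) x x) := by
  refine (hasMFDerivAt_of_hasFDerivAt_comp_symm hf.continuous.continuousAt ?_).mfderiv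
  exact (((contDiffOn_comp_extChartAt_symm hf x).contDiffAt
    (extChartAt_target_mem_nhds x)).differentiableAt (by simp)).hasFDerivAt

variable {G : Type*} [TopologicalSpace G] [ChartedSpace E G] [Group G]

/-- The product of `G` in the preferred chart at `1`. -/
def chartMul (G : Type*) [TopologicalSpace G] [ChartedSpace E G] [Group G] (p : E × E) : E :=
  extChartAt 𝓘(ℝ, E) (1 : G)
    ((extChartAt 𝓘(ℝ, E) (1 : G)).symm p.1 * (extChartAt 𝓘(ℝ, E) (1 : G)).symm p.2)

/-- The origin of the preferred chart at `1`. -/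
def chartOne (G : Type*) [TopologicalSpace G] [ChartedSpace E G] [Group G] : E :=
  extChartAt 𝓘(ℝ, E) (1 : G) 1

theorem extChartAt_symm_chartOne : (extChartAt 𝓘(ℝ, E) (1 : G)).symm (chartOne G) = 1 :=
  extChartAt_to_inv (1 : G)

variable [LieGroup 𝓘(ℝ, E) ∞ G]

theorem contDiffAt_chartMul : ContDiffAt ℝ ∞ (chartMul (E := E) G) (chartOne G, chartOne G) := by
  rw [← contMDiffAt_iff_contDiffAt]
  have hs : ContMDiffAt 𝓘(ℝ, E) 𝓘(ℝ, E) ∞ (extChartAt 𝓘(ℝ, E) (1 : G)).symm (chartOne G) :=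
    (contMDiffOn_extChartAt_symm (1 : G)).contMDiffAt (extChartAt_target_mem_nhds (1 : G))
  have h1 : ContMDiffAt 𝓘(ℝ, E × E) 𝓘(ℝ, E) ∞
      (fun p : E × E => (extChartAt 𝓘(ℝ, E) (1 : G)).symm p.1) (chartOne G, chartOne G) :=
    ContMDiffAt.comp (chartOne G, chartOne G) hs contDiff_fst.contMDiff.contMDiffAt
  have h2 : ContMDiffAt 𝓘(ℝ, E × E) 𝓘(ℝ, E) ∞
      (fun p : E × E => (extChartAt 𝓘(ℝ, E) (1 : G)).symm p.2) (chartOne G, chartOne G) :=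
    ContMDiffAt.comp (chartOne G, chartOne G) hs contDiff_snd.contMDiff.contMDiffAt
  refine ContMDiffAt.comp (chartOne G, chartOne G) ?_ (h1.mul h2)
  refine contMDiffAt_extChartAt' ?_
  rw [extChartAt_symm_chartOne, mul_one]
  exact mem_chart_source E 1

theorem hasFDerivAt_extChartAt_comp {q : G → G} {g : G} (hg : g ∈ (chartAt E (1 : G)).source)
    (hq : MDifferentiable 𝓘(ℝ, E) 𝓘(ℝ, E) q) (hqg : q 1 = g) :
    HasFDerivAt (fun y => extChartAt 𝓘(ℝ, E) (1 : G) (q ((extChartAt 𝓘(ℝ, E) (1 : G)).symm y)))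
      ((chartDeriv 1 g).comp (mfderiv 𝓘(ℝ, E) 𝓘(ℝ, E) q 1 : E →L[ℝ] E)) (chartOne G) := by
  subst hqg
  have hs : HasMFDerivAt 𝓘(ℝ, E) 𝓘(ℝ, E) (extChartAt 𝓘(ℝ, E) (1 : G)).symm (chartOne G)
      (chartSymmDeriv (E := E) (1 : G) (chartOne G)) :=
    (((contMDiffOn_extChartAt_symm (n := ∞) (1 : G)).contMDiffAt
      (extChartAt_target_mem_nhds (1 : G))).mdifferentiableAt (by simp)).hasMFDerivAt
  have hs1 := extChartAt_symm_chartOne (E := E) (G := G)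
  have hq' : HasMFDerivAt 𝓘(ℝ, E) 𝓘(ℝ, E) q ((extChartAt 𝓘(ℝ, E) (1 : G)).symm (chartOne G))
      (mfderiv 𝓘(ℝ, E) 𝓘(ℝ, E) q 1 : E →L[ℝ] E) := by
    rw [hs1]
    exact (hq 1).hasMFDerivAt
  have he : HasMFDerivAt 𝓘(ℝ, E) 𝓘(ℝ, E) (extChartAt 𝓘(ℝ, E) (1 : G))
      (q ((extChartAt 𝓘(ℝ, E) (1 : G)).symm (chartOne G))) (chartDeriv (E := E) 1 (q 1)) := by
    rw [hs1]
    exact (mdifferentiableAt_extChartAt hg).hasMFDerivAt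
  have h := hasMFDerivAt_iff_hasFDerivAt.1
    (HasMFDerivAt.comp (chartOne G) he (HasMFDerivAt.comp (chartOne G) hq' hs))
  have h1 : chartSymmDeriv (1 : G) (chartOne G) = ContinuousLinearMap.id ℝ E :=
    chartSymmDeriv_self (E := E) (1 : G)
  refine h.congr_fderiv (ContinuousLinearMap.ext fun v => ?_)
  exact congrArg (fun w : E => chartDeriv (E := E) 1 (q 1)
    ((mfderiv 𝓘(ℝ, E) 𝓘(ℝ, E) q 1 : E →L[ℝ] E) w)) (DFunLike.congr_fun h1 v)

variable [FiniteDimensional ℝ E]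

/-- The derivative of the adjoint action at `1` is the Lie bracket: both are given by the mixed
second derivatives of the product in a chart. -/
theorem fderiv_AdCLM_one (u ζ : E) :
    fderiv ℝ (fun y => AdCLM ((extChartAt 𝓘(ℝ, E) (1 : G)).symm y) ζ) (chartOne G) u =
      modelBracket G u ζ := by
  have hm : ContDiffAt ℝ ∞ (chartMul (E := E) G) (chartOne G, chartOne G) := contDiffAt_chartMul
  have hdiff : ∀ᶠ p in 𝓝 (chartOne G, chartOne G), DifferentiableAt ℝ (chartMul (E := E) G) p :=
    ((hm.of_le (m := 1) ENat.LEInfty.out).eventually (by simp)).mono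
      fun p hp => hp.differentiableAt (by simp)
  have hsource : ∀ᶠ y in 𝓝 (chartOne (E := E) G),
      (extChartAt 𝓘(ℝ, E) (1 : G)).symm y ∈ (chartAt E (1 : G)).source := by
    filter_upwards [extChartAt_target_mem_nhds (I := 𝓘(ℝ, E)) (1 : G)] with y hy
    simpa using (extChartAt 𝓘(ℝ, E) (1 : G)).map_target hy
  have hc1 : Tendsto (fun y : E => (y, chartOne (E := E) G)) (𝓝 (chartOne G))
      (𝓝 (chartOne G, chartOne G)) :=
    (Continuous.prodMk continuous_id continuous_const).tendsto _
  have hc2 : Tendsto (fun y : E => (chartOne (E := E) G, y)) (𝓝 (chartOne G))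
      (𝓝 (chartOne G, chartOne G)) :=
    (Continuous.prodMk continuous_const continuous_id).tendsto _
  -- The partial derivatives of the product are the left- and right-invariant vector fields.
  have hleft : ∀ᶠ y in 𝓝 (chartOne (E := E) G), ∀ ζ : E,
      fderiv ℝ (chartMul (E := E) G) (y, chartOne G) (0, ζ) = chartLeft (1 : G) y ζ := by
    filter_upwards [hc1.eventually hdiff, hsource] with y hy hy' ζ
    have h := hy.hasFDerivAt.comp (chartOne G)
      (hasFDerivAt_prodMk_right (𝕜 := ℝ) y (chartOne (E := E) G))
    exact DFunLike.congr_fun (h.unique (hasFDerivAt_extChartAt_comp hy'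
      (mdifferentiable_mul_left _) (mul_one _))) ζ
  have hright : ∀ᶠ y in 𝓝 (chartOne (E := E) G), ∀ ζ : E,
      fderiv ℝ (chartMul (E := E) G) (chartOne G, y) (ζ, 0) =
        chartDeriv (1 : G) ((extChartAt 𝓘(ℝ, E) (1 : G)).symm y)
          (rightCLM ((extChartAt 𝓘(ℝ, E) (1 : G)).symm y) ζ) := by
    filter_upwards [hc2.eventually hdiff, hsource] with y hy hy' ζ
    have h := hy.hasFDerivAt.comp (chartOne G)
      (hasFDerivAt_prodMk_left (𝕜 := ℝ) (chartOne (E := E) G) y)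
    exact DFunLike.congr_fun (h.unique (hasFDerivAt_extChartAt_comp hy'
      (mdifferentiable_mul_right _) (one_mul _))) ζ
  have hM : HasFDerivAt (fderiv ℝ (chartMul (E := E) G))
      (fderiv ℝ (fderiv ℝ (chartMul (E := E) G)) (chartOne G, chartOne G))
      (chartOne G, chartOne G) :=
    ((hm.fderiv_right (m := 1) (by norm_cast)).differentiableAt (by simp)).hasFDerivAt
  set M := fderiv ℝ (chartMul (E := E) G)
  set M₂ := fderiv ℝ M (chartOne G, chartOne G)
  have hsymm : ∀ p q, M₂ p q = M₂ q p := fun p q =>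
    (hm.isSymmSndFDerivAt (by simpa using ENat.LEInfty.out)).eq p q
  have hAd1 : ∀ v : E, AdCLM ((extChartAt 𝓘(ℝ, E) (1 : G)).symm (chartOne G)) v = v := fun v => by
    rw [extChartAt_symm_chartOne]
    exact Ad_one v
  have hleft1 : ∀ v : E, leftCLM (1 : G) v = v := fun v =>
    mfderiv_id_apply_of_eq (1 : G) (fun h => one_mul h) v
  have hid : ∀ v : E, M (chartOne G, chartOne G) (v, 0) = v := by
    intro v
    rw [hright.self_of_nhds, extChartAt_symm_chartOne, chartDeriv_self]
    exact mfderiv_id_apply_of_eq (1 : G) (fun h => mul_one h) v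
  have hAd : DifferentiableAt ℝ
      (fun y => AdCLM ((extChartAt 𝓘(ℝ, E) (1 : G)).symm y) ζ) (chartOne G) :=
    ((contDiffOn_comp_extChartAt_symm (contMDiff_AdCLM ζ) (1 : G)).contDiffAt
      (extChartAt_target_mem_nhds (1 : G))).differentiableAt (by simp)
  have hM1 := hM.comp (f := fun y => (y, chartOne G)) (chartOne G)
    (hasFDerivAt_prodMk_left (𝕜 := ℝ) (chartOne (E := E) G) (chartOne (E := E) G))
  have hM2 := hM.comp (f := fun y => (chartOne G, y)) (chartOne G)
    (hasFDerivAt_prodMk_right (𝕜 := ℝ) (chartOne (E := E) G) (chartOne (E := E) G))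
  have hchart : ∀ u ζ : E, fderiv ℝ (chartLeft (1 : G)) (chartOne G) u ζ = M₂ (u, 0) (0, ζ) := by
    intro u ζ
    have h0 : HasFDerivAt (chartLeft (E := E) (1 : G)) (fderiv ℝ (chartLeft (1 : G)) (chartOne G))
        (chartOne G) := (differentiableAt_chartLeft (1 : G)).hasFDerivAt
    have h1 := h0.clm_apply
      (hasFDerivAt_const ζ (chartOne (E := E) G))
    have h2 := hM1.clm_apply (hasFDerivAt_const ((0 : E), ζ) (chartOne (E := E) G))
    have h3 := (h2.congr_of_eventuallyEq (hleft.mono fun y hy => (hy ζ).symm)).unique h1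
    simpa [-extChartAt] using (DFunLike.congr_fun h3 u).symm
  -- The relation `ζᴸ = (Ad ζ)ᴿ`, to be differentiated at the origin of the chart.
  have hAdM : (fun y => M (y, chartOne G) (0, ζ)) =ᶠ[𝓝 (chartOne G)]
      fun y => M (chartOne G, y) (AdCLM ((extChartAt 𝓘(ℝ, E) (1 : G)).symm y) ζ, 0) := by
    filter_upwards [hleft, hright] with y h1 h2
    rw [h1, h2, rightCLM_AdCLM]
    rfl
  have h1 := hM1.clm_apply (hasFDerivAt_const ((0 : E), ζ) (chartOne (E := E) G))
  have h2 := hM2.clm_apply (hAd.hasFDerivAt.prodMk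
    (hasFDerivAt_const (0 : E) (chartOne (E := E) G)))
  have h3 := DFunLike.congr_fun ((h1.congr_of_eventuallyEq hAdM.symm).unique h2) u
  have h4 : M₂ (u, 0) (0, ζ) = M₂ (0, u) (ζ, 0) +
      fderiv ℝ (fun y => AdCLM ((extChartAt 𝓘(ℝ, E) (1 : G)).symm y) ζ) (chartOne G) u := by
    have h6 := hAd1 ζ
    simp only [add_apply, ContinuousLinearMap.comp_apply, ContinuousLinearMap.flip_apply,
      ContinuousLinearMap.prod_apply, ContinuousLinearMap.inl_apply, ContinuousLinearMap.inr_apply,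
      Function.comp_apply, zero_apply, map_zero, zero_add, hid, h6] at h3
    rw [h3, add_comm]
  have h5 := leftCLM_modelBracket (1 : G) u ζ
  rw [hleft1, hleft1, hleft1] at h5
  rw [h5]
  change _ = fderiv ℝ (chartLeft (1 : G)) (chartOne G) u ζ -
    fderiv ℝ (chartLeft (1 : G)) (chartOne G) ζ u
  rw [hchart, hchart, h4, hsymm (0, u)]
  abel

end DerivAd

/-! ### Smooth maps into spaces of alternating forms -/

section SmoothForms

open Set Filter
open scoped Topology

variable {E : Type*} [NormedAddCommGroup E] [NormedSpace ℝ E] [FiniteDimensional ℝ E]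

/-- An alternating form depends linearly and continuously on its values on a basis. -/
theorem exists_clm_eval_basis (E : Type*) [NormedAddCommGroup E] [NormedSpace ℝ E]
    [FiniteDimensional ℝ E] (k : ℕ) :
    ∃ T : ((Fin k → Fin (Module.finrank ℝ E)) → ℝ) →L[ℝ] (E [⋀^Fin k]→L[ℝ] ℝ),
      ∀ c : E [⋀^Fin k]→L[ℝ] ℝ, T (fun r => c fun i => Module.finBasis ℝ E (r i)) = c := by
  let L : (E [⋀^Fin k]→L[ℝ] ℝ) →ₗ[ℝ] ((Fin k → Fin (Module.finrank ℝ E)) → ℝ) :=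
    { toFun := fun c r => c fun i => Module.finBasis ℝ E (r i)
      map_add' := fun _ _ => rfl
      map_smul' := fun _ _ => rfl }
  have hL : LinearMap.ker L = ⊥ := by
    rw [LinearMap.ker_eq_bot]
    intro c c' h
    refine ContinuousAlternatingMap.toAlternatingMap_injective ?_
    refine Module.Basis.ext_alternating (Module.finBasis ℝ E) fun v _ => ?_
    exact congrFun h v
  obtain ⟨T, hT⟩ := L.exists_leftInverse_of_injective hL
  exact ⟨LinearMap.toContinuousLinearMap T, fun c => LinearMap.congr_fun hT c⟩

theorem contDiffOn_continuousAlternatingMap_of_eval {k : ℕ} {c : E → E [⋀^Fin k]→L[ℝ] ℝ}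
    {s : Set E} (h : ∀ w, ContDiffOn ℝ ∞ (fun y => c y w) s) : ContDiffOn ℝ ∞ c s := by
  obtain ⟨T, hT⟩ := exists_clm_eval_basis E k
  have h1 : ContDiffOn ℝ ∞ (fun y => T (fun r => c y fun i => Module.finBasis ℝ E (r i))) s :=
    T.contDiff.comp_contDiffOn (contDiffOn_pi.2 fun r => h _)
  simpa only [hT] using h1

variable {M : Type*} [TopologicalSpace M] [ChartedSpace E M]

theorem contMDiff_continuousAlternatingMap_of_eval {k : ℕ} {c : M → E [⋀^Fin k]→L[ℝ] ℝ}
    (h : ∀ w, ContMDiff 𝓘(ℝ, E) 𝓘(ℝ, ℝ) ∞ (fun x => c x w)) :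
    ContMDiff 𝓘(ℝ, E) 𝓘(ℝ, E [⋀^Fin k]→L[ℝ] ℝ) ∞ c := by
  obtain ⟨T, hT⟩ := exists_clm_eval_basis E k
  have h1 : ContMDiff 𝓘(ℝ, E) 𝓘(ℝ, E [⋀^Fin k]→L[ℝ] ℝ) ∞
      (fun y => T (fun r => c y fun i => Module.finBasis ℝ E (r i))) :=
    T.contMDiff.comp (contMDiff_pi_space.2 fun r => h _)
  simpa only [hT] using h1

/-- The value of a smooth family of forms on smooth vector fields is smooth. -/
theorem contDiffOn_continuousAlternatingMap_apply {k : ℕ} {c : E → E [⋀^Fin k]→L[ℝ] ℝ}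
    {v : Fin k → E → E} {s : Set E} (hc : ∀ w, ContDiffOn ℝ ∞ (fun y => c y w) s)
    (hv : ∀ i, ContDiffOn ℝ ∞ (v i) s) : ContDiffOn ℝ ∞ (fun y => c y fun i => v i y) s := by
  let b := Module.finBasis ℝ E
  have h : ∀ y, (c y fun i => v i y) = ∑ r : Fin k → Fin (Module.finrank ℝ E),
      (∏ i, b.repr (v i y) (r i)) * c y (fun i => b (r i)) := by
    intro y
    have hv : (fun i => v i y) = fun i => ∑ j, b.repr (v i y) j • b j :=
      funext fun i => (b.sum_repr (v i y)).symm
    have h1 := (c y).toMultilinearMap.map_sum (fun i j => b.repr (v i y) j • b j)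
    rw [← hv] at h1
    refine h1.trans (Finset.sum_congr rfl fun r _ => ?_)
    exact (c y).toMultilinearMap.map_smul_univ _ _
  simp only [h]
  refine ContDiffOn.sum fun r _ => ContDiffOn.mul (contDiffOn_prod fun i _ => ?_) (hc _)
  exact ((b.coord (r i)).toContinuousLinearMap.contDiff).comp_contDiffOn (hv i)

/-- A map into the spinor module is smooth if the values of its components on fixed vectors are.
The spinor module is an infinite product without a norm, which rules out `ContMDiff`. -/
def IsSmoothSpinorMap (f : M → Spinor E) : Prop :=
  ∀ k w, ContMDiff 𝓘(ℝ, E) 𝓘(ℝ, ℝ) ∞ (fun x => f x k w)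

theorem IsSmoothSpinorMap.contMDiff {f : M → Spinor E} (hf : IsSmoothSpinorMap f) (k : ℕ) :
    ContMDiff 𝓘(ℝ, E) 𝓘(ℝ, E [⋀^Fin k]→L[ℝ] ℝ) ∞ (fun x => toContinuousAlternating (f x k)) :=
  contMDiff_continuousAlternatingMap_of_eval (hf k)

/-- The derivative of a map into the spinor module, degree by degree. -/
def spinorDeriv (f : M → Spinor E) (x : M) : E →ₗ[ℝ] Spinor E where
  toFun u k := (((mfderiv 𝓘(ℝ, E) 𝓘(ℝ, E [⋀^Fin k]→L[ℝ] ℝ)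
    (fun x => toContinuousAlternating (f x k)) x :
      E →L[ℝ] E [⋀^Fin k]→L[ℝ] ℝ) u).toAlternatingMap)
  map_add' u v := by
    funext k
    exact congrArg ContinuousAlternatingMap.toAlternatingMap (map_add _ u v)
  map_smul' c u := by
    funext k
    exact congrArg ContinuousAlternatingMap.toAlternatingMap (map_smul _ c u)

theorem spinorDeriv_apply [IsManifold 𝓘(ℝ, E) ∞ M] {f : M → Spinor E} (hf : IsSmoothSpinorMap f)
    (x : M) (u : E) (k : ℕ) (w : Fin k → E) :
    spinorDeriv f x u k w = (mfderiv 𝓘(ℝ, E) 𝓘(ℝ, ℝ) (fun x => f x k w) x : E →L[ℝ] ℝ) u := by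
  have h := ((ContinuousAlternatingMap.apply ℝ E ℝ w).hasMFDerivAt.comp x
    (((hf.contMDiff k).mdifferentiable (by simp)) x).hasMFDerivAt).mfderiv
  exact (DFunLike.congr_fun h u).symm

end SmoothForms

/-! ### Differential forms in the left trivialization -/

section LeftTrivialization

open Set Filter
open scoped Topology

variable {E : Type*} [NormedAddCommGroup E] [NormedSpace ℝ E] [FiniteDimensional ℝ E]
  {G : Type*} [TopologicalSpace G] [ChartedSpace E G] [Group G]

/-- The differential form on `G` with the coefficients `f` in the left trivialization. -/
def leftTrivialized (f : G → Spinor E) : SpinorField E G := fun g => pullback (thetaL E g) (f g)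

theorem formInChart_leftTrivialized (f : G → Spinor E) (k : ℕ) (x₀ : G) (y : E) (w : Fin k → E) :
    formInChart x₀ (fun g => leftTrivialized f g k) y w =
      toContinuousAlternating (f ((extChartAt 𝓘(ℝ, E) x₀).symm y) k)
        (fun i => chartTheta x₀ y (w i)) := rfl

variable [LieGroup 𝓘(ℝ, E) ∞ G]

theorem contDiffOn_formInChart_leftTrivialized {f : G → Spinor E} (k : ℕ)
    (hf : ∀ w, ContMDiff 𝓘(ℝ, E) 𝓘(ℝ, ℝ) ∞ (fun g => f g k w)) (x₀ : G) :
    ContDiffOn ℝ ∞ (formInChart x₀ (fun g => leftTrivialized f g k))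
      (extChartAt 𝓘(ℝ, E) x₀).target := by
  refine contDiffOn_continuousAlternatingMap_of_eval fun w => ?_
  simp only [formInChart_leftTrivialized]
  exact contDiffOn_continuousAlternatingMap_apply
    (fun w => contDiffOn_comp_extChartAt_symm (hf w) x₀)
    (fun i => (contDiffOn_chartTheta x₀).clm_apply contDiffOn_const)

theorem isSmoothSpinorOn_leftTrivialized {f : G → Spinor E} (hf : IsSmoothSpinorMap f) :
    IsSmoothSpinorOn (leftTrivialized f) univ := fun k x₀ =>
  (contDiffOn_formInChart_leftTrivialized k (hf k) x₀).mono inter_subset_left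

/-- The derivative at `x₀` of the Maurer-Cartan form in the preferred chart at `x₀`, as a bilinear
map on `𝔤`. -/
def thetaDeriv (x₀ : G) : E →ₗ[ℝ] E →ₗ[ℝ] E where
  toFun ξ := ((fderiv ℝ (chartTheta (E := E) x₀) (extChartAt 𝓘(ℝ, E) x₀ x₀)
    (leftCLM x₀ ξ)).comp (leftCLM x₀)).toLinearMap
  map_add' ξ ζ := by ext; simp
  map_smul' c ξ := by ext; simp

theorem thetaDeriv_sub (x₀ : G) (ξ ζ : E) :
    thetaDeriv x₀ ξ ζ - thetaDeriv x₀ ζ ξ = -modelBracket G ξ ζ := by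
  have h := fderiv_chartTheta_sub x₀ (leftCLM x₀ ξ) (leftCLM x₀ ζ)
  rwa [thetaCLM_leftCLM, thetaCLM_leftCLM] at h

/-- In a chart, a form in left trivialization is the composition of its coefficients with the
Maurer-Cartan form; both contribute to its derivative. -/
theorem fderiv_formInChart_leftTrivialized {f : G → Spinor E} (hf : IsSmoothSpinorMap f) (k : ℕ)
    (x₀ : G) (u : E) (w : Fin k → E) :
    fderiv ℝ (fun y => formInChart x₀ (fun g => leftTrivialized f g k) y w)
        (extChartAt 𝓘(ℝ, E) x₀ x₀) u =
      (spinorDeriv f x₀ u + formDerivation (thetaDeriv x₀ (thetaCLM x₀ u)) (f x₀)) k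
        (fun i => thetaCLM x₀ (w i)) := by
  have hc : DifferentiableAt ℝ
      (fun y => toContinuousAlternating (f ((extChartAt 𝓘(ℝ, E) x₀).symm y) k))
      (extChartAt 𝓘(ℝ, E) x₀ x₀) :=
    ((contDiffOn_comp_extChartAt_symm (hf.contMDiff k) x₀).contDiffAt
      (extChartAt_target_mem_nhds x₀)).differentiableAt (by simp)
  have hθ := differentiableAt_chartTheta (E := E) x₀
  simp only [formInChart_leftTrivialized]
  rw [fderiv_continuousAlternatingMap_apply_apply hc
    (fun i => hθ.clm_apply (differentiableAt_const (w i)))]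
  have h1 : (fun i => chartTheta x₀ (extChartAt 𝓘(ℝ, E) x₀ x₀) (w i)) =
      fun i => thetaCLM x₀ (w i) := funext fun i => chartTheta_self x₀ (w i)
  rw [h1, Pi.add_apply, AlternatingMap.add_apply, formDerivation_apply]
  congr 1
  · rw [← mfderiv_eq_fderiv_comp_symm (hf.contMDiff k) x₀]
    rfl
  · refine Finset.sum_congr rfl fun j _ => ?_
    have h2 : fderiv ℝ (fun y => chartTheta x₀ y (w j)) (extChartAt 𝓘(ℝ, E) x₀ x₀) u =
        thetaDeriv x₀ (thetaCLM x₀ u) (thetaCLM x₀ (w j)) := by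
      have h3 := (hθ.hasFDerivAt.clm_apply (hasFDerivAt_const (w j) _)).fderiv
      rw [h3]
      simp [thetaDeriv, leftCLM_thetaCLM]
    rw [h2, extChartAt_to_inv]
    rfl

/-- The exterior derivative of a form in the left trivialization, in terms of the derivatives of
its coefficients and of the Maurer-Cartan form in a chart. -/
theorem extDSpinor_leftTrivialized_eq_sum {ι : Type*} [Fintype ι] (b : Module.Basis ι ℝ E)
    {f : G → Spinor E} (hf : IsSmoothSpinorMap f) (x₀ : G) :
    extDSpinor (leftTrivialized f) x₀ = pullback (thetaL E x₀)
      (∑ i, extMul (b.coord i) (spinorDeriv f x₀ (leftCLM x₀ (b i)) +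
        formDerivation (thetaDeriv x₀ (b i)) (f x₀)) : Spinor E) := by
  funext k
  cases k with
  | zero =>
    have h1 : (∑ i, extMul (b.coord i) (spinorDeriv f x₀ (leftCLM x₀ (b i)) +
        formDerivation (thetaDeriv x₀ (b i)) (f x₀)) : Spinor E) 0 = 0 := by
      rw [Finset.sum_apply]
      exact Finset.sum_eq_zero fun i _ => extMul_apply_zero _ _
    symm
    exact (congrArg (fun c : E [⋀^Fin 0]→ₗ[ℝ] ℝ => c.compLinearMap
      (thetaCLM x₀).toLinearMap) h1).trans (AlternatingMap.zero_compLinearMap _)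
  | succ k =>
    let H : E →ₗ[ℝ] E [⋀^Fin k]→ₗ[ℝ] ℝ :=
      { toFun := fun ξ => (spinorDeriv f x₀ (leftCLM x₀ ξ) +
          formDerivation (thetaDeriv x₀ ξ) (f x₀)) k
        map_add' := fun ξ ζ => by
          rw [map_add, map_add, map_add, formDerivation_add]
          simp only [Pi.add_apply]
          abel
        map_smul' := fun c ξ => by
          rw [map_smul, map_smul, map_smul]
          ext w
          simp [formDerivation_apply, Finset.mul_sum] }
    have h1 : (∑ i, extMul (b.coord i) (spinorDeriv f x₀ (leftCLM x₀ (b i)) +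
        formDerivation (thetaDeriv x₀ (b i)) (f x₀)) : Spinor E) (k + 1) =
        AlternatingMap.alternatizeUncurryFin H := by
      rw [← sum_covectorWedge b, Finset.sum_apply]
      rfl
    refine AlternatingMap.ext fun (v : Fin (k + 1) → E) => ?_
    have h2 : extDSpinor (leftTrivialized f) x₀ (k + 1) v =
        extDeriv (formInChart x₀ (fun g => leftTrivialized f g k)) (extChartAt 𝓘(ℝ, E) x₀ x₀)
          (fun i => chartDeriv x₀ x₀ (v i)) := rfl
    have h3 : pullback (thetaL E x₀) (∑ i, extMul (b.coord i) (spinorDeriv f x₀ (leftCLM x₀ (b i)) +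
        formDerivation (thetaDeriv x₀ (b i)) (f x₀)) : Spinor E) (k + 1) v =
        (∑ i, extMul (b.coord i) (spinorDeriv f x₀ (leftCLM x₀ (b i)) +
        formDerivation (thetaDeriv x₀ (b i)) (f x₀)) : Spinor E) (k + 1)
        (fun i => thetaCLM x₀ (v i)) := rfl
    have h4 : DifferentiableAt ℝ (formInChart x₀ (fun g => leftTrivialized f g k))
        (extChartAt 𝓘(ℝ, E) x₀ x₀) :=
      ((contDiffOn_formInChart_leftTrivialized k (hf k) x₀).contDiffAt
        (extChartAt_target_mem_nhds x₀)).differentiableAt (by simp)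
    rw [h2, h3, h1, extDeriv_apply h4, AlternatingMap.alternatizeUncurryFin_apply, chartDeriv_self]
    refine Finset.sum_congr rfl fun i _ => ?_
    rw [fderiv_formInChart_leftTrivialized hf]
    change _ = _ • (spinorDeriv f x₀ (leftCLM x₀ (thetaCLM x₀ (v i))) +
          formDerivation (thetaDeriv x₀ (thetaCLM x₀ (v i))) (f x₀)) k _
    rw [leftCLM_thetaCLM]
    rfl

/-- Only the antisymmetric part of the bilinear map `S` contributes, which is half a bracket. -/
theorem formDerivation_sum_eq_chevalleyEilenberg {V : Type*} [LieRing V] [LieAlgebra ℝ V]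
    {ι : Type*} [Fintype ι] (b : Module.Basis ι ℝ V) (S : V →ₗ[ℝ] V →ₗ[ℝ] V)
    (hS : ∀ ξ ζ, S ξ ζ - S ζ ξ = -⁅ξ, ζ⁆) (ψ : Spinor V) :
    ∑ i, extMul (b.coord i) (formDerivation (S (b i)) ψ) = chevalleyEilenberg b ψ := by
  have h1 : ∑ i, extMul (b.coord i) (formDerivation (S (b i)) ψ) =
      ∑ i, ∑ j, extMul (b.coord i) (extMul (b.coord j) (contraction (S (b i) (b j)) ψ)) :=
    Finset.sum_congr rfl fun i _ => by rw [formDerivation_eq_sum b, map_sum]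
  have h2 : ∑ i, ∑ j, extMul (b.coord i) (extMul (b.coord j) (contraction (S (b i) (b j)) ψ)) =
      ∑ i, ∑ j, -extMul (b.coord i) (extMul (b.coord j) (contraction (S (b j) (b i)) ψ)) := by
    rw [Finset.sum_comm]
    refine Finset.sum_congr rfl fun i _ => Finset.sum_congr rfl fun j _ => ?_
    exact extMul_anticomm _ _ _
  have h3 : ∑ i, ∑ j, extMul (b.coord i) (extMul (b.coord j) (contraction ⁅b i, b j⁆ ψ)) =
      -(2 : ℝ) • ∑ i, ∑ j,
        extMul (b.coord i) (extMul (b.coord j) (contraction (S (b i) (b j)) ψ)) := by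
    have h4 : ∀ i j, extMul (b.coord i) (extMul (b.coord j) (contraction ⁅b i, b j⁆ ψ)) =
        -extMul (b.coord i) (extMul (b.coord j) (contraction (S (b i) (b j)) ψ)) -
        -extMul (b.coord i) (extMul (b.coord j) (contraction (S (b j) (b i)) ψ)) := by
      intro i j
      rw [← neg_neg ⁅b i, b j⁆, ← hS]
      simp only [map_neg, map_sub, LinearMap.neg_apply, LinearMap.sub_apply]
      abel
    simp only [h4, Finset.sum_sub_distrib]
    rw [← h2]
    simp only [Finset.sum_neg_distrib]
    module
  rw [h1, chevalleyEilenberg, h3]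
  module

/-- The exterior derivative of a form in the left trivialization: the derivatives of the
coefficients along left-invariant fields, and the Chevalley-Eilenberg differential. -/
theorem extDSpinor_leftTrivialized {ι : Type*} [Fintype ι]
    (b : Module.Basis ι ℝ (GroupLieAlgebra 𝓘(ℝ, E) G))
    {f : G → Spinor (GroupLieAlgebra 𝓘(ℝ, E) G)} (hf : IsSmoothSpinorMap (E := E) f) (x₀ : G) :
    extDSpinor (leftTrivialized (E := E) f) x₀ = pullback (thetaL E x₀)
      ((∑ i, extMul (b.coord i) (spinorDeriv (E := E) f x₀ (leftCLM (E := E) x₀ (b i)))) +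
        chevalleyEilenberg b (f x₀)) := by
  refine (extDSpinor_leftTrivialized_eq_sum (E := E) b hf x₀).trans
    (congrArg (pullback (thetaL E x₀)) ?_)
  have h := formDerivation_sum_eq_chevalleyEilenberg b (thetaDeriv (E := E) x₀)
    (fun ξ ζ => thetaDeriv_sub (E := E) x₀ ξ ζ) (f x₀)
  rw [← h, ← Finset.sum_add_distrib]
  exact Finset.sum_congr rfl fun i _ => map_add _ _ _

end LeftTrivialization

/-! ### Derivatives of maps into the spinor module -/

section SpinorMaps

open Set Filter
open scoped Topology

variable {E : Type*} [NormedAddCommGroup E] [NormedSpace ℝ E]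

/-- The evaluation of the degree `k` component on `w`, as a functional on the spinor module. -/
def spinorEval (k : ℕ) (w : Fin k → E) : Module.Dual ℝ (Spinor E) where
  toFun ψ := ψ k w
  map_add' _ _ := rfl
  map_smul' _ _ := rfl

variable (E) in
/-- The functionals on the spinor module that are combinations of finitely many evaluations. They
preserve differentiability of smooth maps into this module, which has no norm. -/
def evalSpan : Submodule ℝ (Module.Dual ℝ (Spinor E)) :=
  Submodule.span ℝ (range fun p : Σ k : ℕ, Fin k → E => spinorEval p.1 p.2)

theorem spinorEval_mem (k : ℕ) (w : Fin k → E) : spinorEval k w ∈ evalSpan E :=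
  Submodule.subset_span ⟨⟨k, w⟩, rfl⟩

theorem spinorEval_comp_rho_mem (d : Double E) (k : ℕ) (w : Fin k → E) :
    (spinorEval k w).comp (rho d) ∈ evalSpan E := by
  have h1 : (spinorEval k w).comp (contraction d.1) =
      spinorEval (k + 1) (Matrix.vecCons d.1 w) := LinearMap.ext fun ψ => rfl
  have h2 : (spinorEval k w).comp (extMul d.2) ∈ evalSpan E := by
    cases k with
    | zero =>
      convert! (evalSpan E).zero_mem
    | succ k =>
      have h3 : (spinorEval (k + 1) w).comp (extMul d.2) =
          ∑ i : Fin (k + 1), ((-1 : ℝ) ^ (i : ℕ) * d.2 (w i)) • spinorEval k (i.removeNth w) := by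
        refine LinearMap.ext fun ψ => ?_
        refine (covectorWedge_apply d.2 (ψ k) w).trans ?_
        rw [LinearMap.sum_apply]
        exact Finset.sum_congr rfl fun i _ => (mul_assoc _ _ _).symm
      rw [h3]
      exact Submodule.sum_mem _ fun i _ => Submodule.smul_mem _ _ (spinorEval_mem _ _)
  have h3 : (spinorEval k w).comp (rho d) =
      (spinorEval k w).comp (contraction d.1) + (spinorEval k w).comp (extMul d.2) :=
    LinearMap.ext fun ψ => rfl
  rw [h3, h1]
  exact Submodule.add_mem _ (spinorEval_mem _ _) h2

variable {M : Type*} [TopologicalSpace M] [ChartedSpace E M]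

theorem mfderiv_comp_apply_self {F : Type*} [NormedAddCommGroup F] [NormedSpace ℝ F] {f : M → F}
    (hf : ContMDiff 𝓘(ℝ, E) 𝓘(ℝ, F) ∞ f) {q : M → M} {x y : M}
    (hq : MDifferentiable 𝓘(ℝ, E) 𝓘(ℝ, E) q) (hy : q x = y) (v : E) :
    (mfderiv 𝓘(ℝ, E) 𝓘(ℝ, F) (fun h => f (q h)) x : E →L[ℝ] F) v =
      (mfderiv 𝓘(ℝ, E) 𝓘(ℝ, F) f y : E →L[ℝ] F)
        ((mfderiv 𝓘(ℝ, E) 𝓘(ℝ, E) q x : E →L[ℝ] E) v) := by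
  subst hy
  exact DFunLike.congr_fun (mfderiv_comp x (hf.mdifferentiable (by simp) (q x)) (hq x)) v

variable [FiniteDimensional ℝ E] [IsManifold 𝓘(ℝ, E) ∞ M]

/-- In the preferred chart at `x`, the derivative of a combination of components of a smooth
spinor-valued map. -/
theorem IsSmoothSpinorMap.hasFDerivAt_eval {f : M → Spinor E} (hf : IsSmoothSpinorMap f)
    {ℓ : Module.Dual ℝ (Spinor E)} (hℓ : ℓ ∈ evalSpan E) (x : M) :
    HasFDerivAt (fun y => ℓ (f ((extChartAt 𝓘(ℝ, E) x).symm y)))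
      (ℓ.comp (spinorDeriv f x)).toContinuousLinearMap (extChartAt 𝓘(ℝ, E) x x) := by
  induction hℓ using Submodule.span_induction with
  | mem ℓ h =>
    obtain ⟨⟨k, w⟩, rfl⟩ := h
    have h1 := mfderiv_eq_fderiv_comp_symm (hf k w) x
    have h2 := (((contDiffOn_comp_extChartAt_symm (hf k w) x).contDiffAt
      (extChartAt_target_mem_nhds x)).differentiableAt (by simp)).hasFDerivAt
    rw [← h1] at h2
    refine h2.congr_fderiv (ContinuousLinearMap.ext fun u => ?_)
    exact (spinorDeriv_apply hf x u k w).symm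
  | zero =>
    exact (hasFDerivAt_const (0 : ℝ) _).congr_fderiv (ContinuousLinearMap.ext fun u => rfl)
  | add ℓ ℓ' _ _ h h' =>
    exact (h.add h').congr_fderiv (ContinuousLinearMap.ext fun u => rfl)
  | smul c ℓ _ h =>
    exact (h.const_smul c).congr_fderiv (ContinuousLinearMap.ext fun u => rfl)

end SpinorMaps

section LeftDerivatives

open Set Filter
open scoped Topology

variable {E : Type*} [NormedAddCommGroup E] [NormedSpace ℝ E]
  {G : Type*} [TopologicalSpace G] [ChartedSpace E G] [Group G] [LieGroup 𝓘(ℝ, E) ∞ G]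

theorem mfderiv_comp_mul_left {F : Type*} [NormedAddCommGroup F] [NormedSpace ℝ F] {f : G → F}
    (hf : ContMDiff 𝓘(ℝ, E) 𝓘(ℝ, F) ∞ f) (g : G) (ξ : E) :
    (mfderiv 𝓘(ℝ, E) 𝓘(ℝ, F) (fun h => f (g * h)) 1 : E →L[ℝ] F) ξ =
      (mfderiv 𝓘(ℝ, E) 𝓘(ℝ, F) f g : E →L[ℝ] F) (leftCLM (E := E) g ξ) :=
  mfderiv_comp_apply_self hf (mdifferentiable_mul_left g) (mul_one g) ξ

theorem mfderiv_comp_mul_right {F : Type*} [NormedAddCommGroup F] [NormedSpace ℝ F] {f : G → F}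
    (hf : ContMDiff 𝓘(ℝ, E) 𝓘(ℝ, F) ∞ f) (g : G) (ξ : E) :
    (mfderiv 𝓘(ℝ, E) 𝓘(ℝ, F) (fun h => f (h * g)) 1 : E →L[ℝ] F) ξ =
      (mfderiv 𝓘(ℝ, E) 𝓘(ℝ, F) f g : E →L[ℝ] F) (rightCLM (E := E) g ξ) :=
  mfderiv_comp_apply_self hf (mdifferentiable_mul_right g) (one_mul g) ξ

variable [FiniteDimensional ℝ E]

/-- The derivative of `Ad` along the left-invariant vector field of `ξ` is `Ad ∘ ad_ξ`. -/
theorem mfderiv_AdCLM (g : G) (ξ ζ : E) :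
    (mfderiv 𝓘(ℝ, E) 𝓘(ℝ, E) (fun h : G => AdCLM h ζ) g : E →L[ℝ] E) (leftCLM (E := E) g ξ) =
      AdCLM g (modelBracket G ξ ζ) := by
  rw [← mfderiv_comp_mul_left (contMDiff_AdCLM ζ)]
  have h1 : (fun h : G => AdCLM (g * h) ζ) = (AdCLM (E := E) g) ∘ fun h : G => AdCLM h ζ :=
    funext fun h => Ad_mul g h ζ
  have h2 : MDifferentiableAt 𝓘(ℝ, E) 𝓘(ℝ, E) (fun h : G => AdCLM h ζ) 1 :=
    (contMDiff_AdCLM ζ).mdifferentiable (by simp) 1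
  rw [h1, mfderiv_comp 1 (AdCLM (E := E) g).mdifferentiableAt h2, ContinuousLinearMap.mfderiv_eq,
    mfderiv_eq_fderiv_comp_symm (contMDiff_AdCLM ζ)]
  exact congrArg (AdCLM (E := E) g) (fderiv_AdCLM_one ξ ζ)

/-- An `Ad`-invariant bilinear form is invariant under the Lie bracket. -/
theorem bilin_modelBracket {B : LinearMap.BilinForm ℝ E}
    (hB : ∀ (g : G) (ξ ζ : E), B (AdCLM g ξ) (AdCLM g ζ) = B ξ ζ) (u v w : E) :
    B (modelBracket G u v) w = -B v (modelBracket G u w) := by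
  have hAd : ∀ ζ : E, HasFDerivAt
      (fun y => AdCLM ((extChartAt 𝓘(ℝ, E) (1 : G)).symm y) ζ)
      (fderiv ℝ (fun y => AdCLM ((extChartAt 𝓘(ℝ, E) (1 : G)).symm y) ζ) (chartOne G))
      (chartOne G) := fun ζ =>
    (((contDiffOn_comp_extChartAt_symm (contMDiff_AdCLM ζ) (1 : G)).contDiffAt
      (extChartAt_target_mem_nhds (1 : G))).differentiableAt (by simp)).hasFDerivAt
  have hAd1 : ∀ v : E, AdCLM ((extChartAt 𝓘(ℝ, E) (1 : G)).symm (chartOne G)) v = v := fun v => by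
    rw [extChartAt_symm_chartOne]
    exact Ad_one v
  have h := (LinearMap.toContinuousBilinearMap B).hasFDerivAt_of_bilinear (hAd v) (hAd w)
  have h1 : (fun y => (LinearMap.toContinuousBilinearMap B)
      (AdCLM ((extChartAt 𝓘(ℝ, E) (1 : G)).symm y) v)
      (AdCLM ((extChartAt 𝓘(ℝ, E) (1 : G)).symm y) w)) = fun _ => B v w :=
    funext fun y => hB _ v w
  rw [h1] at h
  have h2 := DFunLike.congr_fun (h.unique (hasFDerivAt_const (B v w) _)) u
  have h3 : B v (modelBracket G u w) + B (modelBracket G u v) w = 0 := by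
    rw [← fderiv_AdCLM_one, ← fderiv_AdCLM_one]
    have h4 := hAd1 v
    have h5 := hAd1 w
    simpa [-extChartAt, h4, h5, ContinuousLinearMap.precompR_apply,
      ContinuousLinearMap.precompL_apply] using h2
  linarith

variable {f : G → Spinor E}

/-- The derivative of a spinor-valued map along the generating vector fields of the conjugation
action, when the map is invariant under this action. -/
theorem spinorDeriv_sub_of_invariant (hf : IsSmoothSpinorMap f)
    (hinv : ∀ (g h : G) (k : ℕ) (w : Fin k → E),
      f (h * g) k (fun i => AdCLM h (w i)) = f (g * h) k w) (g : G) (u : E)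
    (k : ℕ) (w : Fin k → E) :
    spinorDeriv f g (leftCLM g u - rightCLM g u) k w =
      ∑ j, f g k (Function.update w j (modelBracket G u (w j))) := by
  have hr : ContMDiff 𝓘(ℝ, E) 𝓘(ℝ, E [⋀^Fin k]→L[ℝ] ℝ) ∞
      (fun h => toContinuousAlternating (f (h * g) k)) :=
    (hf.contMDiff k).comp contMDiff_mul_right
  have hl : ContMDiff 𝓘(ℝ, E) 𝓘(ℝ, ℝ) ∞ (fun h => f (g * h) k w) :=
    (hf k w).comp contMDiff_mul_left
  have hc : DifferentiableAt ℝ (fun y => toContinuousAlternating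
      (f ((extChartAt 𝓘(ℝ, E) (1 : G)).symm y * g) k)) (chartOne G) :=
    ((contDiffOn_comp_extChartAt_symm hr (1 : G)).contDiffAt
      (extChartAt_target_mem_nhds (1 : G))).differentiableAt (by simp)
  have hAd : ∀ i, DifferentiableAt ℝ
      (fun y => AdCLM ((extChartAt 𝓘(ℝ, E) (1 : G)).symm y) (w i)) (chartOne G) := fun i =>
    ((contDiffOn_comp_extChartAt_symm (contMDiff_AdCLM (w i)) (1 : G)).contDiffAt
      (extChartAt_target_mem_nhds (1 : G))).differentiableAt (by simp)
  have hAd1 : ∀ v : E, AdCLM ((extChartAt 𝓘(ℝ, E) (1 : G)).symm (chartOne G)) v = v := fun v => by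
    rw [extChartAt_symm_chartOne]
    exact Ad_one v
  -- The relation `hinv` is differentiated at `h = 1`.
  have h1 := fderiv_continuousAlternatingMap_apply_apply hc hAd u
  have h2 : (fun y => (toContinuousAlternating (f ((extChartAt 𝓘(ℝ, E) (1 : G)).symm y * g) k))
      fun i => AdCLM ((extChartAt 𝓘(ℝ, E) (1 : G)).symm y) (w i)) =
      fun y => f (g * (extChartAt 𝓘(ℝ, E) (1 : G)).symm y) k w :=
    funext fun y => hinv g _ k w
  have h3 : fderiv ℝ (fun y => f (g * (extChartAt 𝓘(ℝ, E) (1 : G)).symm y) k w) (chartOne G) u =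
      spinorDeriv f g (leftCLM g u) k w := by
    rw [spinorDeriv_apply hf, ← mfderiv_comp_mul_left (hf k w) g u, mfderiv_eq_fderiv_comp_symm hl]
    rfl
  have h4 : fderiv ℝ (fun y => toContinuousAlternating
      (f ((extChartAt 𝓘(ℝ, E) (1 : G)).symm y * g) k)) (chartOne G) u w =
      spinorDeriv f g (rightCLM g u) k w := by
    have h5 := mfderiv_comp_mul_right (hf.contMDiff k) g u
    rw [mfderiv_eq_fderiv_comp_symm hr] at h5
    exact congrArg (fun c : E [⋀^Fin k]→L[ℝ] ℝ => c w) h5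
  simp only [hAd1, fderiv_AdCLM_one] at h1
  rw [h2, h3, h4, extChartAt_symm_chartOne, one_mul] at h1
  rw [map_sub]
  exact sub_eq_iff_eq_add'.2 h1

/-- Differentiating the relation `ρ(κ(Ad_g v ⊕ v)) f(g) = 0` along a left-invariant vector
field. -/
theorem rho_kappa_spinorDeriv {B : LinearMap.BilinForm ℝ E} (hf : IsSmoothSpinorMap f) (v : E)
    (h : ∀ g, rho (kappa B (AdCLM g v, v)) (f g) = 0) (g : G) (ξ : E) :
    rho (kappa B (AdCLM g v, v)) (spinorDeriv f g (leftCLM g ξ)) +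
      rho (kappa B (AdCLM g (modelBracket G ξ v), 0)) (f g) = 0 := by
  funext k
  refine AlternatingMap.ext fun w => ?_
  let b := Module.finBasis ℝ E
  let R : Fin (Module.finrank ℝ E) → Module.Dual ℝ (Spinor E) := fun i =>
    (spinorEval k w).comp (rho (kappa B (b i, 0)))
  let R₀ : Module.Dual ℝ (Spinor E) := (spinorEval k w).comp (rho (kappa B (0, v)))
  -- The operator `ρ(κ(a ⊕ v))` is affine in `a`, and is expanded in a basis.
  have hR : ∀ (a : E) (ψ : Spinor E), rho (kappa B (a, 0)) ψ k w = ∑ i, b.coord i a * R i ψ :=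
    fun a ψ => (sum_coord_smul b ((spinorEval k w).comp (((rho (V := E)).flip ψ).comp
      ((kappa B).comp (LinearMap.inl ℝ E E)))) a).symm
  have hR₀ : ∀ (a : E) (ψ : Spinor E),
      rho (kappa B (a, v)) ψ k w = ∑ i, b.coord i a * R i ψ + R₀ ψ := fun a ψ => by
    rw [← hR, kappa_add_right, map_add]
    rfl
  have hAd := (((contDiffOn_comp_extChartAt_symm (contMDiff_AdCLM v) g).contDiffAt
      (extChartAt_target_mem_nhds g)).differentiableAt (by simp)).hasFDerivAt
  rw [← mfderiv_eq_fderiv_comp_symm (contMDiff_AdCLM v)] at hAd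
  have h1 := (HasFDerivAt.fun_sum (u := Finset.univ) fun i _ =>
    ((b.coord i).toContinuousLinearMap.hasFDerivAt.comp _ hAd).mul
      (hf.hasFDerivAt_eval (spinorEval_comp_rho_mem (kappa B (b i, 0)) k w) g)).add
    (hf.hasFDerivAt_eval (spinorEval_comp_rho_mem (kappa B (0, v)) k w) g)
  have h2 := h1.unique ((hasFDerivAt_const (0 : ℝ) _).congr_of_eventuallyEq (.of_forall fun y => by
    refine (hR₀ _ _).symm.trans ?_
    rw [h]
    rfl))
  have h3 := DFunLike.congr_fun h2 (leftCLM g ξ)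
  rw [Pi.add_apply, AlternatingMap.add_apply, hR, hR₀]
  simp only [add_apply, sum_apply, smul_apply, LinearMap.coe_toContinuousLinearMap',
    LinearMap.comp_apply, Function.comp_apply, smul_eq_mul, extChartAt_to_inv, zero_apply] at h3
  have h4 : (∑ i, (b.coord i (AdCLM g v) * R i (spinorDeriv f g (leftCLM g ξ)) +
      R i (f g) * b.coord i (AdCLM g (modelBracket G ξ v)))) +
        R₀ (spinorDeriv f g (leftCLM g ξ)) = 0 := by
    refine Eq.trans ?_ h3
    refine congrArg₂ (· + ·) (Finset.sum_congr rfl fun i _ => congrArg₂ (· + ·) rfl ?_) rfl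
    exact congrArg (fun t => R i (f g) * b.coord i t) (mfderiv_AdCLM g ξ v).symm
  refine Eq.trans ?_ h4
  rw [Finset.sum_add_distrib, add_right_comm]
  simp only [mul_comm (R _ (f g))]

end LeftDerivatives

/-! ### Parity of spinors -/

section Parity

variable {V : Type*} [AddCommGroup V] [Module ℝ V]

/-- A spinor has parity `p` if its components of the degrees `k` with `k + p` odd vanish. -/
def HasParity (p : ℕ) (ψ : Spinor V) : Prop := ∀ k, ¬Even (k + p) → ψ k = 0

theorem HasParity.add {p : ℕ} {ψ ψ' : Spinor V} (h : HasParity p ψ) (h' : HasParity p ψ') :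
    HasParity p (ψ + ψ') := fun k hk => by
  rw [Pi.add_apply, h k hk, h' k hk, add_zero]

theorem HasParity.smul {p : ℕ} {ψ : Spinor V} (h : HasParity p ψ) (c : ℝ) :
    HasParity p (c • ψ) := fun k hk => by
  rw [Pi.smul_apply, h k hk, smul_zero]

theorem HasParity.sum {p : ℕ} {ι : Type*} {s : Finset ι} {ψ : ι → Spinor V}
    (h : ∀ i, HasParity p (ψ i)) : HasParity p (∑ i ∈ s, ψ i) := fun k hk => by
  rw [Finset.sum_apply]
  exact Finset.sum_eq_zero fun i _ => h i k hk

theorem HasParity.contraction {p : ℕ} {ψ : Spinor V} (h : HasParity p ψ) (v : V) :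
    HasParity (p + 1) (contraction v ψ) := fun k hk => by
  rw [contraction_apply, h (k + 1) (by rwa [add_assoc, add_comm 1 p])]
  rfl

theorem HasParity.extMul {p : ℕ} {ψ : Spinor V} (h : HasParity p ψ) (α : Module.Dual ℝ V) :
    HasParity (p + 1) (extMul α ψ) := fun k hk => by
  cases k with
  | zero => rfl
  | succ k =>
    have h1 : ψ k = 0 := h k fun h2 => hk (by
      rw [show k + 1 + (p + 1) = k + p + 2 by ring]
      exact h2.add even_two)
    ext v
    rw [extMul_apply_succ, h1, covectorWedge_apply]
    simp

theorem HasParity.eq_zero {p : ℕ} {ψ : Spinor V} (h : HasParity p ψ) (h' : HasParity (p + 1) ψ) :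
    ψ = 0 := funext fun k => by
  by_cases hk : Even (k + p)
  · exact h' k (by rw [← add_assoc]; exact Nat.not_even_iff_odd.2 hk.add_one)
  · exact h k hk

theorem HasParity.threeFormMul [FiniteDimensional ℝ V] {p : ℕ} {ψ : Spinor V}
    (h : HasParity p ψ) (η : V [⋀^Fin 3]→ₗ[ℝ] ℝ) : HasParity (p + 1) (threeFormMul η ψ) := by
  rw [threeFormMul_eq_sum (Module.finBasis ℝ V)]
  refine (HasParity.sum fun i => .sum fun j => .sum fun k => .smul ?_ _).smul _
  intro m hm
  refine (((h.extMul _).extMul _).extMul _) m fun h2 => hm ?_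
  rw [show m + (p + 1 + 1 + 1) = m + (p + 1) + 2 by ring] at h2
  exact (Nat.even_add.1 h2).2 even_two

theorem hasParity_chevalleyEilenberg {V : Type*} [LieRing V] [LieAlgebra ℝ V] {ι : Type*}
    [Fintype ι] (b : Module.Basis ι ℝ V) {p : ℕ} {ψ : Spinor V} (h : HasParity p ψ) :
    HasParity (p + 1) (chevalleyEilenberg b ψ) := by
  refine (HasParity.sum fun i => .sum fun j => ?_).smul _
  intro m hm
  refine (((h.contraction _).extMul _).extMul _) m fun h2 => hm ?_
  rw [show m + (p + 1 + 1 + 1) = m + (p + 1) + 2 by ring] at h2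
  exact (Nat.even_add.1 h2).2 even_two

theorem hasParity_cliffordRep_homogeneous {B : LinearMap.BilinForm ℝ V} {n : ℕ} {x : Cl B}
    (hx : CliffordAlgebra.involute x = x) (μ : V [⋀^Fin n]→ₗ[ℝ] ℝ) :
    HasParity n (cliffordRep B x (homogeneous μ)) := fun k hk => by
  have h := cliffordRep_even_homogeneous hx μ k
  have h1 : (-1 : ℝ) ^ (k + n) = -1 := Odd.neg_one_pow (Nat.not_even_iff_odd.1 hk)
  rw [pow_add] at h1
  ext w
  have h2 : (-1 : ℝ) ^ k * cliffordRep B x (homogeneous μ) k w =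
      (-1) ^ n * cliffordRep B x (homogeneous μ) k w := DFunLike.congr_fun h w
  change cliffordRep B x (homogeneous μ) k w = 0
  rcases neg_one_pow_eq_or ℝ k with h3 | h3 <;> rcases neg_one_pow_eq_or ℝ n with h4 | h4 <;>
    rw [h3, h4] at h1 h2 <;> linarith

end Parity

/-! ### The Cartan three-form on the Lie algebra -/

section ThreeForm

theorem pullback_threeFormMul {V V' : Type*} [AddCommGroup V] [Module ℝ V] [AddCommGroup V']
    [Module ℝ V'] (A : V →ₗ[ℝ] V') (η : V' [⋀^Fin 3]→ₗ[ℝ] ℝ) (ψ : Spinor V') :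
    pullback A (threeFormMul η ψ) = threeFormMul (η.compLinearMap A) (pullback A ψ) := by
  funext k
  match k with
  | 0 => rfl
  | 1 => rfl
  | 2 => rfl
  | k + 3 =>
    ext w
    simp only [pullback, threeFormMul, wedge, AlternatingMap.compLinearMap_apply,
      AlternatingMap.domDomCongr_apply, AlternatingMap.smul_apply,
      MultilinearMap.alternatization_apply]
    rfl

variable {E : Type*} [NormedAddCommGroup E] [NormedSpace ℝ E] [FiniteDimensional ℝ E]
  {G : Type*} [TopologicalSpace G] [ChartedSpace E G] [Group G] [LieGroup 𝓘(ℝ, E) ∞ G]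

/-- The value of the Cartan 3-form on the Lie algebra. -/
def lieThreeForm (B : LinearMap.BilinForm ℝ (GroupLieAlgebra 𝓘(ℝ, E) G)) :
    GroupLieAlgebra 𝓘(ℝ, E) G [⋀^Fin 3]→ₗ[ℝ] ℝ :=
  (1 / 12 : ℝ) • MultilinearMap.alternatization (bracketTrilinear B)

/-- By invariance of `B` the trilinear form `B(x, [y, z])` is alternating already, so that its
alternatization multiplies it by `3! = 6`. -/
theorem lieThreeForm_apply {B : LinearMap.BilinForm ℝ (GroupLieAlgebra 𝓘(ℝ, E) G)}
    (hBad : ∀ u v w : GroupLieAlgebra 𝓘(ℝ, E) G, B ⁅u, v⁆ w = -B v ⁅u, w⁆)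
    (w : Fin 3 → GroupLieAlgebra 𝓘(ℝ, E) G) :
    lieThreeForm B w = (1 / 2 : ℝ) * B (w 0) ⁅w 1, w 2⁆ := by
  have h01 : ∀ x z : GroupLieAlgebra 𝓘(ℝ, E) G, B x ⁅x, z⁆ = 0 := fun x z => by
    have h := hBad x x z
    rw [lie_self, map_zero, LinearMap.zero_apply] at h
    linarith
  have h02 : ∀ x z : GroupLieAlgebra 𝓘(ℝ, E) G, B x ⁅z, x⁆ = 0 := fun x z => by
    rw [← lie_skew, map_neg, h01, neg_zero]
  let a : GroupLieAlgebra 𝓘(ℝ, E) G [⋀^Fin 3]→ₗ[ℝ] ℝ :=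
    { bracketTrilinear B with
      map_eq_zero_of_eq' := by
        intro v i j hv hij
        change B (v 0) ⁅v 1, v 2⁆ = 0
        fin_cases i <;> fin_cases j <;> simp at hij <;>
          simp only [Fin.zero_eta, Fin.mk_one, Fin.reduceFinMk] at hv <;>
          simp [hv, h01, h02] }
  have h := AlternatingMap.coe_alternatization a
  have h1 : (a : MultilinearMap ℝ (fun _ : Fin 3 => GroupLieAlgebra 𝓘(ℝ, E) G) ℝ) =
      bracketTrilinear B := rfl
  rw [lieThreeForm, ← h1, h]
  change (1 / 12 : ℝ) * ((Fintype.card (Fin 3)).factorial • B (w 0) ⁅w 1, w 2⁆) = _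
  rw [Fintype.card_fin, nsmul_eq_mul]
  norm_num [Nat.factorial]
  ring

end ThreeForm

/-! ### The Cartan spinor in left trivialization -/

section CartanSpinor

variable {E : Type*} [NormedAddCommGroup E] [NormedSpace ℝ E]
  {G : Type*} [TopologicalSpace G] [ChartedSpace E G] [Group G]
  {B : LinearMap.BilinForm ℝ (GroupLieAlgebra 𝓘(ℝ, E) G)} {Adt : G →* pinGroup B} {n : ℕ}

variable (Adt) in
/-- The form `φ` in left trivialization, `g ↦ ϱ(Ãd_g) μ`. -/
def spinorCoeff (μ : GroupLieAlgebra 𝓘(ℝ, E) G [⋀^Fin n]→ₗ[ℝ] ℝ) (g : G) :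
    Spinor (GroupLieAlgebra 𝓘(ℝ, E) G) :=
  cliffordRep B ((Adt g : (Cl B)ˣ) : Cl B) (homogeneous μ)

theorem isSmoothSpinorMap_spinorCoeff (hAdt : IsPinLift B Adt)
    (μ : GroupLieAlgebra 𝓘(ℝ, E) G [⋀^Fin n]→ₗ[ℝ] ℝ) :
    IsSmoothSpinorMap (E := E) (spinorCoeff Adt μ) := fun k w =>
  hAdt.smooth ((spinorEval (E := E) k w).comp ((LinearMap.applyₗ (R := ℝ) (homogeneous μ)).comp
    (cliffordRep B).toLinearMap))

variable [FiniteDimensional ℝ E]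

theorem rho_kappa_spinorCoeff (hB : B.IsSymm) (hAdt : IsPinLift B Adt)
    (hn : Module.finrank ℝ E = n) (μ : GroupLieAlgebra 𝓘(ℝ, E) G [⋀^Fin n]→ₗ[ℝ] ℝ) (g : G)
    (v : GroupLieAlgebra 𝓘(ℝ, E) G) :
    rho (kappa B (Ad E g v, v)) (spinorCoeff Adt μ g) = 0 :=
  rho_kappa_lift_homogeneous hB hn μ (hAdt.lifts g) v

/-- The lift `Ãd_g` is even, since `Ad_g` preserves the volume form. -/
theorem involute_pinLift (hB : B.IsSymm) (hBn : B.Nondegenerate)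
    (hBinv : ∀ (g : G) (ξ ζ : GroupLieAlgebra 𝓘(ℝ, E) G), B (Ad E g ξ) (Ad E g ζ) = B ξ ζ)
    (hAdt : IsPinLift B Adt) (hn : Module.finrank ℝ E = n)
    {μ : GroupLieAlgebra 𝓘(ℝ, E) G [⋀^Fin n]→ₗ[ℝ] ℝ} (hμ : μ ≠ 0)
    (hμinv : ∀ g : G, μ.compLinearMap (Ad E g) = μ) (g : G) :
    CliffordAlgebra.involute ((Adt g : (Cl B)ˣ) : Cl B) = ((Adt g : (Cl B)ˣ) : Cl B) :=
  IsLiftOf.involute_eq hB hBn hn μ hμ (hμinv g) (hBinv g) (hAdt.lifts g)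

theorem hasParity_spinorCoeff (hB : B.IsSymm) (hBn : B.Nondegenerate)
    (hBinv : ∀ (g : G) (ξ ζ : GroupLieAlgebra 𝓘(ℝ, E) G), B (Ad E g ξ) (Ad E g ζ) = B ξ ζ)
    (hAdt : IsPinLift B Adt) (hn : Module.finrank ℝ E = n)
    {μ : GroupLieAlgebra 𝓘(ℝ, E) G [⋀^Fin n]→ₗ[ℝ] ℝ} (hμ : μ ≠ 0)
    (hμinv : ∀ g : G, μ.compLinearMap (Ad E g) = μ) (g : G) :
    HasParity n (spinorCoeff Adt μ g) :=
  hasParity_cliffordRep_homogeneous (involute_pinLift hB hBn hBinv hAdt hn hμ hμinv g) μ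

/-- In left trivialization, pulling back under the conjugation by `h` amounts to pulling back
under `Ad_h`. -/
theorem pullback_Ad_spinorCoeff (hB : B.IsSymm) (hBn : B.Nondegenerate)
    (hBinv : ∀ (g : G) (ξ ζ : GroupLieAlgebra 𝓘(ℝ, E) G), B (Ad E g ξ) (Ad E g ζ) = B ξ ζ)
    (hAdt : IsPinLift B Adt) (hn : Module.finrank ℝ E = n)
    {μ : GroupLieAlgebra 𝓘(ℝ, E) G [⋀^Fin n]→ₗ[ℝ] ℝ} (hμ : μ ≠ 0)
    (hμinv : ∀ g : G, μ.compLinearMap (Ad E g) = μ) (h g : G) :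
    pullback (Ad E h) (spinorCoeff Adt μ (h * g * h⁻¹)) = spinorCoeff Adt μ g := by
  have h1 : ((Adt (h * g * h⁻¹) : (Cl B)ˣ) : Cl B) =
      ((Adt h : (Cl B)ˣ) : Cl B) * ((Adt g : (Cl B)ˣ) : Cl B) *
        (((Adt h : (Cl B)ˣ)⁻¹ : (Cl B)ˣ) : Cl B) := by
    rw [map_mul, map_mul, map_inv]
    rfl
  have h2 := pullback_cliffordRep_conj (hAdt.lifts h)
    (involute_pinLift hB hBn hBinv hAdt hn hμ hμinv h) (hBinv h) ((Adt g : (Cl B)ˣ) : Cl B)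
    (homogeneous μ)
  rw [← h1, pullback_homogeneous, hμinv] at h2
  exact h2

variable [LieGroup 𝓘(ℝ, E) ∞ G]

theorem hasParity_spinorDeriv {f : G → Spinor E} (hf : IsSmoothSpinorMap f) {p : ℕ}
    (h : ∀ g, HasParity p (f g)) (g : G) (u : E) : HasParity p (spinorDeriv f g u) := by
  intro k hk
  ext w
  have h1 : (fun g => f g k w) = fun _ => (0 : ℝ) := funext fun g => by rw [h g k hk]; rfl
  rw [spinorDeriv_apply hf, h1, mfderiv_const]
  rfl

theorem isAdInvariant_cartanSpinor (hB : B.IsSymm) (hBn : B.Nondegenerate)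
    (hBinv : ∀ (g : G) (ξ ζ : GroupLieAlgebra 𝓘(ℝ, E) G), B (Ad E g ξ) (Ad E g ζ) = B ξ ζ)
    (hAdt : IsPinLift B Adt) (hn : Module.finrank ℝ E = n)
    {μ : GroupLieAlgebra 𝓘(ℝ, E) G [⋀^Fin n]→ₗ[ℝ] ℝ} (hμ : μ ≠ 0)
    (hμinv : ∀ g : G, μ.compLinearMap (Ad E g) = μ) :
    IsAdInvariant (cartanSpinor B Adt μ) := by
  intro h g
  funext k
  refine AlternatingMap.ext fun w => ?_
  have h1 := pullback_Ad_spinorCoeff hB hBn hBinv hAdt hn hμ hμinv h g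
  have h2 := congrArg (fun ψ : Spinor (GroupLieAlgebra 𝓘(ℝ, E) G) =>
    ψ k fun i => thetaL E g (w i)) h1
  refine Eq.trans ?_ h2
  exact congrArg (spinorCoeff Adt μ (h * g * h⁻¹) k) (funext fun i => thetaL_conj h g (w i))

theorem isPureSpinor_spinorCoeff (hB : B.IsSymm) (hBn : B.Nondegenerate)
    (hBinv : ∀ (g : G) (ξ ζ : GroupLieAlgebra 𝓘(ℝ, E) G), B (Ad E g ξ) (Ad E g ζ) = B ξ ζ)
    (hAdt : IsPinLift B Adt) (hn : Module.finrank ℝ E = n)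
    {μ : GroupLieAlgebra 𝓘(ℝ, E) G [⋀^Fin n]→ₗ[ℝ] ℝ} (hμ : μ ≠ 0) (g : G) :
    IsPureSpinor (spinorCoeff Adt μ g) ∧ nullSpace (spinorCoeff Adt μ g) =
      LinearMap.range ((kappa B).comp ((Ad E g).prod LinearMap.id)) := by
  have h1 : spinorCoeff Adt μ g ≠ 0 := cliffordRep_unit_ne_zero _ (homogeneous_ne_zero hμ)
  have h2 := isLagrangian_range_kappa hB hBn (A := Ad E g) (fun v => ⟨_, Ad_Ad_inv g v⟩) (hBinv g)
  have h3 := nullSpace_eq_of_isLagrangian h2 h1 (by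
    rintro _ ⟨v, rfl⟩
    exact rho_kappa_spinorCoeff hB hAdt hn μ g v)
  exact ⟨⟨h1, h3 ▸ h2⟩, h3⟩

theorem isPureSpinor_cartanSpinor (hB : B.IsSymm) (hBn : B.Nondegenerate)
    (hBinv : ∀ (g : G) (ξ ζ : GroupLieAlgebra 𝓘(ℝ, E) G), B (Ad E g ξ) (Ad E g ζ) = B ξ ζ)
    (hAdt : IsPinLift B Adt) (hn : Module.finrank ℝ E = n)
    {μ : GroupLieAlgebra 𝓘(ℝ, E) G [⋀^Fin n]→ₗ[ℝ] ℝ} (hμ : μ ≠ 0) (g : G) :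
    IsPureSpinor (cartanSpinor B Adt μ g) ∧
      nullSpace (cartanSpinor B Adt μ g) = cartanDirac B g := by
  have h := isPureSpinor_spinorCoeff hB hBn hBinv hAdt hn hμ g
  refine ⟨h.1.pullback (thetaEquiv g), Submodule.ext fun w => ?_⟩
  rw [mem_cartanDirac_iff hB hBinv, ← h.2]
  exact mem_nullSpace_pullback (thetaEquiv g) _ w

/-- An `Ad`-invariant bilinear form on `𝔤` is `ad`-invariant. -/
theorem bilin_lie
    (hBinv : ∀ (g : G) (ξ ζ : GroupLieAlgebra 𝓘(ℝ, E) G), B (Ad E g ξ) (Ad E g ζ) = B ξ ζ)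
    (u v w : GroupLieAlgebra 𝓘(ℝ, E) G) : B ⁅u, v⁆ w = -B v ⁅u, w⁆ :=
  bilin_modelBracket (E := E) (G := G) (B := B) hBinv u v w

/-- The Cartan spinor is closed under the twisted differential: in left trivialization, the form
`(d + η)φ` is annihilated by the null space of `φ`, so that it is a multiple of `φ`, but its
parity is opposite to that of `φ`. -/
theorem twistedD_cartanSpinor (hB : B.IsSymm) (hBn : B.Nondegenerate)
    (hBinv : ∀ (g : G) (ξ ζ : GroupLieAlgebra 𝓘(ℝ, E) G), B (Ad E g ξ) (Ad E g ζ) = B ξ ζ)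
    (hAdt : IsPinLift B Adt) (hn : Module.finrank ℝ E = n)
    {μ : GroupLieAlgebra 𝓘(ℝ, E) G [⋀^Fin n]→ₗ[ℝ] ℝ} (hμ : μ ≠ 0)
    (hμinv : ∀ g : G, μ.compLinearMap (Ad E g) = μ) (g : G) :
    twistedD (cartanThreeForm B) (cartanSpinor B Adt μ) g = 0 := by
  let b := Module.finBasis ℝ (GroupLieAlgebra 𝓘(ℝ, E) G)
  let f := spinorCoeff Adt μ
  let F : GroupLieAlgebra 𝓘(ℝ, E) G →ₗ[ℝ] Spinor (GroupLieAlgebra 𝓘(ℝ, E) G) :=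
    (spinorDeriv (E := E) f g).comp (leftCLM (E := E) g).toLinearMap
  have hf : IsSmoothSpinorMap (E := E) f := isSmoothSpinorMap_spinorCoeff hAdt μ
  have hfp : ∀ g, HasParity n (f g) := hasParity_spinorCoeff hB hBn hBinv hAdt hn hμ hμinv
  obtain ⟨ψ, hψ⟩ : ∃ ψ, ψ = (∑ i, extMul (b.coord i) (F (b i))) + chevalleyEilenberg b (f g) +
    threeFormMul (lieThreeForm B) (f g) := ⟨_, rfl⟩
  have h0 : twistedD (cartanThreeForm B) (cartanSpinor B Adt μ) g = pullback (thetaL E g) ψ := by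
    rw [hψ, pullback_add, pullback_threeFormMul]
    exact congrArg (· + _) (extDSpinor_leftTrivialized (E := E) b hf g)
  -- The derivative of `ρ(e)φ = 0`, and the invariance of `φ` under conjugation.
  have hF1 : ∀ ξ v, rho (kappa B (Ad E g v, v)) (F ξ) +
      rho (kappa B (Ad E g ⁅ξ, v⁆, 0)) (f g) = 0 := fun ξ v =>
    rho_kappa_spinorDeriv (E := E) (B := B) hf v
      (fun g => rho_kappa_spinorCoeff hB hAdt hn μ g v) g ξ
  have hinv : ∀ (g h : G) (k : ℕ) (w : Fin k → E),
      f (h * g) k (fun i => AdCLM (E := E) h (w i)) = f (g * h) k w := fun g h k w => by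
    have h1 := pullback_Ad_spinorCoeff hB hBn hBinv hAdt hn hμ hμinv h (g * h)
    rw [← mul_assoc, mul_inv_cancel_right] at h1
    exact congrArg (fun ψ : Spinor (GroupLieAlgebra 𝓘(ℝ, E) G) => ψ k w) h1
  have hF2 : ∀ v, F (Ad E g v - v) = formDerivation (LieAlgebra.ad ℝ _ (Ad E g v)) (f g) := by
    intro v
    funext k
    refine AlternatingMap.ext fun w => ?_
    rw [formDerivation_apply]
    refine Eq.trans ?_ (spinorDeriv_sub_of_invariant (E := E) hf hinv g (AdCLM (E := E) g v) k w)
    have h1 : ∀ v : E, leftCLM (E := E) g (AdCLM (E := E) g v) -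
        rightCLM (E := E) g (AdCLM (E := E) g v) = leftCLM (E := E) g (AdCLM (E := E) g v - v) :=
      fun v => by rw [rightCLM_AdCLM, map_sub]
    exact congrArg (fun u : E => spinorDeriv (E := E) f g u k w) (h1 v).symm
  have hψ1 : ∀ v, rho (kappa B (Ad E g v, v)) ψ = 0 := fun v => by
    rw [hψ]
    exact rho_twistedDifferential_eq_zero b B hB (bilin_lie hBinv) (lieThreeForm B)
      (fun x y z => lieThreeForm_apply (bilin_lie hBinv) _) (Ad E g) (f g) F
      (rho_kappa_spinorCoeff hB hAdt hn μ g) hF1 hF2 v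
  obtain ⟨c, hc⟩ := exists_eq_smul_of_rho_kappa hB hBn hn μ hμ (hAdt.lifts g) ψ hψ1
  -- `d` and `η ∧ ·` both change the parity.
  have hp : HasParity (n + 1) ψ := by
    rw [hψ]
    refine (HasParity.add (.sum fun i => ?_) (hasParity_chevalleyEilenberg b (hfp g))).add
      ((hfp g).threeFormMul _)
    exact HasParity.extMul (hasParity_spinorDeriv (E := E) hf hfp g _) _
  have h1 : ψ = 0 := HasParity.eq_zero (hc ▸ (hfp g).smul c) hp
  rw [h0, h1, pullback_zero]

end CartanSpinor

/-! ### The Cartan three-form -/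

theorem isSmoothSpinorMap_homogeneous {E : Type*} [NormedAddCommGroup E] [NormedSpace ℝ E]
    {M : Type*} [TopologicalSpace M] [ChartedSpace E M] {n : ℕ} {c : M → E [⋀^Fin n]→ₗ[ℝ] ℝ}
    (hc : ∀ w, ContMDiff 𝓘(ℝ, E) 𝓘(ℝ, ℝ) ∞ (fun x => c x w)) :
    IsSmoothSpinorMap (fun x => homogeneous (c x)) := by
  intro k w
  rcases eq_or_ne k n with rfl | h
  · simp only [homogeneous_self]
    exact hc w
  · simp only [homogeneous_of_ne _ h]
    exact contMDiff_const

theorem spinorDeriv_const {E : Type*} [NormedAddCommGroup E] [NormedSpace ℝ E]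
    [FiniteDimensional ℝ E] {M : Type*} [TopologicalSpace M] [ChartedSpace E M]
    [IsManifold 𝓘(ℝ, E) ∞ M] (ψ : Spinor E) (x : M) (u : E) :
    spinorDeriv (fun _ : M => ψ) x u = 0 := by
  funext k
  refine AlternatingMap.ext fun w => ?_
  rw [spinorDeriv_apply (fun _ _ => contMDiff_const), mfderiv_const]
  rfl

section CartanThreeForm

variable {E : Type*} [NormedAddCommGroup E] [NormedSpace ℝ E] [FiniteDimensional ℝ E]
  {G : Type*} [TopologicalSpace G] [ChartedSpace E G] [Group G] [LieGroup 𝓘(ℝ, E) ∞ G]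
  {B : LinearMap.BilinForm ℝ (GroupLieAlgebra 𝓘(ℝ, E) G)}

theorem cartanThreeForm_eq (B : LinearMap.BilinForm ℝ (GroupLieAlgebra 𝓘(ℝ, E) G)) :
    cartanThreeForm B =
      fun g => leftTrivialized (E := E) (fun _ : G => homogeneous (lieThreeForm B)) g 3 := by
  funext g
  change _ = (homogeneous (lieThreeForm B) 3).compLinearMap (thetaL E g)
  rw [homogeneous_self]
  rfl

theorem isSmoothFormOn_cartanThreeForm
    (B : LinearMap.BilinForm ℝ (GroupLieAlgebra 𝓘(ℝ, E) G)) :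
    IsSmoothFormOn (cartanThreeForm B) Set.univ := by
  rw [cartanThreeForm_eq]
  exact isSmoothSpinorOn_leftTrivialized (E := E) (fun _ _ => contMDiff_const) 3

/-- The Cartan 3-form on the Lie algebra is `ad`-invariant: this is the Jacobi identity. -/
theorem formDerivation_lieThreeForm
    (hBad : ∀ u v w : GroupLieAlgebra 𝓘(ℝ, E) G, B ⁅u, v⁆ w = -B v ⁅u, w⁆) (c : ℝ)
    (u : GroupLieAlgebra 𝓘(ℝ, E) G) :
    formDerivation (c • LieAlgebra.ad ℝ _ u) (homogeneous (lieThreeForm B)) = 0 := by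
  funext k
  refine AlternatingMap.ext fun w => ?_
  rw [formDerivation_apply]
  rcases eq_or_ne k 3 with rfl | h
  · have h1 : B ⁅u, w 0⁆ ⁅w 1, w 2⁆ + B (w 0) ⁅⁅u, w 1⁆, w 2⁆ + B (w 0) ⁅w 1, ⁅u, w 2⁆⁆ = 0 := by
      rw [hBad, leibniz_lie u (w 1) (w 2), map_add]
      ring
    have h01 : (0 : Fin 3) ≠ 1 := by decide
    have h02 : (0 : Fin 3) ≠ 2 := by decide
    have h12 : (1 : Fin 3) ≠ 2 := by decide
    rw [homogeneous_self, Fin.sum_univ_three]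
    simp only [lieThreeForm_apply hBad, Function.update_self, Function.update_of_ne h01,
      Function.update_of_ne h02, Function.update_of_ne h12, Function.update_of_ne h01.symm,
      Function.update_of_ne h02.symm, Function.update_of_ne h12.symm, LinearMap.smul_apply,
      LieAlgebra.ad_apply, smul_lie, lie_smul, map_smul, smul_eq_mul]
    change _ = (0 : ℝ)
    linear_combination c / 2 * h1
  · rw [homogeneous_of_ne _ h]
    simp

/-- Invariant forms are closed. -/
theorem chevalleyEilenberg_lieThreeForm
    (hBad : ∀ u v w : GroupLieAlgebra 𝓘(ℝ, E) G, B ⁅u, v⁆ w = -B v ⁅u, w⁆) {ι : Type*} [Fintype ι]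
    (b : Module.Basis ι ℝ (GroupLieAlgebra 𝓘(ℝ, E) G)) :
    chevalleyEilenberg b (homogeneous (lieThreeForm B)) = 0 := by
  rw [← formDerivation_sum_eq_chevalleyEilenberg b
    (-(1 / 2 : ℝ) • (LieAlgebra.ad ℝ (GroupLieAlgebra 𝓘(ℝ, E) G) :
      GroupLieAlgebra 𝓘(ℝ, E) G →ₗ[ℝ] Module.End ℝ (GroupLieAlgebra 𝓘(ℝ, E) G)))]
  · refine Finset.sum_eq_zero fun i _ => ?_
    rw [LinearMap.smul_apply]
    exact (congrArg _ (formDerivation_lieThreeForm hBad _ _)).trans (map_zero _)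
  · intro ξ ζ
    change -(1 / 2 : ℝ) • ⁅ξ, ζ⁆ - -(1 / 2 : ℝ) • ⁅ζ, ξ⁆ = -⁅ξ, ζ⁆
    rw [← lie_skew ζ ξ]
    module

theorem extD_cartanThreeForm
    (hBinv : ∀ (g : G) (ξ ζ : GroupLieAlgebra 𝓘(ℝ, E) G), B (Ad E g ξ) (Ad E g ζ) = B ξ ζ)
    (g : G) : extD (cartanThreeForm B) g = 0 := by
  let f : G → Spinor (GroupLieAlgebra 𝓘(ℝ, E) G) := fun _ => homogeneous (lieThreeForm B)
  have hf : IsSmoothSpinorMap (E := E) f := fun k w =>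
    contMDiff_const (c := homogeneous (lieThreeForm B) k w)
  have hd : ∀ u : E, spinorDeriv (E := E) f g u = 0 :=
    fun u => spinorDeriv_const (E := E) (homogeneous (lieThreeForm B)) g u
  have h := extDSpinor_leftTrivialized (E := E)
    (Module.finBasis ℝ (GroupLieAlgebra 𝓘(ℝ, E) G)) hf g
  rw [chevalleyEilenberg_lieThreeForm (bilin_lie hBinv), add_zero] at h
  have h1 := h.trans (congrArg (pullback (thetaL E g)) (Finset.sum_eq_zero fun i _ =>
    (congrArg (extMul _) (hd _)).trans (map_zero _)))
  rw [cartanThreeForm_eq]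
  exact congrFun h1 4

end CartanThreeForm

/-! ### Smoothness of the Cartan-Dirac sub-bundle -/

section Subbundle

variable {E : Type*} [NormedAddCommGroup E] [NormedSpace ℝ E]
  {G : Type*} [TopologicalSpace G] [ChartedSpace E G] [Group G] [LieGroup 𝓘(ℝ, E) ∞ G]
  {B : LinearMap.BilinForm ℝ (GroupLieAlgebra 𝓘(ℝ, E) G)}

/-- The sections `e(ξ)` do not degenerate: `κ` is injective. -/
theorem injective_cartanMap (hB : B.IsSymm) (hBn : B.Nondegenerate)
    (hBinv : ∀ (g : G) (ξ ζ : GroupLieAlgebra 𝓘(ℝ, E) G), B (Ad E g ξ) (Ad E g ζ) = B ξ ζ)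
    (g : G) : Function.Injective (cartanMap B g) := by
  rw [← LinearMap.ker_eq_bot, LinearMap.ker_eq_bot']
  intro ξ hξ
  have h := doubleMap_cartanMap hB hBinv g (Ad E g⁻¹ ξ)
  rw [Ad_Ad_inv, hξ, map_zero, kappa_apply] at h
  have h1 : Ad E g⁻¹ ξ = ξ := (sub_eq_zero.1 (congrArg Prod.fst h).symm).symm
  have h2 : (0 : Module.Dual ℝ (GroupLieAlgebra 𝓘(ℝ, E) G)) =
    (1 / 2 : ℝ) • B (ξ + Ad E g⁻¹ ξ) := congrArg Prod.snd h
  rw [h1, ← two_smul ℝ ξ, map_smul, smul_smul] at h2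
  norm_num at h2
  exact hBn.1 ξ fun y => by rw [← h2]; rfl

variable [FiniteDimensional ℝ E]

theorem contMDiff_linearMap_add_AdCLM (ℓ : E →ₗ[ℝ] ℝ) (v : E) :
    ContMDiff 𝓘(ℝ, E) 𝓘(ℝ, ℝ) ∞ (fun g : G => ℓ (v + AdCLM g v)) :=
  ℓ.toContinuousLinearMap.contMDiff.comp (contMDiff_const.add (contMDiff_AdCLM v))

theorem isSmoothSectionOn_cartanMap (B : LinearMap.BilinForm ℝ (GroupLieAlgebra 𝓘(ℝ, E) G))
    (ξ : GroupLieAlgebra 𝓘(ℝ, E) G) :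
    IsSmoothSectionOn (fun g : G => cartanMap B g ξ) Set.univ := by
  constructor
  · exact (contMDiff_leftField ξ).contMDiffOn.sub_section (contMDiff_rightField ξ).contMDiffOn
  · let α : G → GroupLieAlgebra 𝓘(ℝ, E) G [⋀^Fin 1]→ₗ[ℝ] ℝ := fun g =>
      AlternatingMap.ofSubsingleton ℝ (GroupLieAlgebra 𝓘(ℝ, E) G) ℝ (0 : Fin 1)
        ((B.flip ξ).comp ((1 / 2 : ℝ) • (LinearMap.id + Ad E g)))
    have h1 : (fun g : G => AlternatingMap.ofSubsingleton ℝ (TangentSpace 𝓘(ℝ, E) g) ℝ (0 : Fin 1)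
        (cartanMap B g ξ).2) =
        fun g => leftTrivialized (E := E) (fun g => homogeneous (α g)) g 1 := by
      funext g
      have h2 : leftTrivialized (E := E) (fun g => homogeneous (α g)) g 1 =
          (α g).compLinearMap (thetaL E g) :=
        congrArg (fun β : GroupLieAlgebra 𝓘(ℝ, E) G [⋀^Fin 1]→ₗ[ℝ] ℝ =>
          β.compLinearMap (thetaL E g)) (homogeneous_self (α g))
      rw [h2]
      refine AlternatingMap.ext fun w => ?_
      change B ((1 / 2 : ℝ) • (thetaL E g (w 0) + thetaR E g (w 0))) ξ = _
      rw [thetaR_eq]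
      rfl
    rw [h1]
    refine isSmoothSpinorOn_leftTrivialized (E := E)
      (isSmoothSpinorMap_homogeneous (E := E) fun w => ?_) 1
    exact contMDiff_linearMap_add_AdCLM (E := E) (G := G)
      ((B.flip ξ).comp ((1 / 2 : ℝ) • LinearMap.id)) (w 0)

/-- In left trivialization, `E_g` is the graph-type subspace of the isometry `Ad_g`. -/
theorem isLagrangian_cartanDirac (hB : B.IsSymm) (hBn : B.Nondegenerate)
    (hBinv : ∀ (g : G) (ξ ζ : GroupLieAlgebra 𝓘(ℝ, E) G), B (Ad E g ξ) (Ad E g ζ) = B ξ ζ)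
    (g : G) : IsLagrangian (cartanDirac B g) := by
  intro w
  rw [mem_cartanDirac_iff hB hBinv, isLagrangian_range_kappa hB hBn
    (A := Ad E g) (fun v => ⟨_, Ad_Ad_inv g v⟩) (hBinv g) (doubleMap (thetaEquiv g) w)]
  constructor
  · intro h w' hw'
    rw [← pairing_doubleMap (thetaEquiv g)]
    exact h _ ((mem_cartanDirac_iff hB hBinv g w').1 hw')
  · intro h w' hw'
    obtain ⟨u, rfl⟩ := (doubleMap (thetaEquiv g)).surjective w'
    rw [pairing_doubleMap]
    exact h u ((mem_cartanDirac_iff hB hBinv g u).2 hw')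

/-- The sections `e(eᵢ)` for a basis `eᵢ` of `𝔤` are a global smooth frame of `E`. -/
theorem isAlmostDirac_cartanDirac (hB : B.IsSymm) (hBn : B.Nondegenerate)
    (hBinv : ∀ (g : G) (ξ ζ : GroupLieAlgebra 𝓘(ℝ, E) G), B (Ad E g ξ) (Ad E g ζ) = B ξ ζ) :
    IsAlmostDirac (cartanDirac B) := by
  let b := Module.finBasis ℝ (GroupLieAlgebra 𝓘(ℝ, E) G)
  refine ⟨fun x₀ => ⟨Set.univ, isOpen_univ, Set.mem_univ x₀, _, fun i g => cartanMap B g (b i),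
    fun i => isSmoothSectionOn_cartanMap B (b i), fun g _ => ⟨?_, ?_⟩⟩,
    isLagrangian_cartanDirac hB hBn hBinv⟩
  · exact b.linearIndependent.map' (cartanMap B g)
      (LinearMap.ker_eq_bot.2 (injective_cartanMap hB hBn hBinv g))
  · rw [Set.range_comp' (cartanMap B g) b, Submodule.span_image, b.span_eq, Submodule.map_top]
    rfl

end Subbundle

/-! ### Courant integrability -/

section Integrability

open Set Filter
open scoped Topology

theorem threeFormMul_smul {V : Type*} [AddCommGroup V] [Module ℝ V] [FiniteDimensional ℝ V]
    (η : V [⋀^Fin 3]→ₗ[ℝ] ℝ) (c : ℝ) (ψ : Spinor V) :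
    threeFormMul η (c • ψ) = c • threeFormMul η ψ := by
  simp only [threeFormMul_eq_sum (Module.finBasis ℝ V), map_smul, Finset.smul_sum, smul_comm c]

/-- If `φ` is annihilated by `L`, then `α ∧ φ` lies in the first step of the filtration. -/
theorem inFiltration_two_extMul {V : Type*} [AddCommGroup V] [Module ℝ V]
    {L : Submodule ℝ (Double V)} {φ : Spinor V} (h : ∀ w ∈ L, rho w φ = 0) (α : Module.Dual ℝ V) :
    InFiltration L 2 (extMul α φ) := by
  intro w hw w' hw' w'' _
  rw [rho_extMul, h w hw, map_zero, sub_zero, map_smul, h w' hw', smul_zero, map_zero]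

variable {E : Type*} [NormedAddCommGroup E] [NormedSpace ℝ E] [FiniteDimensional ℝ E]
  {M : Type*} [TopologicalSpace M] [ChartedSpace E M] [IsManifold 𝓘(ℝ, E) ∞ M]

theorem formInChart_self {k : ℕ} (β : FormField E M k) (x : M) (w : Fin k → E) :
    formInChart x β (extChartAt 𝓘(ℝ, E) x x) w = β x w := by
  have h : ∀ z : M, z = x → ∀ u : Fin k → E, (β z : E [⋀^Fin k]→ₗ[ℝ] ℝ) u = β x u := by
    rintro _ rfl u
    rfl
  refine (h _ (extChartAt_to_inv x) _).trans ?_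
  refine congrArg (β x) (funext fun i => ?_)
  exact DFunLike.congr_fun (chartSymmDeriv_self x) (w i)

/-- If a form `φ'` is pointwise a multiple of a form `φ` that does not vanish at `x`, then the
factor is differentiable at `x`, and its derivative `α` enters `dφ'` by a Leibniz rule. -/
theorem exists_extDSpinor_eq {φ φ' : SpinorField E M} {x : M}
    (hφ : ∀ k, DifferentiableAt ℝ (formInChart x (fun x => φ x k)) (extChartAt 𝓘(ℝ, E) x x))
    (hφ' : ∀ k, DifferentiableAt ℝ (formInChart x (fun x => φ' x k)) (extChartAt 𝓘(ℝ, E) x x))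
    (hx : φ x ≠ 0) (h : ∀ᶠ z in 𝓝 x, ∃ c : ℝ, φ' z = c • φ z) :
    ∃ (c : ℝ) (α : Module.Dual ℝ (TangentSpace 𝓘(ℝ, E) x)), φ' x = c • φ x ∧
      extDSpinor φ' x = c • extDSpinor φ x + extMul α (φ x) := by
  obtain ⟨k₀, hk₀⟩ := Function.ne_iff.1 hx
  obtain ⟨w₀, hw₀⟩ : ∃ w₀, φ x k₀ w₀ ≠ 0 := by
    by_contra! h1
    exact hk₀ (AlternatingMap.ext h1)
  let y₀ := extChartAt 𝓘(ℝ, E) x x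
  let ev : (E [⋀^Fin k₀]→L[ℝ] ℝ) →L[ℝ] ℝ := ContinuousAlternatingMap.apply ℝ E ℝ w₀
  let a : E → ℝ := fun y => ev (formInChart x (fun x => φ x k₀) y)
  let a' : E → ℝ := fun y => ev (formInChart x (fun x => φ' x k₀) y)
  have ha : DifferentiableAt ℝ a y₀ := ev.differentiableAt.comp y₀ (hφ k₀)
  have ha' : DifferentiableAt ℝ a' y₀ := ev.differentiableAt.comp y₀ (hφ' k₀)
  have ha0 : a y₀ ≠ 0 := by
    have h1 : a y₀ = φ x k₀ w₀ := formInChart_self (fun x => φ x k₀) x w₀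
    rwa [h1]
  -- The factor between the two forms, as the quotient of a pair of their components.
  let H : E → ℝ := fun y => a' y * (a y)⁻¹
  have hH : DifferentiableAt ℝ H y₀ := ha'.mul (ha.inv ha0)
  have h1 : ∀ᶠ y in 𝓝 y₀, ∀ k, formInChart x (fun x => φ' x k) y =
      H y • formInChart x (fun x => φ x k) y := by
    have h2 : Tendsto (extChartAt 𝓘(ℝ, E) x).symm (𝓝 y₀) (𝓝 x) := by
      have h3 := continuousAt_extChartAt_symm (I := 𝓘(ℝ, E)) x
      rw [ContinuousAt, extChartAt_to_inv] at h3
      exact h3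
    filter_upwards [h2.eventually h, ha.continuousAt.eventually_ne ha0] with y hy hay
    obtain ⟨c, hc⟩ := hy
    have h4 : ∀ k, formInChart x (fun x => φ' x k) y = c • formInChart x (fun x => φ x k) y :=
      fun k => ContinuousAlternatingMap.ext fun w =>
        congrArg (fun ψ : Spinor E => ψ k fun i => chartSymmDeriv x y (w i)) hc
    have h5 : a' y = c * a y := congrArg ev (h4 k₀)
    have h6 : H y = c := by rw [show H y = a' y * (a y)⁻¹ from rfl, h5, mul_inv_cancel_right₀ hay]
    rw [h6]
    exact h4
  obtain ⟨α, hα⟩ : ∃ α : E →L[ℝ] ℝ, α = fderiv ℝ H y₀ := ⟨_, rfl⟩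
  refine ⟨H y₀, α.toLinearMap, ?_, ?_⟩
  · funext k
    refine AlternatingMap.ext fun w => ?_
    refine (formInChart_self (fun x => φ' x k) x w).symm.trans ?_
    rw [h1.self_of_nhds k]
    exact congrArg (H y₀ * ·) (formInChart_self (fun x => φ x k) x w)
  · funext k
    cases k with
    | zero =>
      change (0 : TangentSpace 𝓘(ℝ, E) x [⋀^Fin 0]→ₗ[ℝ] ℝ) = H y₀ • 0 + 0
      rw [smul_zero, add_zero]
    | succ k =>
      refine AlternatingMap.ext fun (v : Fin (k + 1) → E) => ?_
      have hd : ∀ u : E, fderiv ℝ (formInChart x (fun x => φ' x k)) y₀ u =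
          H y₀ • fderiv ℝ (formInChart x (fun x => φ x k)) y₀ u +
            α u • formInChart x (fun x => φ x k) y₀ := fun u => by
        have h7 : formInChart x (fun x => φ' x k) =ᶠ[𝓝 y₀]
            fun y => H y • formInChart x (fun x => φ x k) y := h1.mono fun y hy => hy k
        rw [h7.fderiv_eq, fderiv_fun_smul hH (hφ k), hα]
        rfl
      have e1 : ∀ χ : SpinorField E M, extDSpinor χ x (k + 1) v = ∑ i : Fin (k + 1),
          (-1 : ℝ) ^ (i : ℕ) * fderiv ℝ (formInChart x (fun x => χ x k)) y₀ (v i)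
            (i.removeNth v) := fun χ => by
        change ContinuousAlternatingMap.alternatizeUncurryFin
          (fderiv ℝ (formInChart x (fun x => χ x k)) y₀) (fun i => chartDeriv x x (v i)) = _
        rw [ContinuousAlternatingMap.alternatizeUncurryFin_apply, chartDeriv_self]
        refine Finset.sum_congr rfl fun i _ => ?_
        rw [zsmul_eq_mul, Int.cast_pow, Int.cast_neg, Int.cast_one]
        rfl
      have e2 : extMul (α.toLinearMap : Module.Dual ℝ (TangentSpace 𝓘(ℝ, E) x)) (φ x) (k + 1) v =
          ∑ i : Fin (k + 1), (-1 : ℝ) ^ (i : ℕ) * (α (v i) * φ x k (i.removeNth v)) :=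
        covectorWedge_apply _ _ _
      change extDSpinor φ' x (k + 1) v = H y₀ * extDSpinor φ x (k + 1) v +
        extMul (α.toLinearMap : Module.Dual ℝ (TangentSpace 𝓘(ℝ, E) x)) (φ x) (k + 1) v
      rw [e1, e1, e2, Finset.mul_sum, ← Finset.sum_add_distrib]
      refine Finset.sum_congr rfl fun i _ => ?_
      rw [hd, ← formInChart_self (fun x => φ x k) x (i.removeNth v)]
      have hr : ∀ s p q r t : ℝ, s * (p * q + r * t) = p * (s * q) + s * (r * t) := by
        intros
        ring
      exact hr _ _ _ _ _

end Integrability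

section CartanIntegrability

open Set Filter
open scoped Topology

variable {E : Type*} [NormedAddCommGroup E] [NormedSpace ℝ E] [FiniteDimensional ℝ E]
  {G : Type*} [TopologicalSpace G] [ChartedSpace E G] [Group G] [LieGroup 𝓘(ℝ, E) ∞ G]
  {B : LinearMap.BilinForm ℝ (GroupLieAlgebra 𝓘(ℝ, E) G)} {Adt : G →* pinGroup B} {n : ℕ}

/-- The spinors at `g` annihilated by `E_g` are the multiples of `φ_g`. -/
theorem exists_eq_smul_cartanSpinor (hB : B.IsSymm) (hBn : B.Nondegenerate)
    (hBinv : ∀ (g : G) (ξ ζ : GroupLieAlgebra 𝓘(ℝ, E) G), B (Ad E g ξ) (Ad E g ζ) = B ξ ζ)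
    (hAdt : IsPinLift B Adt) (hn : Module.finrank ℝ E = n)
    {μ : GroupLieAlgebra 𝓘(ℝ, E) G [⋀^Fin n]→ₗ[ℝ] ℝ} (hμ : μ ≠ 0) {g : G}
    {ψ : Spinor (TangentSpace 𝓘(ℝ, E) g)} (hψ : ∀ w ∈ cartanDirac B g, rho w ψ = 0) :
    ∃ c : ℝ, ψ = c • cartanSpinor B Adt μ g := by
  obtain ⟨χ, rfl⟩ : ∃ χ, ψ = pullback (thetaEquiv g).toLinearMap χ :=
    ⟨pullback (thetaEquiv g).symm.toLinearMap ψ, funext fun k => AlternatingMap.ext fun w =>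
      congrArg (ψ k) (funext fun i => ((thetaEquiv g).symm_apply_apply (w i)).symm)⟩
  obtain ⟨c, rfl⟩ := exists_eq_smul_of_rho_kappa hB hBn hn μ hμ (hAdt.lifts g) χ fun v => by
    rw [← doubleMap_cartanMap hB hBinv g v]
    exact (mem_nullSpace_pullback (thetaEquiv g) χ _).1 (hψ _ ⟨_, rfl⟩)
  exact ⟨c, pullback_smul _ _ _⟩

/-- A pure spinor defining `E` is locally a function times `φ`, so that its twisted differential is
the product of `φ` and a 1-form. -/
theorem isIntegrable_cartanDirac (hB : B.IsSymm) (hBn : B.Nondegenerate)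
    (hBinv : ∀ (g : G) (ξ ζ : GroupLieAlgebra 𝓘(ℝ, E) G), B (Ad E g ξ) (Ad E g ζ) = B ξ ζ)
    (hAdt : IsPinLift B Adt) (hn : Module.finrank ℝ E = n)
    {μ : GroupLieAlgebra 𝓘(ℝ, E) G [⋀^Fin n]→ₗ[ℝ] ℝ} (hμ : μ ≠ 0)
    (hμinv : ∀ g : G, μ.compLinearMap (Ad E g) = μ) :
    IsIntegrable (cartanDirac B) (cartanThreeForm B) := by
  intro U φ' hU hφ' hpure x hx
  have hx0 := isPureSpinor_cartanSpinor hB hBn hBinv hAdt hn hμ x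
  have hnull : ∀ g ∈ U, ∀ w ∈ cartanDirac B g, rho w (φ' g) = 0 := fun g hg w hw =>
    mem_nullSpace.1 ((hpure g hg).2.symm ▸ hw)
  have hd : ∀ k, DifferentiableAt ℝ (formInChart x (fun g => cartanSpinor B Adt μ g k))
      (extChartAt 𝓘(ℝ, E) x x) := fun k =>
    ((contDiffOn_formInChart_leftTrivialized (E := E) k
      (isSmoothSpinorMap_spinorCoeff hAdt μ k) x).contDiffAt
        (extChartAt_target_mem_nhds x)).differentiableAt (by simp)
  have hd' : ∀ k, DifferentiableAt ℝ (formInChart x (fun g => φ' g k))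
      (extChartAt 𝓘(ℝ, E) x x) := fun k => by
    refine ((hφ' k x).contDiffAt (IsOpen.mem_nhds ?_ ?_)).differentiableAt (by simp)
    · exact (continuousOn_extChartAt_symm x).isOpen_inter_preimage (isOpen_extChartAt_target x) hU
    · refine ⟨mem_extChartAt_target x, ?_⟩
      rw [mem_preimage, extChartAt_to_inv]
      exact hx
  obtain ⟨c, α, hc, hα⟩ := exists_extDSpinor_eq hd hd' hx0.1.1
    ((hU.eventually_mem hx).mono fun g hg =>
    exists_eq_smul_cartanSpinor hB hBn hBinv hAdt hn hμ (hnull g hg))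
  have h1 : twistedD (cartanThreeForm B) φ' x = extMul α (cartanSpinor B Adt μ x) := by
    have h2 : extDSpinor (cartanSpinor B Adt μ) x +
        threeFormMul (cartanThreeForm B x) (cartanSpinor B Adt μ x) = 0 :=
      twistedD_cartanSpinor hB hBn hBinv hAdt hn hμ hμinv x
    have h3 : threeFormMul (cartanThreeForm B x) (φ' x) =
        c • threeFormMul (cartanThreeForm B x) (cartanSpinor B Adt μ x) := by
      rw [hc]
      exact threeFormMul_smul (V := E) _ _ _
    rw [twistedD, hα, h3, add_right_comm, ← smul_add, h2, smul_zero, zero_add]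
  rw [h1]
  exact inFiltration_two_extMul (fun w hw => mem_nullSpace.1 (hx0.2.symm ▸ hw)) α

end CartanIntegrability

end CartanDirac

end

/-- Integrability of the Cartan-Dirac structure. -/
theorem mainTheorem3
    {E : Type*} [NormedAddCommGroup E] [NormedSpace ℝ E] [FiniteDimensional ℝ E]
    {G : Type*} [TopologicalSpace G] [ChartedSpace E G] [Group G] [LieGroup 𝓘(ℝ, E) ∞ G]
    (B : LinearMap.BilinForm ℝ (GroupLieAlgebra 𝓘(ℝ, E) G))
    (hBsymm : B.IsSymm) (hBnondeg : B.Nondegenerate)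
    (hBinv : ∀ (g : G) (ξ ζ : GroupLieAlgebra 𝓘(ℝ, E) G),
      B (CartanDirac.Ad E g ξ) (CartanDirac.Ad E g ζ) = B ξ ζ)
    (μ : GroupLieAlgebra 𝓘(ℝ, E) G [⋀^Fin (Module.finrank ℝ E)]→ₗ[ℝ] ℝ) (hμ : μ ≠ 0)
    (hμinv : ∀ g : G, μ.compLinearMap (CartanDirac.Ad E g) = μ)
    (Adt : G →* CartanDirac.pinGroup B) (hAdt : CartanDirac.IsPinLift B Adt) :
    CartanDirac.IsSmoothSpinorOn (CartanDirac.cartanSpinor B Adt μ) Set.univ ∧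
    CartanDirac.IsAdInvariant (CartanDirac.cartanSpinor B Adt μ) ∧
    (∀ g : G, CartanDirac.IsPureSpinor (CartanDirac.cartanSpinor B Adt μ g) ∧
      CartanDirac.nullSpace (CartanDirac.cartanSpinor B Adt μ g) = CartanDirac.cartanDirac B g) ∧
    (∀ g : G, CartanDirac.twistedD (CartanDirac.cartanThreeForm B)
      (CartanDirac.cartanSpinor B Adt μ) g = 0) ∧
    CartanDirac.IsDirac (CartanDirac.cartanDirac B) (CartanDirac.cartanThreeForm B) := by
  have hn : Module.finrank ℝ E = Module.finrank ℝ E := rfl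
  refine ⟨?_, ?_, ?_, ?_, ?_, ?_, ?_, ?_⟩
  · exact CartanDirac.isSmoothSpinorOn_leftTrivialized (E := E)
      (CartanDirac.isSmoothSpinorMap_spinorCoeff hAdt μ)
  · exact CartanDirac.isAdInvariant_cartanSpinor hBsymm hBnondeg hBinv hAdt hn hμ hμinv
  · exact CartanDirac.isPureSpinor_cartanSpinor hBsymm hBnondeg hBinv hAdt hn hμ
  · exact CartanDirac.twistedD_cartanSpinor hBsymm hBnondeg hBinv hAdt hn hμ hμinv
  · exact CartanDirac.isSmoothFormOn_cartanThreeForm B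
  · exact CartanDirac.extD_cartanThreeForm hBinv
  · exact CartanDirac.isAlmostDirac_cartanDirac hBsymm hBnondeg hBinv
  · exact CartanDirac.isIntegrable_cartanDirac hBsymm hBnondeg hBinv hAdt hn hμ hμinv
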